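/- All graphs are finite, simple and undirected. Let $V(G)$ and $E(G)$ denote the vertex set and the edge set of a graph $G$. A graph is *matchable* if it has a perfect matching (the graph without vertices is matchable), and a connected graph is *matching covered* if each of its edges belongs to a perfect matching. For a matchable graph $G$: - the *global forcing number* $gf(G)$ is the smallest size of a set $S\subseteq E(G)$ such that $S\cap M_1\neq S\cap M_2$ for all distinct perfect matchings $M_1,M_2$ of $G$; - for a perfect matching $M$ of $G$, $af(G,M)$ is the smallest size of a set $S\subseteq E(G)\setminus M$ such that $M$ is the only perfect matching of $G-S$, and $Af(G)$ is the maximum of $af(G,M)$ over all perfect matchings $M$ of $G$; - a subgraph $H$ of $G$ is *conformal* if $G-V(H)$ is matchable; - $G$ is *strongly uniform* if $gf(H)=Af(H)$ for every conformal matchable subgraph $H$ of $G$; - a *bisubdivision* of a graph $J$ is a graph obtained from $J$ by replacing the edges in some set of edges by internally disjoint paths of odd length; $J$ is a *conformal minor* of $G$ if some conformal subgraph of $G$ is isomorphic to a bisubdivision of $J$. Let $A_1$ be the graph formed by three internally disjoint paths of length $3$ between two vertices; $A_2$ the cycle $v_0v_1\cdots v_7v_0$ with the two chords $v_0v_3,\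 v_0v_5$; $A_3$ the cycle $v_0v_1\cdots v_9v_0$ with the two chords $v_0v_3,\ v_5v_8$; and $A_4=K_{3,3}$. Let $C$ be an even cycle whose vertices are properly colored black and white. A *chord* of $C$ is an edge not in $C$ with both ends on $C$. Let $x_1x_2$ and $y_1y_2$ be two disjoint chords of $C$ such that $x_1$ and $y_1$ have the same color. They are *parallel* if their ends appear along $C$ in the cyclic order $x_1,x_2,y_1,y_2$ (in one of the two directions), and *strongly crossed* if they appear in the cyclic order $x_1,y_1,x_2,y_2$ (in one of the two directions) and $x_1y_2,\ x_2y_1\in E(C)$. **Theorem.** Let $G$ be a matching covered bipartite graph with at least four vertices. The following are equivalent: i) $G$ is strongly uniform; ii) $G$ has no conformal minor in $\{A_1,A_2,A_3,A_4\}$; iii) $G$ is an even cycle; or $G$ is bipartite and consists of a Hamilton cycle and exactly one chord; or $G$ consists of a Hamilton cycle and exactly two chords, which are strongly crossed; or $G$ is bipartite and consists of a Hamilton cycle together with pairwise parallel chords. -/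

import Mathlib

namespace ForcingGraphs

open SimpleGraph

universe u v

/-- The perfect matchings of `G`, as sets of edges. -/
def perfectMatchings {V : Type u} (G : SimpleGraph V) : Set (Set (Sym2 V)) :=
  {M | ∃ N : G.Subgraph, N.IsPerfectMatching ∧ N.edgeSet = M}

/-- `G` has a perfect matching. (The graph without vertices has one, the empty matching.) -/
def Matchable {V : Type u} (G : SimpleGraph V) : Prop :=
  (perfectMatchings G).Nonempty

/-- A connected graph is matching covered if each of its edges lies in a perfect matching. -/
def MatchingCovered {V : Type u} (G : SimpleGraph V) : Prop :=
  G.Connected ∧ ∀ e ∈ G.edgeSet, ∃ M ∈ perfectMatchings G, e ∈ M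

/-- A set of edges of `G` that distinguishes all perfect matchings of `G`. -/
def IsGlobalForcingSet {V : Type u} (G : SimpleGraph V) (S : Set (Sym2 V)) : Prop :=
  S ⊆ G.edgeSet ∧
    ∀ M₁ ∈ perfectMatchings G, ∀ M₂ ∈ perfectMatchings G, M₁ ≠ M₂ → S ∩ M₁ ≠ S ∩ M₂

/-- The global forcing number (for finite graphs). -/
noncomputable def gf {V : Type u} (G : SimpleGraph V) : ℕ :=
  sInf {k | ∃ S : Set (Sym2 V), IsGlobalForcingSet G S ∧ S.ncard = k}

/-- A set `S` of edges outside `M` such that `M` is the only perfect matching of `G - S`. -/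
def IsAntiForcingSet {V : Type u} (G : SimpleGraph V) (M S : Set (Sym2 V)) : Prop :=
  S ⊆ G.edgeSet \ M ∧ perfectMatchings (G.deleteEdges S) = {M}

/-- The anti-forcing number of a perfect matching `M` (for finite graphs). -/
noncomputable def af {V : Type u} (G : SimpleGraph V) (M : Set (Sym2 V)) : ℕ :=
  sInf {k | ∃ S : Set (Sym2 V), IsAntiForcingSet G M S ∧ S.ncard = k}

/-- The maximum anti-forcing number (for finite matchable graphs). -/
noncomputable def maxAf {V : Type u} (G : SimpleGraph V) : ℕ :=
  sSup (af G '' perfectMatchings G)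

/-- A subgraph `H` of `G` is conformal if `G - V(H)` has a perfect matching. -/
def IsConformal {V : Type u} {G : SimpleGraph V} (H : G.Subgraph) : Prop :=
  Matchable (G.induce H.vertsᶜ)

/-- `G` is matchable, and `gf(H) = Af(H)` for each conformal matchable subgraph `H` of `G`. -/
def StronglyUniform {V : Type u} (G : SimpleGraph V) : Prop :=
  Matchable G ∧ ∀ H : G.Subgraph, IsConformal H → Matchable H.coe → gf H.coe = maxAf H.coe

/-- A way of obtaining `H` (up to isomorphism) from `J` by replacing each edge by a path of odd
length (possibly of length one, i.e. leaving the edge as it is), these paths being internally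
disjoint. -/
structure Bisubdivision {W : Type v} {U : Type u} (J : SimpleGraph W) (H : SimpleGraph U) where
  /-- the vertices of `J`, as vertices of `H` -/
  branch : W ↪ U
  /-- the replacement path of an edge of `J`, with either of its two orientations -/
  path : ∀ d : J.Dart, H.Walk (branch d.fst) (branch d.snd)
  isPath : ∀ d, (path d).IsPath
  odd_length : ∀ d, Odd (path d).length
  path_symm : ∀ d, path d.symm = (path d).reverse
  /-- the inner vertices of the paths are new -/
  branch_mem : ∀ d w, branch w ∈ (path d).support → w = d.fst ∨ w = d.snd
  /-- the paths of different edges have no inner vertex in common -/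
  internally_disjoint : ∀ d d', d.edge ≠ d'.edge → ∀ x, x ∈ (path d).support →
    x ∈ (path d').support → x ∈ Set.range branch
  /-- every vertex of `H` is a vertex of `J` or lies on one of the paths -/
  vertex_mem : ∀ x, x ∈ Set.range branch ∨ ∃ d, x ∈ (path d).support
  /-- every edge of `H` lies on one of the paths -/
  edge_mem : ∀ e ∈ H.edgeSet, ∃ d, e ∈ (path d).edges

/-- Some bisubdivision of `J` is a conformal subgraph of `G`. -/
def IsConformalMinor {W : Type v} {V : Type u} (J : SimpleGraph W) (G : SimpleGraph V) : Prop :=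
  ∃ H : G.Subgraph, IsConformal H ∧ Nonempty (Bisubdivision J H.coe)

/-- Three internally disjoint paths of length three between the vertices `0` and `1`. -/
def A₁ : SimpleGraph (Fin 8) :=
  fromEdgeSet {s(0, 2), s(2, 3), s(3, 1), s(0, 4), s(4, 5), s(5, 1), s(0, 6), s(6, 7), s(7, 1)}

/-- The cycle of length eight with two chords that share an end. -/
def A₂ : SimpleGraph (Fin 8) :=
  fromEdgeSet ((cycleGraph 8).edgeSet ∪ {s(0, 3), s(0, 5)})

/-- The cycle of length ten with two disjoint chords that are neither crossed nor parallel. -/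
def A₃ : SimpleGraph (Fin 10) :=
  fromEdgeSet ((cycleGraph 10).edgeSet ∪ {s(0, 3), s(5, 8)})

/-- The complete bipartite graph `K₃,₃`, which is the cycle of length six with its three chords
that join opposite vertices. -/
def A₄ : SimpleGraph (Fin 3 ⊕ Fin 3) :=
  completeBipartiteGraph (Fin 3) (Fin 3)

/-- The chords of a Hamilton cycle `C` of `G`. -/
def chords {V : Type u} {G : SimpleGraph V} {a : V} (C : G.Walk a a) : Set (Sym2 V) :=
  {e | e ∈ G.edgeSet ∧ e ∉ C.edges}

/-- `c` is a proper black-white coloring of the closed walk `C`. -/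
def IsColoring {V : Type u} {G : SimpleGraph V} {a : V} (C : G.Walk a a) (c : V → Bool) : Prop :=
  ∀ x y, s(x, y) ∈ C.edges → c x ≠ c y

/-- Some distinct vertices of a cycle `C` appear along `C`, in one of its two directions and from
some starting point, in the order in which they are listed in `l`. -/
def Ordered {V : Type u} {G : SimpleGraph V} {a : V} (C : G.Walk a a) (l : List V) : Prop :=
  ∃ t : List V, (t ~r C.support.tail ∨ t ~r C.reverse.support.tail) ∧ l.Sublist t

/-- The chords `e` and `f` of the cycle `C` with coloring `c` are parallel. -/
def Parallel {V : Type u} {G : SimpleGraph V} {a : V} (C : G.Walk a a) (c : V → Bool)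
    (e f : Sym2 V) : Prop :=
  ∃ x₁ x₂ y₁ y₂ : V, e = s(x₁, x₂) ∧ f = s(y₁, y₂) ∧ c x₁ = c y₁ ∧ Ordered C [x₁, x₂, y₁, y₂]

/-- The chords `e` and `f` of the cycle `C` with coloring `c` are strongly crossed. -/
def StronglyCrossed {V : Type u} {G : SimpleGraph V} {a : V} (C : G.Walk a a) (c : V → Bool)
    (e f : Sym2 V) : Prop :=
  ∃ x₁ x₂ y₁ y₂ : V, e = s(x₁, x₂) ∧ f = s(y₁, y₂) ∧ c x₁ = c y₁ ∧ Ordered C [x₁, y₁, x₂, y₂] ∧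
    s(x₁, y₂) ∈ C.edges ∧ s(x₂, y₁) ∈ C.edges

/-- `G` is an even cycle. -/
def IsB₀ {V : Type u} [DecidableEq V] (G : SimpleGraph V) : Prop :=
  ∃ (a : V) (C : G.Walk a a), C.IsHamiltonianCycle ∧ Even C.length ∧ chords C = ∅

/-- `G` is bipartite and consists of a Hamilton cycle and exactly one chord. -/
def IsB₁ {V : Type u} [DecidableEq V] (G : SimpleGraph V) : Prop :=
  G.IsBipartite ∧ ∃ (a : V) (C : G.Walk a a), C.IsHamiltonianCycle ∧ ∃ e, chords C = {e}

/-- `G` consists of a Hamilton cycle and exactly two chords, which are strongly crossed. -/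
def IsB₂ {V : Type u} [DecidableEq V] (G : SimpleGraph V) : Prop :=
  ∃ (a : V) (C : G.Walk a a) (c : V → Bool), C.IsHamiltonianCycle ∧ IsColoring C c ∧
    ∃ e f, e ≠ f ∧ chords C = {e, f} ∧ StronglyCrossed C c e f

/-- `G` is bipartite and consists of a Hamilton cycle with pairwise parallel chords. -/
def IsB₃ {V : Type u} [DecidableEq V] (G : SimpleGraph V) : Prop :=
  G.IsBipartite ∧ ∃ (a : V) (C : G.Walk a a) (c : V → Bool), C.IsHamiltonianCycle ∧
    IsColoring C c ∧ ∀ e ∈ chords C, ∀ f ∈ chords C, e ≠ f → Parallel C c e f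

end ForcingGraphs

/-!
The three conditions are linked by two facts about arbitrary graphs and an analysis of chords.

*Numbers.* Every bipartite graph satisfies `maxAf G ≤ gf G` (`maxAf_le_gf`). Relative to a perfect
matching `M`, perfect matchings are permutations of the black vertices, and the pairs outside a
global forcing set can be exchanged, one row at a time, for a set of at least the same size that
contains `M` and no other perfect matching, so that the remaining edges form an anti-forcing set of
`M`. Hence `G` is strongly uniform as soon as `gf ≤ maxAf` for
all its conformal matchable subgraphs `H`. The perfect matchings of `H` correspond to those perfect
matchings of `G` that are contained in a certain set `F` of edges, and `gf H ≤ maxAf H` follows if one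
of them differs from `k` others in pairwise disjoint sets of edges while `k` edges distinguish all of
them (`IsUniformFamily`, `stronglyUniform_of_isUniformFamily`). No reference to `H` remains.

*Excluded minors.* For a bisubdivision `H` of `J` one has `gf J ≤ gf H` and `maxAf H ≤ maxAf J`, and
`maxAf J < gf J` holds for the four small graphs. So none of them is a conformal minor of a strongly
uniform graph (`StronglyUniform.not_isConformalMinor_A`).

*Finding the Hamilton cycle.* A conformal cycle that misses a vertex has an ear: an alternating path
with respect to a perfect matching that leaves the cycle and a perfect matching of the rest
(`exists_ear`). Its ends divide the cycle into two odd paths. If both have length at least three, they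
form with the ear a bisubdivision of `A₁`; otherwise there is a longer conformal cycle. Without the
conformal minor `A₁`, a longest conformal cycle is therefore a Hamilton cycle
(`exists_isHamiltonianCycle`).

*Pairs of chords.* Two chords with a common end give `A₂`, disjoint chords that do not cross and are not
parallel give `A₃`, and crossed chords that are not strongly crossed give `A₁`
(`CycleEnum.parallel_or_stronglyCrossed`). A strongly crossed pair tolerates a third chord in `K₃,₃`
only (`CycleEnum.isConformalMinor_A₄_of_stronglyCrossed`).

*Strong uniformity.* Number the vertices along the Hamilton cycle. For a perfect matching, the function
that is `1` where membership of the edge `i` of the cycle agrees with the parity of `i`, and `0`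
elsewhere, changes exactly at the ends of the chords in the matching (`ChordSystem.pot`,
`ChordSystem.mem_perfectMatchings_iff_pot`). Parallel chords, seen from one of them, cut off disjoint
parts of the cycle, and then the matching with as many chords as possible can be changed independently
in these parts and in what remains (`ChordSystem.isUniformFamily_of_disjoint`). For two strongly crossed
chords there are at most four perfect matchings, arranged in a `2 × 2` grid
(`ChordSystem.isUniformFamily_of_crossed`).
-/

namespace ForcingGraphs

open SimpleGraph

/-! ### Perfect matchings as fixed-point-free involutions -/

section Mates

variable {V : Type*} {G : SimpleGraph V} {M N : Set (Sym2 V)} {f : V → V}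

/-- `f` sends each vertex to its partner in some perfect matching of `G`. -/
def IsMate (G : SimpleGraph V) (f : V → V) : Prop :=
  ∀ x, G.Adj x (f x) ∧ f (f x) = x

/-- The edges of the perfect matching with partner function `f`. -/
def mateEdges (f : V → V) : Set (Sym2 V) := {e | ∃ x, e = s(x, f x)}

lemma IsMate.mk_mem (hf : IsMate G f) {x y : V} : s(x, y) ∈ mateEdges f ↔ f x = y := by
  constructor
  · rintro ⟨z, hz⟩
    rcases Sym2.eq_iff.1 hz with ⟨rfl, rfl⟩ | ⟨rfl, rfl⟩
    · rfl
    · exact (hf _).2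
  · rintro rfl
    exact ⟨x, rfl⟩

lemma mem_perfectMatchings_iff_mate :
    M ∈ perfectMatchings G ↔ ∃ f, IsMate G f ∧ M = mateEdges f := by
  constructor
  · rintro ⟨N, hN, rfl⟩
    rw [Subgraph.isPerfectMatching_iff] at hN
    choose f hf hu using hN
    have hf2 : IsMate G f := fun x => ⟨(hf x).adj_sub, (hu (f x) x (hf x).symm).symm⟩
    refine ⟨f, hf2, ?_⟩
    ext e
    induction e with | _ x y
    rw [hf2.mk_mem, Subgraph.mem_edgeSet]
    constructor
    · intro h; exact (hu x y h).symm
    · rintro rfl; exact hf x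
  · rintro ⟨f, hf, rfl⟩
    refine ⟨{ verts := Set.univ, Adj := fun x y => f x = y,
              adj_sub := ?_, edge_vert := fun _ => trivial, symm := ?_ }, ?_, ?_⟩
    · rintro x y rfl; exact (hf x).1
    · refine ⟨?_⟩
      rintro x y rfl; exact (hf x).2
    · rw [Subgraph.isPerfectMatching_iff]
      exact fun v => ⟨f v, rfl, fun y hy => Eq.symm hy⟩
    · ext e
      induction e with | _ x y
      rw [hf.mk_mem, Subgraph.mem_edgeSet]

lemma subset_edgeSet (hM : M ∈ perfectMatchings G) : M ⊆ G.edgeSet := by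
  obtain ⟨N, -, rfl⟩ := hM
  exact N.edgeSet_subset

lemma mem_perfectMatchings_iff :
    M ∈ perfectMatchings G ↔ M ⊆ G.edgeSet ∧ ∀ v, ∃! e, e ∈ M ∧ v ∈ e := by
  constructor
  · intro h
    refine ⟨subset_edgeSet h, fun v => ?_⟩
    obtain ⟨f, hf, rfl⟩ := mem_perfectMatchings_iff_mate.1 h
    refine ⟨s(v, f v), ⟨⟨v, rfl⟩, Sym2.mem_mk_left _ _⟩, ?_⟩
    rintro e ⟨he, hv⟩
    obtain ⟨w, rfl⟩ := hv
    rw [hf.mk_mem.1 he]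
  · rintro ⟨hE, hM⟩
    have h : ∀ v, ∃ w, s(v, w) ∈ M := by
      intro v
      obtain ⟨e, ⟨he, w, rfl⟩, -⟩ := hM v
      exact ⟨w, he⟩
    choose f hf using h
    have key : ∀ x y, s(x, y) ∈ M → f x = y := by
      intro x y hxy
      have := (hM x).unique ⟨hf x, Sym2.mem_mk_left _ _⟩ ⟨hxy, Sym2.mem_mk_left _ _⟩
      exact Sym2.congr_right.1 this
    have hm : IsMate G f := fun x => ⟨hE (hf x), key _ _ (by rw [Sym2.eq_swap]; exact hf x)⟩
    refine mem_perfectMatchings_iff_mate.2 ⟨f, hm, ?_⟩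
    ext e
    induction e with | _ x y
    rw [hm.mk_mem]
    exact ⟨key x y, by rintro rfl; exact hf x⟩

/-- No perfect matching is properly contained in another one. -/
lemma eq_of_subset (hM : M ∈ perfectMatchings G) (hN : N ∈ perfectMatchings G) (h : M ⊆ N) :
    M = N := by
  obtain ⟨f, hf, rfl⟩ := mem_perfectMatchings_iff_mate.1 hM
  obtain ⟨g, hg, rfl⟩ := mem_perfectMatchings_iff_mate.1 hN
  have : f = g := by
    ext x
    exact (hg.mk_mem.1 (h (hf.mk_mem.2 rfl))).symm
  rw [this]

lemma matchable_iff_mate : Matchable G ↔ ∃ f, IsMate G f := by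
  constructor
  · rintro ⟨M, hM⟩
    obtain ⟨f, hf, -⟩ := mem_perfectMatchings_iff_mate.1 hM
    exact ⟨f, hf⟩
  · rintro ⟨f, hf⟩
    exact ⟨_, mem_perfectMatchings_iff_mate.2 ⟨f, hf, rfl⟩⟩

lemma matchable_induce_iff {S : Set V} :
    Matchable (G.induce S) ↔ ∃ f : V → V, ∀ x ∈ S, f x ∈ S ∧ G.Adj x (f x) ∧ f (f x) = x := by
  classical
  rw [matchable_iff_mate]
  constructor
  · rintro ⟨f, hf⟩
    refine ⟨fun x => if h : x ∈ S then f ⟨x, h⟩ else x, fun x hx => ?_⟩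
    have h1 := hf ⟨x, hx⟩
    refine ⟨by simp [hx], by simpa [hx] using h1.1, by simp [hx, h1.2]⟩
  · rintro ⟨f, hf⟩
    refine ⟨fun x => ⟨f x, (hf x x.2).1⟩, fun x => ⟨?_, ?_⟩⟩
    · simpa using (hf x x.2).2.1
    · ext; simpa using (hf x x.2).2.2

end Mates

/-! ### Bounds for forcing numbers -/

section Numbers

variable {V : Type*} {G : SimpleGraph V} {M N S : Set (Sym2 V)}

lemma gf_le (h : IsGlobalForcingSet G S) : gf G ≤ S.ncard :=
  Nat.sInf_le ⟨S, h, rfl⟩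

lemma exists_gf (G : SimpleGraph V) : ∃ S, IsGlobalForcingSet G S ∧ S.ncard = gf G := by
  have : {k | ∃ S : Set (Sym2 V), IsGlobalForcingSet G S ∧ S.ncard = k}.Nonempty := by
    refine ⟨_, G.edgeSet, ⟨subset_rfl, ?_⟩, rfl⟩
    intro M₁ h₁ M₂ h₂ hne
    rwa [Set.inter_eq_right.2 (subset_edgeSet h₁), Set.inter_eq_right.2 (subset_edgeSet h₂)]
  exact Nat.sInf_mem this

lemma mem_perfectMatchings_deleteEdges :
    N ∈ perfectMatchings (G.deleteEdges S) ↔ N ∈ perfectMatchings G ∧ Disjoint N S := by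
  simp only [mem_perfectMatchings_iff, edgeSet_deleteEdges, Set.subset_sdiff]
  tauto

lemma isAntiForcingSet_iff (hM : M ∈ perfectMatchings G) :
    IsAntiForcingSet G M S ↔
      S ⊆ G.edgeSet \ M ∧ ∀ N ∈ perfectMatchings G, Disjoint N S → N = M := by
  unfold IsAntiForcingSet
  refine and_congr_right fun hS => ?_
  constructor
  · intro h N hN hd
    have : N ∈ perfectMatchings (G.deleteEdges S) :=
      mem_perfectMatchings_deleteEdges.2 ⟨hN, hd⟩
    rwa [h] at this
  · intro h
    ext N
    rw [mem_perfectMatchings_deleteEdges, Set.mem_singleton_iff]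
    refine ⟨fun hN => h N hN.1 hN.2, ?_⟩
    rintro rfl
    exact ⟨hM, (Set.disjoint_sdiff_right).mono_right hS⟩

lemma af_le (h : IsAntiForcingSet G M S) : af G M ≤ S.ncard :=
  Nat.sInf_le ⟨S, h, rfl⟩

lemma exists_af (hM : M ∈ perfectMatchings G) :
    ∃ S, IsAntiForcingSet G M S ∧ S.ncard = af G M := by
  have : {k | ∃ S : Set (Sym2 V), IsAntiForcingSet G M S ∧ S.ncard = k}.Nonempty := by
    refine ⟨_, G.edgeSet \ M, (isAntiForcingSet_iff hM).2 ⟨subset_rfl, ?_⟩, rfl⟩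
    intro N hN hd
    refine eq_of_subset hN hM fun e he => ?_
    by_contra hc
    exact Set.disjoint_left.1 hd he ⟨subset_edgeSet hN he, hc⟩
  exact Nat.sInf_mem this

lemma maxAf_le {k : ℕ} (h : ∀ M ∈ perfectMatchings G, af G M ≤ k) : maxAf G ≤ k := by
  rcases (af G '' perfectMatchings G).eq_empty_or_nonempty with h0 | h0
  · rw [maxAf, h0]; simp
  · refine csSup_le h0 ?_
    rintro _ ⟨M, hM, rfl⟩
    exact h M hM

lemma af_le_maxAf [Finite V] (hM : M ∈ perfectMatchings G) : af G M ≤ maxAf G :=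
  le_csSup ((Set.toFinite _).bddAbove) ⟨M, hM, rfl⟩

end Numbers

/-! ### The maximum anti-forcing number of a bipartite graph is at most its global forcing number -/

section Permutations

variable {A : Type*} [DecidableEq A] [Fintype A]

/-- Let the permutations supported in `X` and contained in the relation `R` be such that two of
them never differ in pairs of `T` only. Then some row of `T` has at most one element: otherwise
start with a permutation that uses as many pairs of `T` as possible, choose in each row a pair of
`T` that it does not use, and switch to the chosen pairs along a cycle. -/
lemma exists_row_card_le_one {R : A → A → Prop} (hR : ∀ a, R a a) {X : Finset A}
    (hX : X.Nonempty) {T : Finset (A × A)} (hTX : ∀ p ∈ T, p.1 ∈ X ∧ p.2 ∈ X)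
    (hTR : ∀ p ∈ T, R p.1 p.2)
    (h : ∀ σ τ : Equiv.Perm A, (∀ a, R a (σ a)) → (∀ a, R a (τ a)) →
      (∀ a ∉ X, σ a = a) → (∀ a ∉ X, τ a = a) →
      (∀ a, σ a ≠ τ a → (a, σ a) ∈ T ∧ (a, τ a) ∈ T) → σ = τ) :
    ∃ x ∈ X, (T.filter (fun p => p.1 = x)).card ≤ 1 := by
  classical
  by_contra! hc
  let P : Finset (Equiv.Perm A) :=
    Finset.univ.filter (fun σ => (∀ a, R a (σ a)) ∧ ∀ a ∉ X, σ a = a)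
  have hP : P.Nonempty := ⟨1, by simp [P, hR]⟩
  obtain ⟨σ, hσP, hmax⟩ :=
    P.exists_max_image (fun σ => (X.filter (fun a => (a, σ a) ∈ T)).card) hP
  simp only [P, Finset.mem_filter, Finset.mem_univ, true_and] at hσP hmax
  obtain ⟨hσR, hσX⟩ := hσP
  have hσX' : ∀ a ∈ X, σ.symm a ∈ X := by
    intro a ha
    by_contra hn
    have := hσX _ hn
    rw [Equiv.apply_symm_apply] at this
    exact hn (this ▸ ha)
  have hex : ∀ x, ∃ y, x ∈ X → (x, y) ∈ T ∧ y ≠ σ x := by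
    intro x
    by_cases hx : x ∈ X
    · obtain ⟨⟨a, b⟩, ⟨a', b'⟩, h1, h2, hne⟩ := Finset.one_lt_card_iff.1 (hc x hx)
      simp only [Finset.mem_filter] at h1 h2
      obtain ⟨h1, rfl⟩ := h1
      obtain ⟨h2, h3⟩ := h2
      subst h3
      by_cases hb : b = σ a'
      · refine ⟨b', fun _ => ⟨h2, ?_⟩⟩
        rintro rfl
        exact hne (by rw [hb])
      · exact ⟨b, fun _ => ⟨h1, hb⟩⟩
    · exact ⟨x, fun h => absurd h hx⟩
  choose f hf using hex
  let g : A → A := fun a => if a ∈ X then σ.symm (f a) else a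
  have hgX : ∀ a ∈ X, g a ∈ X := by
    intro a ha
    simp only [g, ha, if_true]
    exact hσX' _ (hTX _ (hf a ha).1).2
  let Y := Function.periodicPts g
  have hY : ∃ y ∈ X, y ∈ Y := by
    obtain ⟨x, hx⟩ := hX
    have hit : ∀ n, g^[n] x ∈ X := by
      intro n
      induction n with
      | zero => exact hx
      | succ n ih => rw [Function.iterate_succ_apply']; exact hgX _ ih
    obtain ⟨m, n, hmn, he⟩ := Finite.exists_ne_map_eq_of_infinite (fun n : ℕ => g^[n] x)
    wlog hlt : m < n generalizing m n
    · exact this n m hmn.symm he.symm (by omega)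
    refine ⟨g^[m] x, hit m, n - m, by omega, ?_⟩
    rw [Function.IsPeriodicPt, Function.IsFixedPt, ← Function.iterate_add_apply]
    rw [show n - m + m = n by omega]
    exact he.symm
  have hbij : Set.BijOn g Y Y := Function.bijOn_periodicPts g
  let t : A → A := fun a => if a ∈ Y then g a else a
  have ht : Function.Injective t := by
    intro a b hab
    simp only [t] at hab
    split_ifs at hab with ha hb hb
    · exact hbij.injOn ha hb hab
    · exact absurd (hab ▸ hbij.mapsTo ha) hb
    · exact absurd (hab ▸ hbij.mapsTo hb) ha
    · exact hab
  let t' : Equiv.Perm A := Equiv.ofBijective t (Finite.injective_iff_bijective.1 ht)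
  let τ : Equiv.Perm A := t'.trans σ
  have hτ1 : ∀ a ∈ X, a ∈ Y → τ a = f a := by
    intro a ha hb
    simp [τ, t', t, hb, g, ha]
  have hτ2 : ∀ a, ¬ (a ∈ X ∧ a ∈ Y) → τ a = σ a := by
    intro a ha
    by_cases hb : a ∈ Y
    · have : a ∉ X := fun h => ha ⟨h, hb⟩
      simp [τ, t', t, hb, g, this]
    · simp [τ, t', t, hb]
  have hτR : ∀ a, R a (τ a) := by
    intro a
    by_cases ha : a ∈ X ∧ a ∈ Y
    · rw [hτ1 a ha.1 ha.2]; exact hTR _ (hf a ha.1).1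
    · rw [hτ2 a ha]; exact hσR a
  have hτX : ∀ a ∉ X, τ a = a := by
    intro a ha
    rw [hτ2 a (fun h => ha h.1)]; exact hσX a ha
  have hsub : X.filter (fun a => (a, σ a) ∈ T) ⊆ X.filter (fun a => (a, τ a) ∈ T) := by
    intro a
    simp only [Finset.mem_filter]
    rintro ⟨ha, hb⟩
    refine ⟨ha, ?_⟩
    by_cases hy : a ∈ Y
    · rw [hτ1 a ha hy]; exact (hf a ha).1
    · rw [hτ2 a (fun h => hy h.2)]; exact hb
  have heq := Finset.eq_of_subset_of_card_le hsub (hmax τ ⟨hτR, hτX⟩)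
  have hστ : σ = τ := by
    refine h σ τ hσR hτR hσX hτX fun a ha => ?_
    by_cases hy : a ∈ X ∧ a ∈ Y
    · have h1 : (a, τ a) ∈ T := by rw [hτ1 a hy.1 hy.2]; exact (hf a hy.1).1
      have h2 : a ∈ X.filter (fun a => (a, σ a) ∈ T) := by
        rw [heq]; exact Finset.mem_filter.2 ⟨hy.1, h1⟩
      exact ⟨(Finset.mem_filter.1 h2).2, h1⟩
    · exact absurd (hτ2 a hy).symm ha
  obtain ⟨y, hyX, hyY⟩ := hY
  have := hτ1 y hyX hyY
  rw [← hστ] at this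
  exact (hf y hyX).2 this.symm

/-- If no two permutations in `R` differ in pairs of `T` only, then `T` can be replaced by a
relation `F` of at least the same size, contained in `T` and the diagonal, that contains the
diagonal but no other permutation. -/
lemma exists_rigid_relation {R : A → A → Prop} (hR : ∀ a, R a a) (X : Finset A) :
    ∀ T : Finset (A × A), (∀ p ∈ T, p.1 ∈ X ∧ p.2 ∈ X) → (∀ p ∈ T, R p.1 p.2) →
    (∀ σ τ : Equiv.Perm A, (∀ a, R a (σ a)) → (∀ a, R a (τ a)) →
      (∀ a ∉ X, σ a = a) → (∀ a ∉ X, τ a = a) →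
      (∀ a, σ a ≠ τ a → (a, σ a) ∈ T ∧ (a, τ a) ∈ T) → σ = τ) →
    ∃ F : Finset (A × A), (∀ p ∈ F, p.1 ∈ X ∧ p.2 ∈ X) ∧ (∀ p ∈ F, p ∈ T ∨ p.1 = p.2) ∧
      (∀ x ∈ X, (x, x) ∈ F) ∧ T.card ≤ F.card ∧
      ∀ σ : Equiv.Perm A, (∀ a ∉ X, σ a = a) → (∀ a ∈ X, (a, σ a) ∈ F) → σ = 1 := by
  classical
  induction hn : X.card generalizing X with
  | zero =>
    intro T hTX _ _
    obtain rfl := Finset.card_eq_zero.1 hn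
    refine ⟨∅, by simp, by simp, by simp, ?_, fun σ hσ _ => ?_⟩
    · have : T = ∅ := Finset.eq_empty_of_forall_notMem fun p hp => by simpa using hTX p hp
      simp [this]
    · ext a; exact hσ a (by simp)
  | succ n ih =>
    intro T hTX hTR h
    obtain ⟨x, hx, hrow⟩ :=
      exists_row_card_le_one hR (Finset.card_pos.1 (by omega)) hTX hTR h
    obtain ⟨F', hF'X, hF'T, hF'd, hF'c, hF'u⟩ := ih (X.erase x)
      (by rw [Finset.card_erase_of_mem hx]; omega)
      (T.filter (fun p => p.1 ≠ x ∧ p.2 ≠ x))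
      (by
        intro p hp
        rw [Finset.mem_filter] at hp
        have := hTX p hp.1
        simp [this, hp.2])
      (fun p hp => hTR p (Finset.mem_filter.1 hp).1)
      (by
        intro σ τ h1 h2 h3 h4 h5
        refine h σ τ h1 h2 (fun a ha => h3 a (fun hh => ha (Finset.mem_of_mem_erase hh)))
          (fun a ha => h4 a (fun hh => ha (Finset.mem_of_mem_erase hh))) fun a ha => ?_
        have := h5 a ha
        exact ⟨(Finset.mem_filter.1 this.1).1, (Finset.mem_filter.1 this.2).1⟩)
    let K := insert (x, x) (T.filter (fun p => p.2 = x))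
    have hK : ∀ p ∈ K, p.2 = x := by
      intro p hp
      rcases Finset.mem_insert.1 hp with rfl | hp
      · rfl
      · exact (Finset.mem_filter.1 hp).2
    have hdisj : Disjoint F' K := by
      rw [Finset.disjoint_left]
      intro p hp hpK
      have := (hF'X p hp).2
      rw [hK p hpK] at this
      simp at this
    refine ⟨F' ∪ K, ?_, ?_, ?_, ?_, ?_⟩
    · intro p hp
      rcases Finset.mem_union.1 hp with hp | hp
      · have := hF'X p hp
        exact ⟨Finset.mem_of_mem_erase this.1, Finset.mem_of_mem_erase this.2⟩
      · rcases Finset.mem_insert.1 hp with rfl | hp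
        · exact ⟨hx, hx⟩
        · exact hTX p (Finset.mem_filter.1 hp).1
    · intro p hp
      rcases Finset.mem_union.1 hp with hp | hp
      · exact (hF'T p hp).imp_left fun h => (Finset.mem_filter.1 h).1
      · rcases Finset.mem_insert.1 hp with rfl | hp
        · exact Or.inr rfl
        · exact Or.inl (Finset.mem_filter.1 hp).1
    · intro y hy
      by_cases hyx : y = x
      · subst hyx; simp [K]
      · exact Finset.mem_union_left _ (hF'd y (Finset.mem_erase.2 ⟨hyx, hy⟩))
    · rw [Finset.card_union_of_disjoint hdisj]
      have hT : T ⊆ T.filter (fun p => p.1 ≠ x ∧ p.2 ≠ x) ∪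
          (T.filter (fun p => p.1 = x) ∪ T.filter (fun p => p.2 = x)) := by
        intro p hp
        simp only [Finset.mem_union, Finset.mem_filter, hp, true_and]
        tauto
      have hKc : (T.filter (fun p => p.1 = x) ∪ T.filter (fun p => p.2 = x)).card ≤ K.card := by
        by_cases hxx : (x, x) ∈ T
        · -- the only element of the row lies on the diagonal, hence in the column
          refine Finset.card_le_card fun p hp => ?_
          rcases Finset.mem_union.1 hp with hp | hp
          · have := Finset.card_le_one.1 hrow p hp (x, x) (by simp [hxx])
            simp [K, this]
          · exact Finset.mem_insert_of_mem hp
        · rw [Finset.card_insert_of_notMem (by simp [hxx])]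
          exact (Finset.card_union_le _ _).trans (by omega)
      have h1 := Finset.card_le_card hT
      have h2 := Finset.card_union_le (T.filter (fun p => p.1 ≠ x ∧ p.2 ≠ x))
        (T.filter (fun p => p.1 = x) ∪ T.filter (fun p => p.2 = x))
      omega
    · intro σ hσ hσF
      have hσx : σ x = x := by
        rcases Finset.mem_union.1 (hσF x hx) with hp | hp
        · simpa using (hF'X _ hp).1
        · exact hK _ hp
      refine hF'u σ (fun a ha => ?_) (fun a ha => ?_)
      · by_cases hax : a = x
        · rw [hax, hσx]
        · exact hσ a (fun hh => ha (Finset.mem_erase.2 ⟨hax, hh⟩))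
      · rcases Finset.mem_union.1 (hσF a (Finset.mem_of_mem_erase ha)) with hp | hp
        · exact hp
        · have : σ a = σ x := by rw [hσx]; exact hK _ hp
          exact absurd (σ.injective this) (Finset.ne_of_mem_erase ha)

end Permutations

/-- For the perfect matchings `M` of a bipartite graph, identify each black vertex with its
partner in `M`: perfect matchings become permutations of the black vertices, `M` becomes the
identity, and the edges outside a global forcing set form a relation to which
`exists_rigid_relation` applies. -/
theorem maxAf_le_gf {V : Type*} [Finite V] {G : SimpleGraph V} (c : V → Bool)
    (hc : ∀ x y, G.Adj x y → c x ≠ c y) : maxAf G ≤ gf G := by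
  classical
  have := Fintype.ofFinite V
  refine maxAf_le fun M hM => ?_
  obtain ⟨S, hS, hSc⟩ := exists_gf G
  rw [← hSc]
  obtain ⟨m, hm, hMm⟩ := mem_perfectMatchings_iff_mate.1 hM
  have hcf : ∀ {f : V → V}, IsMate G f → ∀ x, c (f x) = !c x := by
    intro f hf x
    have := hc x (f x) (hf x).1
    revert this
    cases c x <;> cases c (f x) <;> simp
  let A := {x : V // c x = true}
  let R : A → A → Prop := fun a b => G.Adj a.1 (m b.1)
  let ε : A × A → Sym2 V := fun p => s(p.1.1, m p.2.1)
  have hε : Function.Injective ε := by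
    rintro ⟨⟨a, ha⟩, ⟨b, hb⟩⟩ ⟨⟨a', ha'⟩, ⟨b', hb'⟩⟩ h
    rcases Sym2.eq_iff.1 h with ⟨h1, h2⟩ | ⟨h1, h2⟩
    · simp only at h1 h2
      have : b = b' := by rw [← (hm b).2, h2, (hm b').2]
      subst h1 this
      rfl
    · simp only at h1 h2
      have := hcf hm b'
      rw [← h1, ha, hb'] at this
      simp at this
  let mate : Equiv.Perm A → V → V := fun σ x =>
    if h : c x = true then m (σ ⟨x, h⟩).1
    else (σ.symm ⟨m x, by rw [hcf hm]; simpa using h⟩).1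
  have hmate : ∀ σ : Equiv.Perm A, (∀ a, R a (σ a)) → IsMate G (mate σ) := by
    intro σ hσ x
    by_cases h : c x = true
    · have h2 : ¬ c (m (σ ⟨x, h⟩).1) = true := by
        rw [hcf hm, (σ ⟨x, h⟩).2]; simp
      have h3 : mate σ x = m (σ ⟨x, h⟩).1 := by simp [mate, h]
      refine ⟨by rw [h3]; exact hσ ⟨x, h⟩, ?_⟩
      rw [h3]
      simp only [mate, h2]
      simp [(hm (σ ⟨x, h⟩).1).2]
    · have h0 : c (m x) = true := by rw [hcf hm]; simpa using h
      have h3 : mate σ x = (σ.symm ⟨m x, h0⟩).1 := by simp [mate, h]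
      have h4 := hσ (σ.symm ⟨m x, h0⟩)
      simp only [R, Equiv.apply_symm_apply, (hm x).2] at h4
      refine ⟨by rw [h3]; exact h4.symm, ?_⟩
      rw [h3]
      have h5 := (σ.symm ⟨m x, h0⟩).2
      simp [mate, h5, (hm x).2]
  have hmate' : ∀ σ : Equiv.Perm A, ∀ a : A, mate σ a.1 = m (σ a).1 := by
    intro σ a
    simp [mate, a.2]
  have hmemN : ∀ σ : Equiv.Perm A, (∀ a, R a (σ a)) → ∀ e ∈ mateEdges (mate σ),
      ∃ a : A, e = ε (a, σ a) := by
    rintro σ hσ _ ⟨x, rfl⟩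
    by_cases h : c x = true
    · exact ⟨⟨x, h⟩, by simp only [ε]; rw [← hmate' σ ⟨x, h⟩]⟩
    · have h0 : c (mate σ x) = true := by rw [hcf (hmate σ hσ)]; simpa using h
      refine ⟨⟨_, h0⟩, ?_⟩
      simp only [ε]
      rw [← hmate' σ ⟨_, h0⟩, (hmate σ hσ x).2, Sym2.eq_swap]
  let Rf : Finset (A × A) := Finset.univ.filter fun p => R p.1 p.2
  let T : Finset (A × A) := Rf.filter fun p => ε p ∉ S
  have hRf : ∀ p, p ∈ Rf ↔ R p.1 p.2 := by intro p; simp [Rf]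
  obtain ⟨F, -, hFT, hFd, hFc, hFu⟩ := exists_rigid_relation (R := R)
    (fun a => (hm a.1).1) Finset.univ T (by simp)
    (fun p hp => (hRf p).1 (Finset.mem_filter.1 hp).1)
    (by
      intro σ τ hσ hτ _ _ hd
      by_contra hne
      have hσM := mem_perfectMatchings_iff_mate.2 ⟨_, hmate σ hσ, rfl⟩
      have hτM := mem_perfectMatchings_iff_mate.2 ⟨_, hmate τ hτ, rfl⟩
      refine hS.2 _ hσM _ hτM ?_ ?_
      · intro he
        apply hne
        ext a
        have h1 : s(a.1, mate σ a.1) ∈ mateEdges (mate σ) := ⟨_, rfl⟩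
        rw [he, (hmate τ hτ).mk_mem, hmate', hmate'] at h1
        rw [← (hm (σ a).1).2, ← h1, (hm (τ a).1).2]
      · -- an edge of `S` in one of the matchings comes from a position where they agree
        have key : ∀ σ τ : Equiv.Perm A, (∀ a, R a (σ a)) →
            (∀ a, σ a ≠ τ a → (a, σ a) ∈ T) →
            ∀ e ∈ S ∩ mateEdges (mate σ), e ∈ S ∩ mateEdges (mate τ) := by
          rintro σ τ hσ hd e ⟨heS, he⟩
          obtain ⟨a, rfl⟩ := hmemN σ hσ e he
          refine ⟨heS, ?_⟩
          by_cases ha : σ a = τ a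
          · rw [ha]
            exact ⟨a.1, by rw [hmate']⟩
          · exact absurd heS (Finset.mem_filter.1 (hd a ha)).2
        ext e
        exact ⟨key σ τ hσ (fun a ha => (hd a ha).1) e,
          key τ σ hτ (fun a ha => (hd a (Ne.symm ha)).2) e⟩)
  have hFR : ∀ p ∈ F, R p.1 p.2 := by
    rintro ⟨a, b⟩ hp
    rcases hFT _ hp with h | h
    · exact (hRf _).1 (Finset.mem_filter.1 h).1
    · simp only at h
      subst h
      exact (hm a.1).1
  have hS' : IsAntiForcingSet G M (ε '' ((Rf \ F : Finset (A × A)) : Set (A × A))) := by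
    rw [isAntiForcingSet_iff hM]
    constructor
    · rintro _ ⟨⟨a, b⟩, hp, rfl⟩
      rw [Finset.mem_coe, Finset.mem_sdiff, hRf] at hp
      refine ⟨hp.1, fun hh => hp.2 ?_⟩
      rw [hMm, hm.mk_mem] at hh
      have : a = b := by
        ext
        rw [← (hm a.1).2, hh, (hm b.1).2]
      rw [← this]
      exact hFd a (Finset.mem_univ _)
    · intro N hN hd
      obtain ⟨f, hf, rfl⟩ := mem_perfectMatchings_iff_mate.1 hN
      let t : A → A := fun a => ⟨m (f a.1), by rw [hcf hm, hcf hf, a.2]; rfl⟩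
      have ht : Function.Injective t := by
        intro a b hab
        have h1 : m (f a.1) = m (f b.1) := congrArg Subtype.val hab
        ext
        rw [← (hf a.1).2, ← (hm (f a.1)).2, h1, (hm (f b.1)).2, (hf b.1).2]
      have ht1 := hFu (Equiv.ofBijective t (Finite.injective_iff_bijective.1 ht)) (by simp) (by
        intro a _
        by_contra hn
        refine Set.disjoint_left.1 hd (show ε (a, t a) ∈ _ from ⟨a.1, ?_⟩) ⟨(a, t a), ?_, rfl⟩
        · simp only [ε, t]; rw [(hm (f a.1)).2]
        · rw [Finset.mem_coe, Finset.mem_sdiff, hRf]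
          refine ⟨?_, hn⟩
          simp only [R, t]; rw [(hm (f a.1)).2]; exact (hf a.1).1)
      have hfm : ∀ a : A, f a.1 = m a.1 := by
        intro a
        have h1 : t a = a := by
          have := DFunLike.congr_fun ht1 a
          simpa using this
        have h2 : m (f a.1) = a.1 := congrArg Subtype.val h1
        rw [← h2, (hm (f a.1)).2, h2]
      refine eq_of_subset hN hM ?_
      rintro _ ⟨x, rfl⟩
      rw [hMm, hm.mk_mem]
      by_cases h : c x = true
      · exact (hfm ⟨x, h⟩).symm
      · have h0 : c (f x) = true := by rw [hcf hf]; simpa using h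
        have h1 := hfm ⟨_, h0⟩
        simp only [(hf x).2] at h1
        conv_lhs => rw [h1]
        exact (hm (f x)).2
  refine (af_le hS').trans ?_
  refine (Set.ncard_image_le (Finset.finite_toSet _)).trans ?_
  rw [Set.ncard_coe_finset]
  have hTRf : T ⊆ Rf := Finset.filter_subset _ _
  have hFRf : F ⊆ Rf := fun p hp => (hRf p).2 (hFR p hp)
  have h1 : (Rf \ F).card ≤ (Rf \ T).card := by
    rw [Finset.card_sdiff_of_subset hFRf, Finset.card_sdiff_of_subset hTRf]
    omega
  refine h1.trans ?_
  have h2 : ((Rf \ T).image ε : Set (Sym2 V)) ⊆ S := by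
    intro e he
    rw [Finset.mem_coe, Finset.mem_image] at he
    obtain ⟨p, hp, rfl⟩ := he
    rw [Finset.mem_sdiff] at hp
    by_contra hh
    exact hp.2 (Finset.mem_filter.2 ⟨hp.1, hh⟩)
  rw [← Finset.card_image_of_injective _ hε, ← Set.ncard_coe_finset]
  exact Set.ncard_le_ncard h2 (Set.toFinite _)

/-! ### Perfect matchings of bisubdivisions -/

lemma _root_.SimpleGraph.Walk.mem_edges_iff_getVert {V : Type*} {G : SimpleGraph V} {a b : V}
    (p : G.Walk a b) {e : Sym2 V} :
    e ∈ p.edges ↔ ∃ i < p.length, e = s(p.getVert i, p.getVert (i + 1)) := by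
  induction p with
  | nil => simp
  | cons h p ih =>
    rw [Walk.edges_cons, List.mem_cons, ih]
    constructor
    · rintro (rfl | ⟨i, hi, rfl⟩)
      · exact ⟨0, by simp, by simp⟩
      · exact ⟨i + 1, by simpa using hi, by simp⟩
    · rintro ⟨i, hi, rfl⟩
      cases i with
      | zero => left; simp
      | succ i => right; exact ⟨i, by simpa using hi, by simp⟩

namespace Bisubdivision

variable {W U : Type*} {J : SimpleGraph W} {H : SimpleGraph U} (B : Bisubdivision J H)

/-- The `i`-th vertex of the path that replaces the edge of the dart `d`. -/
def vert (d : J.Dart) (i : ℕ) : U := (B.path d).getVert i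

/-- The `i`-th edge of the path that replaces the edge of the dart `d`. -/
def edge (d : J.Dart) (i : ℕ) : Sym2 U := s(B.vert d i, B.vert d (i + 1))

/-- The length of the path that replaces the edge of the dart `d`. -/
def len (d : J.Dart) : ℕ := (B.path d).length

lemma odd_len (d : J.Dart) : Odd (B.len d) := B.odd_length d

lemma vert_zero (d : J.Dart) : B.vert d 0 = B.branch d.fst := Walk.getVert_zero _

lemma vert_len (d : J.Dart) : B.vert d (B.len d) = B.branch d.snd := Walk.getVert_length _

lemma len_symm (d : J.Dart) : B.len d.symm = B.len d := by
  simp only [len, B.path_symm]; exact Walk.length_reverse _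

lemma vert_symm (d : J.Dart) (i : ℕ) : B.vert d.symm i = B.vert d (B.len d - i) := by
  simp only [vert, B.path_symm]; exact Walk.getVert_reverse _ _

lemma edge_symm {d : J.Dart} {i : ℕ} (hi : i < B.len d) :
    B.edge d.symm i = B.edge d (B.len d - 1 - i) := by
  simp only [edge, vert_symm]
  rw [Sym2.eq_swap, show B.len d - (i + 1) = B.len d - 1 - i by omega,
    show B.len d - 1 - i + 1 = B.len d - i by omega]

lemma vert_inj {d : J.Dart} {i j : ℕ} (hi : i ≤ B.len d) (hj : j ≤ B.len d)
    (h : B.vert d i = B.vert d j) : i = j :=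
  (B.isPath d).getVert_injOn hi hj h

lemma edge_inj {d : J.Dart} {i j : ℕ} (hi : i < B.len d) (hj : j < B.len d)
    (h : B.edge d i = B.edge d j) : i = j := by
  rcases Sym2.eq_iff.1 h with ⟨h1, -⟩ | ⟨h1, h2⟩
  · exact B.vert_inj hi.le hj.le h1
  · have := B.vert_inj hi.le hj h1
    have := B.vert_inj hi hj.le h2
    omega

lemma vert_mem (d : J.Dart) (i : ℕ) : B.vert d i ∈ (B.path d).support :=
  Walk.getVert_mem_support _ _

lemma edge_mem_edgeSet {d : J.Dart} {i : ℕ} (hi : i < B.len d) : B.edge d i ∈ H.edgeSet :=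
  (B.path d).adj_getVert_succ hi

lemma exists_edge {e : Sym2 U} (he : e ∈ H.edgeSet) : ∃ d, ∃ i < B.len d, e = B.edge d i := by
  obtain ⟨d, hd⟩ := B.edge_mem e he
  exact ⟨d, (B.path d).mem_edges_iff_getVert.1 hd⟩

lemma eq_or_eq_of_vert_mem_range {d : J.Dart} {i : ℕ} (hi : i ≤ B.len d)
    (h : B.vert d i ∈ Set.range B.branch) : i = 0 ∨ i = B.len d := by
  obtain ⟨w, hw⟩ := h
  rcases B.branch_mem d w (hw ▸ B.vert_mem d i) with rfl | rfl
  · left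
    exact B.vert_inj hi (Nat.zero_le _) (by rw [← hw, vert_zero])
  · right
    exact B.vert_inj hi le_rfl (by rw [← hw, vert_len])

lemma edge_eq_edge {d d' : J.Dart} {i j : ℕ} (hi : i < B.len d) (hj : j < B.len d')
    (h : B.edge d i = B.edge d' j) : d.edge = d'.edge := by
  by_contra hne
  have key : ∀ {d d' : J.Dart} {i j : ℕ}, i < B.len d → j < B.len d' →
      B.edge d i = B.edge d' j → d.edge ≠ d'.edge → B.edge d i = d.edge.map B.branch := by
    intro d d' i j hi hj h hne
    have hs : ∀ k, B.vert d k ∈ B.edge d i → B.vert d k ∈ Set.range B.branch := by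
      intro k hk
      refine B.internally_disjoint d d' hne _ (B.vert_mem d k) ?_
      rw [h] at hk
      rcases Sym2.mem_iff.1 hk with hk | hk <;> rw [hk] <;> exact B.vert_mem _ _
    have h1 := B.eq_or_eq_of_vert_mem_range hi.le (hs i (Sym2.mem_mk_left _ _))
    have h2 := B.eq_or_eq_of_vert_mem_range (i := i + 1) hi (hs (i + 1) (Sym2.mem_mk_right _ _))
    have h3 : i = 0 := by omega
    have h4 : B.len d = 1 := by omega
    subst h3
    have : B.vert d 1 = B.branch d.snd := by rw [← h4, vert_len]
    simp only [edge, zero_add, this, vert_zero]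
    rfl
  have h1 := key hi hj h hne
  have h2 := key hj hi h.symm (Ne.symm hne)
  rw [h1, h2] at h
  exact hne (Sym2.map.injective B.branch.injective h)

lemma eq_or_eq_of_vert_mem {d : J.Dart} {i : ℕ} (hi : i + 1 < B.len d) {e : Sym2 U}
    (he : e ∈ H.edgeSet) (hv : B.vert d (i + 1) ∈ e) : e = B.edge d i ∨ e = B.edge d (i + 1) := by
  have hr : B.vert d (i + 1) ∉ Set.range B.branch := by
    intro h
    have := B.eq_or_eq_of_vert_mem_range hi.le h
    omega
  obtain ⟨d', j, hj, rfl⟩ := B.exists_edge he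
  have hdd : d.edge = d'.edge := by
    by_contra hne
    refine hr (B.internally_disjoint d d' hne _ (B.vert_mem _ _) ?_)
    rcases Sym2.mem_iff.1 hv with h | h <;> rw [h] <;> exact B.vert_mem _ _
  have : ∃ k < B.len d, B.edge d' j = B.edge d k := by
    rcases (dart_edge_eq_iff d' d).1 hdd.symm with rfl | rfl
    · exact ⟨j, hj, rfl⟩
    · rw [len_symm] at hj
      exact ⟨_, by omega, B.edge_symm hj⟩
  obtain ⟨k, hk, hk2⟩ := this
  rw [hk2] at hv ⊢
  rcases Sym2.mem_iff.1 hv with h | h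
  · have := B.vert_inj hi.le hk.le h
    right; rw [this]
  · have := B.vert_inj hi.le hk h
    left; congr 1; omega

lemma exists_dart {w : W} {e : Sym2 U} (he : e ∈ H.edgeSet) (hw : B.branch w ∈ e) :
    ∃ d : J.Dart, d.fst = w ∧ e = B.edge d 0 := by
  obtain ⟨d, i, hi, rfl⟩ := B.exists_edge he
  have key : ∃ k, (k = i ∨ k = i + 1) ∧ B.vert d k = B.branch w := by
    rcases Sym2.mem_iff.1 hw with h | h
    · exact ⟨i, Or.inl rfl, h.symm⟩
    · exact ⟨i + 1, Or.inr rfl, h.symm⟩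
  obtain ⟨k, hk, hkw⟩ := key
  rcases B.eq_or_eq_of_vert_mem_range (i := k) (d := d) (by omega) ⟨w, hkw.symm⟩ with rfl | rfl
  · refine ⟨d, B.branch.injective (by rw [← B.vert_zero, hkw]), ?_⟩
    congr 1; omega
  · refine ⟨d.symm, B.branch.injective (by rw [← hkw, vert_len]; rfl), ?_⟩
    rw [B.edge_symm (by omega)]
    congr 1; omega

lemma eq_of_edge_zero_eq {d d' : J.Dart} (hf : d.fst = d'.fst) (h : B.edge d 0 = B.edge d' 0) :
    d = d' := by
  have h1 := B.edge_eq_edge (B.odd_len d).pos (B.odd_len d').pos h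
  rcases (dart_edge_eq_iff d d').1 h1 with h2 | rfl
  · exact h2
  · exact absurd hf d'.adj.ne'

/-! Perfect matchings of `H` and of `J` correspond to each other: an edge of `J` belongs to the
matching of `J` iff the first edge of its path (equivalently, the last one) belongs to the matching
of `H`. -/

variable {B} in
lemma edge_mem_iff {M : Set (Sym2 U)} (hM : M ∈ perfectMatchings H) {d : J.Dart} {i : ℕ}
    (hi : i < B.len d) : B.edge d i ∈ M ↔ (B.edge d 0 ∈ M ↔ Even i) := by
  induction i with
  | zero => simp
  | succ i ih =>
    have ih := ih (by omega)
    obtain ⟨hE, hu⟩ := mem_perfectMatchings_iff.1 hM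
    obtain ⟨e, ⟨heM, hev⟩, hee⟩ := hu (B.vert d (i + 1))
    have hne : B.edge d i ≠ B.edge d (i + 1) := by
      intro h
      have := B.edge_inj (by omega) hi h
      omega
    have hxor : B.edge d (i + 1) ∈ M ↔ B.edge d i ∉ M := by
      constructor
      · intro h1 h2
        exact hne ((hee _ ⟨h2, Sym2.mem_mk_right _ _⟩).trans
          (hee _ ⟨h1, Sym2.mem_mk_left _ _⟩).symm)
      · intro h
        rcases B.eq_or_eq_of_vert_mem hi (hE heM) hev with rfl | rfl
        · exact absurd heM h
        · exact heM
    rw [hxor, ih, Nat.even_add_one]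
    tauto

/-- The matching of `J` that corresponds to a perfect matching `M` of its bisubdivision. -/
def proj (M : Set (Sym2 U)) : Set (Sym2 W) := {e | ∃ d : J.Dart, d.edge = e ∧ B.edge d 0 ∈ M}

variable {B} in
lemma edge_symm_mem_iff {M : Set (Sym2 U)} (hM : M ∈ perfectMatchings H) (d : J.Dart) :
    B.edge d.symm 0 ∈ M ↔ B.edge d 0 ∈ M := by
  have h := B.odd_len d
  have h0 := h.pos
  rw [B.edge_symm h0, edge_mem_iff hM (by omega)]
  have : Even (B.len d - 1 - 0) := by
    rw [Nat.sub_zero]; exact h.tsub_odd odd_one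
  simp only [this, iff_true]

variable {B} in
lemma dart_edge_mem_proj {M : Set (Sym2 U)} (hM : M ∈ perfectMatchings H) (d : J.Dart) :
    d.edge ∈ B.proj M ↔ B.edge d 0 ∈ M := by
  constructor
  · rintro ⟨d', h, hd'⟩
    rcases (dart_edge_eq_iff d' d).1 h with rfl | rfl
    · exact hd'
    · exact (edge_symm_mem_iff hM d).1 hd'
  · exact fun h => ⟨d, rfl, h⟩

lemma proj_mem {M : Set (Sym2 U)} (hM : M ∈ perfectMatchings H) :
    B.proj M ∈ perfectMatchings J := by
  obtain ⟨hE, hu⟩ := mem_perfectMatchings_iff.1 hM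
  rw [mem_perfectMatchings_iff]
  constructor
  · rintro _ ⟨d, rfl, -⟩
    exact d.edge_mem
  · intro w
    obtain ⟨e, ⟨heM, hew⟩, hee⟩ := hu (B.branch w)
    obtain ⟨d, rfl, rfl⟩ := B.exists_dart (hE heM) hew
    refine ⟨d.edge, ⟨⟨d, rfl, heM⟩, Sym2.mem_mk_left _ _⟩, ?_⟩
    rintro _ ⟨⟨d', rfl, hd'⟩, hw⟩
    have key : ∀ d' : J.Dart, B.edge d' 0 ∈ M → d'.fst = d.fst → d'.edge = d.edge := by
      intro d' h1 h2
      have := hee _ ⟨h1, by rw [← h2, ← B.vert_zero]; exact Sym2.mem_mk_left _ _⟩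
      rw [B.eq_of_edge_zero_eq h2 this]
    rcases Sym2.mem_iff.1 hw with h | h
    · exact key d' hd' h.symm
    · rw [← Dart.edge_symm]
      exact key d'.symm ((edge_symm_mem_iff hM d').2 hd') h.symm

variable {B} in
lemma proj_injOn : Set.InjOn B.proj (perfectMatchings H) := by
  intro M hM M' hM' h
  refine eq_of_subset hM hM' fun e he => ?_
  obtain ⟨d, i, hi, rfl⟩ := B.exists_edge (subset_edgeSet hM he)
  rw [edge_mem_iff hM hi, ← dart_edge_mem_proj hM, h] at he
  rwa [edge_mem_iff hM' hi, ← dart_edge_mem_proj hM']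

/-- The matching of a bisubdivision of `J` that corresponds to a perfect matching `N` of `J`. -/
def lift (N : Set (Sym2 W)) : Set (Sym2 U) :=
  {e | ∃ d : J.Dart, ∃ i < B.len d, e = B.edge d i ∧ (d.edge ∈ N ↔ Even i)}

variable {B} in
lemma edge_mem_lift {N : Set (Sym2 W)} {d : J.Dart} {i : ℕ} (hi : i < B.len d) :
    B.edge d i ∈ B.lift N ↔ (d.edge ∈ N ↔ Even i) := by
  constructor
  · rintro ⟨d', j, hj, he, h⟩
    have hdd := B.edge_eq_edge hi hj he
    rw [hdd, h]
    rcases (dart_edge_eq_iff d' d).1 hdd.symm with rfl | rfl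
    · rw [B.edge_inj hi hj he]
    · rw [len_symm] at hj
      rw [B.edge_symm hj] at he
      have := B.edge_inj hi (by omega) he
      have hodd := B.odd_len d
      rw [this]
      rw [Nat.odd_iff] at hodd
      rw [Nat.even_iff, Nat.even_iff]
      omega
  · exact fun h => ⟨d, i, hi, rfl, h⟩

lemma lift_mem {N : Set (Sym2 W)} (hN : N ∈ perfectMatchings J) :
    B.lift N ∈ perfectMatchings H := by
  obtain ⟨hE, hu⟩ := mem_perfectMatchings_iff.1 hN
  rw [mem_perfectMatchings_iff]
  have hEH : B.lift N ⊆ H.edgeSet := by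
    rintro _ ⟨d, i, hi, rfl, -⟩
    exact B.edge_mem_edgeSet hi
  refine ⟨hEH, fun x => ?_⟩
  by_cases hx : x ∈ Set.range B.branch
  · obtain ⟨w, rfl⟩ := hx
    obtain ⟨e, ⟨heN, w', rfl⟩, hee⟩ := hu w
    let d : J.Dart := ⟨(w, w'), hE heN⟩
    refine ⟨B.edge d 0, ⟨(edge_mem_lift (B.odd_len d).pos).2 (iff_of_true heN Even.zero), ?_⟩, ?_⟩
    · rw [show B.branch w = B.vert d 0 from (B.vert_zero d).symm]
      exact Sym2.mem_mk_left _ _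
    · rintro e ⟨heL, hw⟩
      obtain ⟨d', hd', rfl⟩ := B.exists_dart (hEH heL) hw
      rw [edge_mem_lift (B.odd_len d').pos] at heL
      have h1 : d'.edge = d.edge :=
        hee _ ⟨by simpa using heL, by rw [← hd']; exact Sym2.mem_mk_left _ _⟩
      rcases (dart_edge_eq_iff d' d).1 h1 with rfl | rfl
      · rfl
      · exact absurd hd' d.adj.ne'
  · obtain ⟨d, hd⟩ := (B.vertex_mem x).resolve_left hx
    obtain ⟨k, rfl, hk⟩ := Walk.mem_support_iff_exists_getVert.1 hd
    change B.vert d k ∉ _ at hx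
    change k ≤ B.len d at hk
    have hk0 : k ≠ 0 := by
      rintro rfl
      exact hx ⟨_, (B.vert_zero d).symm⟩
    have hkl : k ≠ B.len d := by
      rintro rfl
      exact hx ⟨_, (B.vert_len d).symm⟩
    obtain ⟨i, rfl⟩ := Nat.exists_eq_succ_of_ne_zero hk0
    change ∃! e, e ∈ B.lift N ∧ B.vert d (i + 1) ∈ e
    have h1 := edge_mem_lift (B := B) (N := N) (d := d) (i := i) (by omega)
    have h2 := edge_mem_lift (B := B) (N := N) (d := d) (i := i + 1) (by omega)
    rw [Nat.even_add_one] at h2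
    by_cases hc : d.edge ∈ N ↔ Even i
    · refine ⟨B.edge d i, ⟨h1.2 hc, Sym2.mem_mk_right _ _⟩, ?_⟩
      rintro e ⟨he, hv⟩
      rcases B.eq_or_eq_of_vert_mem (by omega) (hEH he) hv with rfl | rfl
      · rfl
      · have := h2.1 he
        tauto
    · refine ⟨B.edge d (i + 1), ⟨h2.2 (by tauto), Sym2.mem_mk_left _ _⟩, ?_⟩
      rintro e ⟨he, hv⟩
      rcases B.eq_or_eq_of_vert_mem (by omega) (hEH he) hv with rfl | rfl
      · exact absurd (h1.1 he) hc
      · rfl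

lemma proj_lift {N : Set (Sym2 W)} (hN : N ∈ perfectMatchings J) : B.proj (B.lift N) = N := by
  ext e
  constructor
  · rintro ⟨d, rfl, h⟩
    simpa using (edge_mem_lift (B.odd_len d).pos).1 h
  · intro he
    have : ∃ d : J.Dart, d.edge = e := by
      induction e with | _ x y
      exact ⟨⟨(x, y), subset_edgeSet hN he⟩, rfl⟩
    obtain ⟨d, rfl⟩ := this
    exact ⟨d, rfl, (edge_mem_lift (B.odd_len d).pos).2 (by simpa using he)⟩

lemma matchable (B : Bisubdivision J H) (h : Matchable J) : Matchable H := by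
  obtain ⟨N, hN⟩ := h
  exact ⟨_, B.lift_mem hN⟩

/-- Edges of one replacement path contribute the same to a global forcing set, so that the edges of
`J` whose paths meet a global forcing set of `H` form one of `J`. -/
lemma gf_le_gf (B : Bisubdivision J H) [Finite U] : gf J ≤ gf H := by
  classical
  obtain ⟨S, hS, hSc⟩ := exists_gf H
  rw [← hSc]
  let S' : Set (Sym2 W) := {e | ∃ d : J.Dart, d.edge = e ∧ ∃ i < B.len d, B.edge d i ∈ S}
  have hS' : IsGlobalForcingSet J S' := by
    constructor
    · rintro _ ⟨d, rfl, -⟩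
      exact d.edge_mem
    · intro N₁ h₁ N₂ h₂ hne heq
      have key : ∀ N₁ N₂, S' ∩ N₁ = S' ∩ N₂ → S ∩ B.lift N₁ ⊆ S ∩ B.lift N₂ := by
        rintro N₁ N₂ heq _ ⟨heS, d, i, hi, rfl, h⟩
        refine ⟨heS, (edge_mem_lift hi).2 ?_⟩
        rw [← h]
        have hd : d.edge ∈ S' := ⟨d, rfl, i, hi, heS⟩
        have := Set.ext_iff.1 heq d.edge
        simp only [Set.mem_inter_iff, hd, true_and] at this
        exact this.symm
      refine hS.2 _ (B.lift_mem h₁) _ (B.lift_mem h₂) ?_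
        (Set.Subset.antisymm (key _ _ heq) (key _ _ heq.symm))
      intro hl
      exact hne (by rw [← B.proj_lift h₁, hl, B.proj_lift h₂])
  refine (gf_le hS').trans ?_
  have hex : ∀ e, ∃ g, e ∈ S' → g ∈ S ∧ ∃ d : J.Dart, d.edge = e ∧ ∃ i < B.len d,
      B.edge d i = g := by
    intro e
    by_cases he : e ∈ S'
    · obtain ⟨d, hd, i, hi, hs⟩ := he
      exact ⟨_, fun _ => ⟨hs, d, hd, i, hi, rfl⟩⟩
    · exact ⟨s(B.branch e.out.1, B.branch e.out.1), fun h => absurd h he⟩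
  choose φ hφ using hex
  refine Set.ncard_le_ncard_of_injOn φ (fun e he => (hφ e he).1) ?_ (Set.toFinite S)
  intro e he e' he' heq
  obtain ⟨-, d, rfl, i, hi, h1⟩ := hφ e he
  obtain ⟨-, d', rfl, j, hj, h2⟩ := hφ e' he'
  exact B.edge_eq_edge hi hj (by rw [h1, h2, heq])

/-- An anti-forcing set of the corresponding matching of `J` yields one of the same size in `H`, which
consists of the first edges of the replacement paths. -/
lemma maxAf_le_maxAf (B : Bisubdivision J H) [Finite W] : maxAf H ≤ maxAf J := by
  classical
  refine maxAf_le fun M hM => ?_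
  obtain ⟨S, hS, hSc⟩ := exists_af (B.proj_mem hM)
  refine le_trans ?_ (af_le_maxAf (B.proj_mem hM))
  rw [← hSc]
  rw [isAntiForcingSet_iff (B.proj_mem hM)] at hS
  have hex : ∀ e : S, ∃ d : J.Dart, d.edge = e.1 := by
    rintro ⟨e, he⟩
    have := (hS.1 he).1
    induction e with | _ x y
    exact ⟨⟨(x, y), this⟩, rfl⟩
  choose δ hδ using hex
  have hAF : IsAntiForcingSet H M (Set.range fun e : S => B.edge (δ e) 0) := by
    rw [isAntiForcingSet_iff hM]
    constructor
    · rintro _ ⟨e, rfl⟩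
      refine ⟨B.edge_mem_edgeSet (B.odd_len _).pos, fun h => (hS.1 e.2).2 ?_⟩
      rw [← hδ e]
      exact (dart_edge_mem_proj hM _).2 h
    · intro N hN hd
      refine proj_injOn hN hM (hS.2 _ (B.proj_mem hN) ?_)
      rw [Set.disjoint_left]
      intro e he heS
      have h := hδ ⟨e, heS⟩
      rw [← show (δ ⟨e, heS⟩).edge = e from h, dart_edge_mem_proj hN] at he
      exact Set.disjoint_left.1 hd he ⟨⟨e, heS⟩, rfl⟩
  refine (af_le hAF).trans ?_
  rw [← Set.image_univ]
  refine (Set.ncard_image_le (Set.toFinite _)).trans ?_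
  rw [Set.ncard_univ]
  exact le_rfl

end Bisubdivision

/-! ### The four forbidden conformal minors -/

section Finite

variable {V : Type*} {J : SimpleGraph V}

/-- If no `k` pairs of vertices distinguish the perfect matchings in `L`, given by their partner
functions, then the global forcing number exceeds `k`. -/
lemma lt_gf_of_forall [Finite V] [Nonempty V] {k : ℕ} {L : Set (V → V)}
    (hL : ∀ f ∈ L, IsMate J f)
    (h : ∀ q : Fin k → V × V, ∃ f ∈ L, ∃ g ∈ L, f ≠ g ∧
      ∀ i, f (q i).1 = (q i).2 ↔ g (q i).1 = (q i).2) : k < gf J := by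
  classical
  obtain ⟨S, hS, hSc⟩ := exists_gf J
  by_contra hk
  rw [← hSc, not_lt] at hk
  obtain ⟨T, hST⟩ : ∃ q : Fin k → V × V, ∀ e ∈ S, ∃ i, e = s((q i).1, (q i).2) := by
    obtain ⟨φ⟩ : Nonempty (S ↪ Fin k) := by
      have := Fintype.ofFinite S
      refine Function.Embedding.nonempty_of_card_le ?_
      rw [Fintype.card_fin, ← Nat.card_eq_fintype_card]
      exact hk
    let v : V := Classical.arbitrary V
    refine ⟨fun i => if h : ∃ e, φ e = i then h.choose.1.out else (v, v), fun e he => ?_⟩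
    refine ⟨φ ⟨e, he⟩, ?_⟩
    have hex : ∃ e', φ e' = φ ⟨e, he⟩ := ⟨_, rfl⟩
    have := φ.injective hex.choose_spec
    simp only [hex, dif_pos]
    rw [this]
    exact (Quot.out_eq e).symm
  obtain ⟨f, hf, g, hg, hne, hfg⟩ := h T
  have hf' := hL f hf
  have hg' := hL g hg
  refine hS.2 _ (mem_perfectMatchings_iff_mate.2 ⟨f, hf', rfl⟩) _
    (mem_perfectMatchings_iff_mate.2 ⟨g, hg', rfl⟩) ?_ ?_
  · intro he
    apply hne
    ext x
    have : s(x, f x) ∈ mateEdges f := ⟨x, rfl⟩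
    rw [he, hg'.mk_mem] at this
    exact this.symm
  · ext e
    refine and_congr_right fun he => ?_
    obtain ⟨i, rfl⟩ := hST e he
    rw [hf'.mk_mem, hg'.mk_mem]
    exact hfg i

/-- A bound for the maximum anti-forcing number in terms of partner functions and lists of ordered
pairs, which makes the conditions decidable for small graphs. -/
lemma maxAf_le_of_forall [Finite V] [DecidableEq V] {k : ℕ}
    (h : ∀ f, IsMate J f → ∃ S : List (V × V), S.length ≤ k ∧
      (∀ p ∈ S, J.Adj p.1 p.2 ∧ f p.1 ≠ p.2) ∧
      ∀ g, IsMate J g → (∀ p ∈ S, g p.1 ≠ p.2) → g = f) : maxAf J ≤ k := by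
  refine maxAf_le fun M hM => ?_
  obtain ⟨f, hf, rfl⟩ := mem_perfectMatchings_iff_mate.1 hM
  obtain ⟨S, hSk, hS, hu⟩ := h f hf
  let T : Finset (Sym2 V) := (S.map fun p => s(p.1, p.2)).toFinset
  have hT : ∀ p ∈ S, s(p.1, p.2) ∈ T := by
    intro p hp
    rw [List.mem_toFinset]
    exact List.mem_map.2 ⟨p, hp, rfl⟩
  have : IsAntiForcingSet J (mateEdges f) T := by
    rw [isAntiForcingSet_iff hM]
    constructor
    · intro e he
      rw [Finset.mem_coe, List.mem_toFinset] at he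
      obtain ⟨p, hp, rfl⟩ := List.mem_map.1 he
      refine ⟨(hS p hp).1, fun h => (hS p hp).2 ?_⟩
      exact hf.mk_mem.1 h
    · intro N hN hd
      obtain ⟨g, hg, rfl⟩ := mem_perfectMatchings_iff_mate.1 hN
      rw [hu g hg]
      intro p hp hgp
      exact Set.disjoint_left.1 hd (hg.mk_mem.2 hgp) (hT p hp)
  refine (af_le this).trans ?_
  rw [Set.ncard_coe_finset]
  exact (List.toFinset_card_le _).trans (by simpa using hSk)

/-- Four perfect matchings are not distinguished by two edges if at most one of their three
partitions into pairs is induced by an edge. -/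
lemma two_lt_gf [Finite V] [Nonempty V] {f : Fin 4 → V → V}
    (hf : ∀ i, IsMate J (f i)) (hinj : Function.Injective f)
    (h : ∀ x y, ¬ ((f 0 x = y ↔ f 1 x = y) ∧ (f 2 x = y ↔ f 3 x = y) ∧ ¬ (f 0 x = y ↔ f 2 x = y)) ∧
      ¬ ((f 0 x = y ↔ f 3 x = y) ∧ (f 1 x = y ↔ f 2 x = y) ∧ ¬ (f 0 x = y ↔ f 1 x = y))) :
    2 < gf J := by
  refine lt_gf_of_forall (k := 2) (L := Set.range f) (by rintro _ ⟨i, rfl⟩; exact hf i) fun q => ?_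
  suffices hs : ∃ i j : Fin 4, i ≠ j ∧ (f i (q 0).1 = (q 0).2 ↔ f j (q 0).1 = (q 0).2) ∧
      (f i (q 1).1 = (q 1).2 ↔ f j (q 1).1 = (q 1).2) by
    obtain ⟨i, j, hij, h0, h1⟩ := hs
    refine ⟨_, ⟨i, rfl⟩, _, ⟨j, rfl⟩, hinj.ne hij, fun k => ?_⟩
    fin_cases k
    · exact h0
    · exact h1
  have h0 := h (q 0).1 (q 0).2
  have h1 := h (q 1).1 (q 1).2
  by_contra! hc
  have c01 := hc 0 1 (by decide)
  have c02 := hc 0 2 (by decide)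
  have c03 := hc 0 3 (by decide)
  have c12 := hc 1 2 (by decide)
  have c13 := hc 1 3 (by decide)
  have c23 := hc 2 3 (by decide)
  clear hc h hinj hf
  grind

end Finite

instance : DecidableRel A₁.Adj := fun x y =>
  decidable_of_iff ((s(x, y) = s(0, 2) ∨ s(x, y) = s(2, 3) ∨ s(x, y) = s(3, 1) ∨ s(x, y) = s(0, 4) ∨
    s(x, y) = s(4, 5) ∨ s(x, y) = s(5, 1) ∨ s(x, y) = s(0, 6) ∨ s(x, y) = s(6, 7) ∨
    s(x, y) = s(7, 1)) ∧ x ≠ y) (by simp only [A₁, fromEdgeSet_adj, Set.mem_insert_iff,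
      Set.mem_singleton_iff])

instance : DecidableRel A₂.Adj := fun x y =>
  decidable_of_iff (((cycleGraph 8).Adj x y ∨ s(x, y) = s(0, 3) ∨ s(x, y) = s(0, 5)) ∧ x ≠ y)
    (by simp only [A₂, fromEdgeSet_adj, Set.mem_union, Set.mem_insert_iff,
      Set.mem_singleton_iff, mem_edgeSet])

instance : DecidableRel A₃.Adj := fun x y =>
  decidable_of_iff (((cycleGraph 10).Adj x y ∨ s(x, y) = s(0, 3) ∨ s(x, y) = s(5, 8)) ∧ x ≠ y)
    (by simp only [A₃, fromEdgeSet_adj, Set.mem_union, Set.mem_insert_iff,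
      Set.mem_singleton_iff, mem_edgeSet])

instance : DecidableRel A₄.Adj := fun x y =>
  decidable_of_iff (x.isLeft ∧ y.isRight ∨ x.isRight ∧ y.isLeft) Iff.rfl

/-- The partner functions of the perfect matchings of `A₁`. -/
lemma mate_A₁ {f : Fin 8 → Fin 8} (hf : IsMate A₁ f) :
    f = ![2, 3, 0, 1, 5, 4, 7, 6] ∨
      f = ![4, 5, 3, 2, 0, 1, 7, 6] ∨
      f = ![6, 7, 3, 2, 5, 4, 0, 1] := by
  have h0 := (show ∀ y, A₁.Adj 0 y → y = 2 ∨ y = 4 ∨ y = 6 by decide) _ (hf 0).1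
  have h1 := (show ∀ y, A₁.Adj 1 y → y = 3 ∨ y = 5 ∨ y = 7 by decide) _ (hf 1).1
  have h2 := (show ∀ y, A₁.Adj 2 y → y = 0 ∨ y = 3 by decide) _ (hf 2).1
  have h3 := (show ∀ y, A₁.Adj 3 y → y = 2 ∨ y = 1 by decide) _ (hf 3).1
  have h4 := (show ∀ y, A₁.Adj 4 y → y = 0 ∨ y = 5 by decide) _ (hf 4).1
  have h5 := (show ∀ y, A₁.Adj 5 y → y = 4 ∨ y = 1 by decide) _ (hf 5).1
  have h6 := (show ∀ y, A₁.Adj 6 y → y = 0 ∨ y = 7 by decide) _ (hf 6).1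
  have h7 := (show ∀ y, A₁.Adj 7 y → y = 6 ∨ y = 1 by decide) _ (hf 7).1
  have i0 := (hf 0).2
  have i1 := (hf 1).2
  have i2 := (hf 2).2
  have i3 := (hf 3).2
  have i4 := (hf 4).2
  have i5 := (hf 5).2
  have i6 := (hf 6).2
  have i7 := (hf 7).2
  clear hf
  simp only [funext_iff, Fin.forall_fin_succ]
  simp
  rcases h0 with h0 | h0 | h0 <;> grind (splits := 40)

/-- The partner functions of the perfect matchings of `A₂`. -/
lemma mate_A₂ {f : Fin 8 → Fin 8} (hf : IsMate A₂ f) :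
    f = ![3, 2, 1, 0, 5, 4, 7, 6] ∨
      f = ![5, 2, 1, 4, 3, 0, 7, 6] ∨
      f = ![1, 0, 3, 2, 5, 4, 7, 6] ∨
      f = ![7, 2, 1, 4, 3, 6, 5, 0] := by
  have h0 := (show ∀ y, A₂.Adj 0 y → y = 1 ∨ y = 7 ∨ y = 3 ∨ y = 5 by decide) _ (hf 0).1
  have h1 := (show ∀ y, A₂.Adj 1 y → y = 0 ∨ y = 2 by decide) _ (hf 1).1
  have h2 := (show ∀ y, A₂.Adj 2 y → y = 1 ∨ y = 3 by decide) _ (hf 2).1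
  have h3 := (show ∀ y, A₂.Adj 3 y → y = 2 ∨ y = 4 ∨ y = 0 by decide) _ (hf 3).1
  have h4 := (show ∀ y, A₂.Adj 4 y → y = 3 ∨ y = 5 by decide) _ (hf 4).1
  have h5 := (show ∀ y, A₂.Adj 5 y → y = 4 ∨ y = 6 ∨ y = 0 by decide) _ (hf 5).1
  have h6 := (show ∀ y, A₂.Adj 6 y → y = 5 ∨ y = 7 by decide) _ (hf 6).1
  have h7 := (show ∀ y, A₂.Adj 7 y → y = 6 ∨ y = 0 by decide) _ (hf 7).1
  have i0 := (hf 0).2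
  have i1 := (hf 1).2
  have i2 := (hf 2).2
  have i3 := (hf 3).2
  have i4 := (hf 4).2
  have i5 := (hf 5).2
  have i6 := (hf 6).2
  have i7 := (hf 7).2
  clear hf
  simp only [funext_iff, Fin.forall_fin_succ]
  simp
  rcases h0 with h0 | h0 | h0 | h0 <;> grind (splits := 40)

/-- The partner functions of the perfect matchings of `A₃`. -/
lemma mate_A₃ {f : Fin 10 → Fin 10} (hf : IsMate A₃ f) :
    f = ![3, 2, 1, 0, 5, 4, 7, 6, 9, 8] ∨
      f = ![9, 2, 1, 4, 3, 8, 7, 6, 5, 0] ∨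
      f = ![1, 0, 3, 2, 5, 4, 7, 6, 9, 8] ∨
      f = ![9, 2, 1, 4, 3, 6, 5, 8, 7, 0] := by
  have h0 := (show ∀ y, A₃.Adj 0 y → y = 1 ∨ y = 9 ∨ y = 3 by decide) _ (hf 0).1
  have h1 := (show ∀ y, A₃.Adj 1 y → y = 0 ∨ y = 2 by decide) _ (hf 1).1
  have h2 := (show ∀ y, A₃.Adj 2 y → y = 1 ∨ y = 3 by decide) _ (hf 2).1
  have h3 := (show ∀ y, A₃.Adj 3 y → y = 2 ∨ y = 4 ∨ y = 0 by decide) _ (hf 3).1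
  have h4 := (show ∀ y, A₃.Adj 4 y → y = 3 ∨ y = 5 by decide) _ (hf 4).1
  have h5 := (show ∀ y, A₃.Adj 5 y → y = 4 ∨ y = 6 ∨ y = 8 by decide) _ (hf 5).1
  have h6 := (show ∀ y, A₃.Adj 6 y → y = 5 ∨ y = 7 by decide) _ (hf 6).1
  have h7 := (show ∀ y, A₃.Adj 7 y → y = 6 ∨ y = 8 by decide) _ (hf 7).1
  have h8 := (show ∀ y, A₃.Adj 8 y → y = 7 ∨ y = 9 ∨ y = 5 by decide) _ (hf 8).1
  have h9 := (show ∀ y, A₃.Adj 9 y → y = 8 ∨ y = 0 by decide) _ (hf 9).1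
  have i0 := (hf 0).2
  have i1 := (hf 1).2
  have i2 := (hf 2).2
  have i3 := (hf 3).2
  have i4 := (hf 4).2
  have i5 := (hf 5).2
  have i6 := (hf 6).2
  have i7 := (hf 7).2
  have i8 := (hf 8).2
  have i9 := (hf 9).2
  clear hf
  simp only [funext_iff, Fin.forall_fin_succ]
  simp
  rcases h0 with h0 | h0 | h0 <;> grind (splits := 40)

section Numbers

set_option maxRecDepth 4000

lemma maxAf_A₁_le : maxAf A₁ ≤ 1 := by
  refine maxAf_le_of_forall fun f hf => ?_
  rcases mate_A₁ hf with rfl | rfl | rfl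
  · refine ⟨[(2, 3)], by decide, by decide, fun g hg hS => ?_⟩
    rcases mate_A₁ hg with rfl | rfl | rfl
    all_goals first | rfl | exact absurd hS (by decide)
  · refine ⟨[(4, 5)], by decide, by decide, fun g hg hS => ?_⟩
    rcases mate_A₁ hg with rfl | rfl | rfl
    all_goals first | rfl | exact absurd hS (by decide)
  · refine ⟨[(6, 7)], by decide, by decide, fun g hg hS => ?_⟩
    rcases mate_A₁ hg with rfl | rfl | rfl
    all_goals first | rfl | exact absurd hS (by decide)

lemma maxAf_A₂_le : maxAf A₂ ≤ 2 := by
  refine maxAf_le_of_forall fun f hf => ?_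
  rcases mate_A₂ hf with rfl | rfl | rfl | rfl
  · refine ⟨[(3, 4), (0, 1)], by decide, by decide, fun g hg hS => ?_⟩
    rcases mate_A₂ hg with rfl | rfl | rfl | rfl
    all_goals first | rfl | exact absurd hS (by decide)
  · refine ⟨[(4, 5), (5, 6)], by decide, by decide, fun g hg hS => ?_⟩
    rcases mate_A₂ hg with rfl | rfl | rfl | rfl
    all_goals first | rfl | exact absurd hS (by decide)
  · refine ⟨[(1, 2)], by decide, by decide, fun g hg hS => ?_⟩
    rcases mate_A₂ hg with rfl | rfl | rfl | rfl
    all_goals first | rfl | exact absurd hS (by decide)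
  · refine ⟨[(6, 7)], by decide, by decide, fun g hg hS => ?_⟩
    rcases mate_A₂ hg with rfl | rfl | rfl | rfl
    all_goals first | rfl | exact absurd hS (by decide)

lemma maxAf_A₃_le : maxAf A₃ ≤ 2 := by
  refine maxAf_le_of_forall fun f hf => ?_
  rcases mate_A₃ hf with rfl | rfl | rfl | rfl
  · refine ⟨[(3, 4), (0, 1)], by decide, by decide, fun g hg hS => ?_⟩
    rcases mate_A₃ hg with rfl | rfl | rfl | rfl
    all_goals first | rfl | exact absurd hS (by decide)
  · refine ⟨[(4, 5), (5, 6)], by decide, by decide, fun g hg hS => ?_⟩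
    rcases mate_A₃ hg with rfl | rfl | rfl | rfl
    all_goals first | rfl | exact absurd hS (by decide)
  · refine ⟨[(1, 2)], by decide, by decide, fun g hg hS => ?_⟩
    rcases mate_A₃ hg with rfl | rfl | rfl | rfl
    all_goals first | rfl | exact absurd hS (by decide)
  · refine ⟨[(6, 7)], by decide, by decide, fun g hg hS => ?_⟩
    rcases mate_A₃ hg with rfl | rfl | rfl | rfl
    all_goals first | rfl | exact absurd hS (by decide)

lemma maxAf_lt_gf_A₂ : maxAf A₂ < gf A₂ := by
  refine maxAf_A₂_le.trans_lt (two_lt_gf (f := ![![3, 2, 1, 0, 5, 4, 7, 6],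
    ![5, 2, 1, 4, 3, 0, 7, 6],
    ![1, 0, 3, 2, 5, 4, 7, 6],
    ![7, 2, 1, 4, 3, 6, 5, 0]])
    (by unfold IsMate; decide) (by decide) (by decide))

lemma maxAf_lt_gf_A₃ : maxAf A₃ < gf A₃ := by
  refine maxAf_A₃_le.trans_lt (two_lt_gf (f := ![![3, 2, 1, 0, 5, 4, 7, 6, 9, 8],
    ![9, 2, 1, 4, 3, 8, 7, 6, 5, 0],
    ![1, 0, 3, 2, 5, 4, 7, 6, 9, 8],
    ![9, 2, 1, 4, 3, 6, 5, 8, 7, 0]])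
    (by unfold IsMate; decide) (by decide) (by decide))

lemma maxAf_lt_gf_A₁ : maxAf A₁ < gf A₁ := by
  refine maxAf_A₁_le.trans_lt (lt_gf_of_forall (k := 1) (L := {![2, 3, 0, 1, 5, 4, 7, 6],
    ![4, 5, 3, 2, 0, 1, 7, 6], ![6, 7, 3, 2, 5, 4, 0, 1]}) ?_ fun q => ?_)
  · rintro f (rfl | rfl | rfl) <;> (unfold IsMate; decide)
  · -- two of any three matchings agree on a given edge
    set f : Fin 3 → Fin 8 → Fin 8 := ![![2, 3, 0, 1, 5, 4, 7, 6],
      ![4, 5, 3, 2, 0, 1, 7, 6], ![6, 7, 3, 2, 5, 4, 0, 1]] with hf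
    suffices hs : ∃ i j : Fin 3, i ≠ j ∧ (f i (q 0).1 = (q 0).2 ↔ f j (q 0).1 = (q 0).2) by
      obtain ⟨i, j, hij, h0⟩ := hs
      have hmem : ∀ i, f i ∈ ({![2, 3, 0, 1, 5, 4, 7, 6], ![4, 5, 3, 2, 0, 1, 7, 6],
          ![6, 7, 3, 2, 5, 4, 0, 1]} : Set (Fin 8 → Fin 8)) := by
        intro i; fin_cases i <;> simp [f]
      have hinj : Function.Injective f := by rw [hf]; decide
      refine ⟨_, hmem i, _, hmem j, hinj.ne hij, fun k => ?_⟩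
      rw [Subsingleton.elim k 0]
      exact h0
    by_contra! hc
    have c01 := hc 0 1 (by decide)
    have c02 := hc 0 2 (by decide)
    have c12 := hc 1 2 (by decide)
    tauto

/-- The partner function of the perfect matching of `A₄` given by a permutation. -/
def mateA₄ (σ : Equiv.Perm (Fin 3)) : Fin 3 ⊕ Fin 3 → Fin 3 ⊕ Fin 3 :=
  Sum.elim (fun i => Sum.inr (σ i)) (fun i => Sum.inl (σ.symm i))

lemma isMate_mateA₄ (σ : Equiv.Perm (Fin 3)) : IsMate A₄ (mateA₄ σ) := by
  rintro (i | i) <;> simp [mateA₄, A₄]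

lemma exists_mateA₄ {f : Fin 3 ⊕ Fin 3 → Fin 3 ⊕ Fin 3} (hf : IsMate A₄ f) :
    ∃ σ, f = mateA₄ σ := by
  have h1 : ∀ i, ∃ j, f (Sum.inl i) = Sum.inr j := by
    intro i
    have := (hf (Sum.inl i)).1
    cases h : f (Sum.inl i) with
    | inl j => rw [h] at this; simp [A₄] at this
    | inr j => exact ⟨j, rfl⟩
  have h2 : ∀ i, ∃ j, f (Sum.inr i) = Sum.inl j := by
    intro i
    have := (hf (Sum.inr i)).1
    cases h : f (Sum.inr i) with
    | inr j => rw [h] at this; simp [A₄] at this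
    | inl j => exact ⟨j, rfl⟩
  choose s hs using h1
  choose t ht using h2
  refine ⟨⟨s, t, fun i => ?_, fun i => ?_⟩, ?_⟩
  · have := (hf (Sum.inl i)).2
    rw [hs, ht] at this
    exact Sum.inl_injective this
  · have := (hf (Sum.inr i)).2
    rw [ht, hs] at this
    exact Sum.inr_injective this
  · ext (i | i)
    · exact hs i
    · exact ht i

lemma maxAf_A₄_le : maxAf A₄ ≤ 3 := by
  refine maxAf_le_of_forall fun f hf => ?_
  obtain ⟨σ, rfl⟩ := exists_mateA₄ hf
  refine ⟨[(Sum.inl 0, Sum.inr (σ 1)), (Sum.inl 0, Sum.inr (σ 2)), (Sum.inl 1, Sum.inr (σ 2))],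
    le_rfl, ?_, fun g hg hS => ?_⟩
  · simp [mateA₄, A₄]
  · obtain ⟨τ, rfl⟩ := exists_mateA₄ hg
    simp [mateA₄] at hS
    congr 1
    have key : ∀ σ τ : Equiv.Perm (Fin 3), (τ 0 ≠ σ 1 ∧ τ 0 ≠ σ 2 ∧ τ 1 ≠ σ 2) → τ = σ := by
      decide
    exact key σ τ hS

/-- Three positions do not distinguish all six permutations of three elements. -/
lemma exists_perm_agree (a : Fin 3 → Fin 3 × Fin 3) :
    ∃ σ τ : Equiv.Perm (Fin 3), σ ≠ τ ∧ ∀ i, σ (a i).1 = (a i).2 ↔ τ (a i).1 = (a i).2 := by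
  have key : ∀ a b c : Fin 3 × Fin 3, ∃ σ τ : Equiv.Perm (Fin 3), σ ≠ τ ∧
      (σ a.1 = a.2 ↔ τ a.1 = a.2) ∧ (σ b.1 = b.2 ↔ τ b.1 = b.2) ∧
      (σ c.1 = c.2 ↔ τ c.1 = c.2) := by
    decide
  obtain ⟨σ, τ, h, h0, h1, h2⟩ := key (a 0) (a 1) (a 2)
  refine ⟨σ, τ, h, fun i => ?_⟩
  fin_cases i
  exacts [h0, h1, h2]

lemma maxAf_lt_gf_A₄ : maxAf A₄ < gf A₄ := by
  refine maxAf_A₄_le.trans_lt (lt_gf_of_forall (k := 3) (L := Set.range mateA₄) ?_ fun q => ?_)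
  · rintro _ ⟨σ, rfl⟩
    exact isMate_mateA₄ σ
  · have hq : ∀ p : (Fin 3 ⊕ Fin 3) × (Fin 3 ⊕ Fin 3), ∃ a : Fin 3 × Fin 3,
        ∀ σ τ : Equiv.Perm (Fin 3), (σ a.1 = a.2 ↔ τ a.1 = a.2) →
          (mateA₄ σ p.1 = p.2 ↔ mateA₄ τ p.1 = p.2) := by
      rintro ⟨i | i, j | j⟩
      · exact ⟨(0, 0), by simp [mateA₄]⟩
      · exact ⟨(i, j), by simp [mateA₄]⟩
      · refine ⟨(j, i), fun σ τ h => ?_⟩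
        simpa [mateA₄, Equiv.symm_apply_eq, @eq_comm _ i] using h
      · exact ⟨(0, 0), by simp [mateA₄]⟩
    choose a ha using hq
    obtain ⟨σ, τ, hne, h⟩ := exists_perm_agree fun i => a (q i)
    refine ⟨_, ⟨σ, rfl⟩, _, ⟨τ, rfl⟩, fun he => hne ?_, fun i => ha _ σ τ (h i)⟩
    ext i
    have := congrFun he (Sum.inl i)
    simp only [mateA₄, Sum.elim_inl] at this
    exact congrArg _ (Sum.inr_injective this)

end Numbers

/-- A strongly uniform graph has no conformal minor whose global forcing number exceeds its
maximum anti-forcing number. -/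
lemma StronglyUniform.not_isConformalMinor {V W : Type*} [Finite V] [Finite W]
    {G : SimpleGraph V} {J : SimpleGraph W} (hG : StronglyUniform G) (hJ : Matchable J)
    (h : maxAf J < gf J) : ¬ IsConformalMinor J G := by
  rintro ⟨H, hH, ⟨B⟩⟩
  have h1 := hG.2 H hH (B.matchable hJ)
  have h2 := B.gf_le_gf
  have h3 := B.maxAf_le_maxAf
  omega

lemma StronglyUniform.not_isConformalMinor_A {V : Type*} [Finite V] {G : SimpleGraph V}
    (hG : StronglyUniform G) : ¬ IsConformalMinor A₁ G ∧ ¬ IsConformalMinor A₂ G ∧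
      ¬ IsConformalMinor A₃ G ∧ ¬ IsConformalMinor A₄ G := by
  refine ⟨hG.not_isConformalMinor ?_ maxAf_lt_gf_A₁, hG.not_isConformalMinor ?_ maxAf_lt_gf_A₂,
    hG.not_isConformalMinor ?_ maxAf_lt_gf_A₃, hG.not_isConformalMinor ?_ maxAf_lt_gf_A₄⟩
  · exact matchable_iff_mate.2 ⟨![2, 3, 0, 1, 5, 4, 7, 6], by unfold IsMate; decide⟩
  · exact matchable_iff_mate.2 ⟨![3, 2, 1, 0, 5, 4, 7, 6], by unfold IsMate; decide⟩
  · exact matchable_iff_mate.2 ⟨![3, 2, 1, 0, 5, 4, 7, 6, 9, 8], by unfold IsMate; decide⟩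
  · exact matchable_iff_mate.2 ⟨_, isMate_mateA₄ 1⟩

/-! ### A criterion for the equality of the two forcing numbers -/

/-- A family of sets (of edges) with a member `M` and `k` further members whose differences to `M`
are pairwise disjoint, such that some `k` elements distinguish all members. -/
def IsUniformFamily {E : Type*} (F : Set (Set E)) : Prop :=
  ∃ M ∈ F, ∃ (k : ℕ) (m : Fin k → Set E), (∀ i, m i ∈ F ∧ m i ≠ M) ∧
    (∀ i j, i ≠ j → Disjoint (m i \ M) (m j \ M)) ∧
    ∃ S : Set E, S.Finite ∧ S.ncard ≤ k ∧ ∀ M₁ ∈ F, ∀ M₂ ∈ F, S ∩ M₁ = S ∩ M₂ → M₁ = M₂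

lemma IsUniformFamily.of_fintype {E ι : Type*} [Fintype ι] {F : Set (Set E)} {M : Set E}
    (hM : M ∈ F) (m : ι → Set E) (hm : ∀ i, m i ∈ F ∧ m i ≠ M)
    (hd : ∀ i j, i ≠ j → Disjoint (m i \ M) (m j \ M)) (s : ι → E)
    (hs : ∀ M₁ ∈ F, ∀ M₂ ∈ F, (∀ i, s i ∈ M₁ ↔ s i ∈ M₂) → M₁ = M₂) : IsUniformFamily F := by
  let φ := (Fintype.equivFin ι).symm
  refine ⟨M, hM, Fintype.card ι, m ∘ φ, fun i => hm _,
    fun i j hij => hd _ _ (φ.injective.ne hij), Set.range s, Set.finite_range s, ?_, ?_⟩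
  · rw [← Set.image_univ]
    refine (Set.ncard_image_le Set.finite_univ).trans ?_
    rw [Set.ncard_univ, Nat.card_eq_fintype_card]
  · intro M₁ h₁ M₂ h₂ h
    refine hs M₁ h₁ M₂ h₂ fun i => ?_
    have := Set.ext_iff.1 h (s i)
    simpa using this

/-- An anti-forcing set of `M` meets each of the disjoint differences to `M`. -/
lemma gf_le_maxAf_of_isUniformFamily {V : Type*} [Finite V] {G : SimpleGraph V}
    (h : IsUniformFamily (perfectMatchings G)) : gf G ≤ maxAf G := by
  obtain ⟨M, hM, k, m, hm, hd, S, hSf, hSk, hS⟩ := h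
  have h1 : gf G ≤ k := by
    refine (gf_le (S := S ∩ G.edgeSet) ⟨Set.inter_subset_right, ?_⟩).trans
      ((Set.ncard_le_ncard Set.inter_subset_left hSf).trans hSk)
    intro M₁ h₁ M₂ h₂ hne heq
    refine hne (hS M₁ h₁ M₂ h₂ ?_)
    rwa [Set.inter_assoc, Set.inter_assoc, Set.inter_eq_right.2 (subset_edgeSet h₁),
      Set.inter_eq_right.2 (subset_edgeSet h₂)] at heq
  refine h1.trans (le_trans ?_ (af_le_maxAf hM))
  obtain ⟨T, hT, hTc⟩ := exists_af hM
  rw [← hTc]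
  rw [isAntiForcingSet_iff hM] at hT
  have hex : ∀ i, ∃ e, e ∈ T ∧ e ∈ m i \ M := by
    intro i
    by_contra! hc
    refine (hm i).2 (hT.2 _ (hm i).1 (Set.disjoint_left.2 fun e he heT => ?_))
    exact hc e heT ⟨he, (hT.1 heT).2⟩
  choose t ht using hex
  have hinj : Function.Injective t := by
    intro i j hij
    by_contra hne
    exact Set.disjoint_left.1 (hd i j hne) (ht i).2 (hij ▸ (ht j).2)
  calc k = (Set.range t).ncard := by
        rw [← Set.image_univ, Set.ncard_image_of_injective _ hinj, Set.ncard_univ]; simp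
    _ ≤ T.ncard := Set.ncard_le_ncard (by rintro _ ⟨i, rfl⟩; exact (ht i).1) (Set.toFinite _)

section Conformal

variable {V : Type*} {G : SimpleGraph V}

/-- The perfect matchings of a conformal subgraph `H` are the perfect matchings of `G` that are
contained in a certain set `F` of edges, restricted to `H`. -/
lemma IsConformal.gf_le_maxAf [Finite V] {H : G.Subgraph} (hH : IsConformal H)
    (hHm : Matchable H.coe)
    (h : ∀ F : Set (Sym2 V), (∃ M ∈ perfectMatchings G, M ⊆ F) →
      IsUniformFamily {M | M ∈ perfectMatchings G ∧ M ⊆ F}) : gf H.coe ≤ maxAf H.coe := by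
  classical
  obtain ⟨f, hf⟩ := matchable_induce_iff.1 hH
  let N : Set (Sym2 V) := {e | ∃ x, x ∉ H.verts ∧ e = s(x, f x)}
  let j : Sym2 H.verts → Sym2 V := Sym2.map Subtype.val
  have hj : Function.Injective j := Sym2.map.injective Subtype.val_injective
  let φ : Set (Sym2 H.verts) → Set (Sym2 V) := fun M => j '' M ∪ N
  let F : Set (Sym2 V) := H.edgeSet ∪ N
  have hjN : ∀ e, j e ∉ N := by
    rintro e ⟨x, hx, hex⟩
    have : x ∈ j e := by rw [hex]; exact Sym2.mem_mk_left _ _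
    obtain ⟨y, -, rfl⟩ := Sym2.mem_map.1 this
    exact hx y.2
  have hjφ : ∀ M e, j e ∈ φ M ↔ e ∈ M := by
    intro M e
    constructor
    · rintro (⟨e', he', h⟩ | h)
      · rwa [← hj h]
      · exact absurd h (hjN e)
    · exact fun h => Or.inl ⟨e, h, rfl⟩
  have hφ : ∀ M ∈ perfectMatchings H.coe, φ M ∈ perfectMatchings G ∧ φ M ⊆ F := by
    intro M hM
    obtain ⟨g, hg, rfl⟩ := mem_perfectMatchings_iff_mate.1 hM
    constructor
    · refine mem_perfectMatchings_iff_mate.2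
        ⟨fun x => if hx : x ∈ H.verts then (g ⟨x, hx⟩).1 else f x, fun x => ?_, ?_⟩
      · by_cases hx : x ∈ H.verts
        · have h1 := hg ⟨x, hx⟩
          have h2 : H.Adj x (g ⟨x, hx⟩).1 := h1.1
          simp [hx, h1.2, h2.adj_sub]
        · have h1 := hf x hx
          have h2 : f x ∉ H.verts := h1.1
          simp [hx, h1.2.1, h1.2.2, h2]
      · ext e
        constructor
        · rintro (⟨_, ⟨x, rfl⟩, rfl⟩ | ⟨x, hx, rfl⟩)
          · exact ⟨x.1, by simp [j]⟩
          · exact ⟨x, by simp [hx]⟩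
        · rintro ⟨x, rfl⟩
          by_cases hx : x ∈ H.verts
          · left
            exact ⟨_, ⟨⟨x, hx⟩, rfl⟩, by simp [j, hx]⟩
          · right
            exact ⟨x, hx, by simp [hx]⟩
    · rintro e (⟨_, ⟨x, rfl⟩, rfl⟩ | hN)
      · left
        exact (hg x).1
      · exact Or.inr hN
  have hφ' : ∀ M ∈ perfectMatchings G, M ⊆ F → ∃ M' ∈ perfectMatchings H.coe, φ M' = M := by
    intro M hM hMF
    obtain ⟨g, hg, rfl⟩ := mem_perfectMatchings_iff_mate.1 hM
    have hgH : ∀ x ∈ H.verts, H.Adj x (g x) := by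
      intro x hx
      rcases hMF ⟨x, rfl⟩ with h | ⟨y, hy, h⟩
      · exact h
      · rcases Sym2.eq_iff.1 h with ⟨rfl, -⟩ | ⟨rfl, -⟩
        · exact absurd hx hy
        · exact absurd hx (hf y hy).1
    have hgN : ∀ x, x ∉ H.verts → g x = f x := by
      intro x hx
      rcases hMF ⟨x, rfl⟩ with h | ⟨y, hy, h⟩
      · exact absurd (H.edge_vert h) hx
      · rcases Sym2.eq_iff.1 h with ⟨rfl, h2⟩ | ⟨h1, h2⟩
        · exact h2
        · rw [h2, h1, (hf y hy).2.2]
    let g' : H.verts → H.verts := fun x => ⟨g x, H.edge_vert (hgH x x.2).symm⟩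
    have hg' : IsMate H.coe g' := fun x => ⟨hgH x x.2, Subtype.ext (hg x).2⟩
    refine ⟨mateEdges g', mem_perfectMatchings_iff_mate.2 ⟨g', hg', rfl⟩, ?_⟩
    refine eq_of_subset (hφ _ (mem_perfectMatchings_iff_mate.2 ⟨g', hg', rfl⟩)).1 hM ?_
    rintro e (⟨_, ⟨x, rfl⟩, rfl⟩ | ⟨x, hx, rfl⟩)
    · exact ⟨x.1, rfl⟩
    · exact ⟨x, by rw [hgN x hx]⟩
  have hφi : Function.Injective φ := by
    intro M M' h
    ext e
    rw [← hjφ M, h, hjφ]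
  obtain ⟨M, hM, k, m, hm, hd, S, hSf, hSk, hS⟩ := h F (by
    obtain ⟨M, hM⟩ := hHm
    exact ⟨φ M, (hφ M hM).1, (hφ M hM).2⟩)
  obtain ⟨M', hM', rfl⟩ := hφ' M hM.1 hM.2
  have hex : ∀ i, ∃ M' ∈ perfectMatchings H.coe, φ M' = m i := fun i =>
    hφ' _ (hm i).1.1 (hm i).1.2
  choose m' hm' hm'' using hex
  refine gf_le_maxAf_of_isUniformFamily ⟨M', hM', k, m', fun i => ⟨hm' i, ?_⟩, ?_,
    j ⁻¹' S, hSf.preimage hj.injOn, ?_, ?_⟩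
  · intro he
    exact (hm i).2 (by rw [← hm'' i, he])
  · intro i i' hii
    rw [Set.disjoint_left]
    rintro e ⟨h1, h2⟩ ⟨h3, -⟩
    refine Set.disjoint_left.1 (hd i i' hii) (show j e ∈ _ from ⟨?_, ?_⟩) ⟨?_, ?_⟩
    · rw [← hm'' i, hjφ]; exact h1
    · rw [hjφ]; exact h2
    · rw [← hm'' i', hjφ]; exact h3
    · rw [hjφ]; exact h2
  · refine le_trans ?_ hSk
    exact Set.ncard_le_ncard_of_injOn j (fun e he => he) hj.injOn hSf
  · intro M₁ h₁ M₂ h₂ heq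
    refine hφi (hS _ (hφ M₁ h₁) _ (hφ M₂ h₂) ?_)
    have key : ∀ M₁ M₂, j ⁻¹' S ∩ M₁ = j ⁻¹' S ∩ M₂ → S ∩ φ M₁ ⊆ S ∩ φ M₂ := by
      rintro M₁ M₂ heq e ⟨heS, ⟨e', he', rfl⟩ | heN⟩
      · refine ⟨heS, Or.inl ⟨e', ?_, rfl⟩⟩
        have : e' ∈ j ⁻¹' S ∩ M₁ := ⟨heS, he'⟩
        rw [heq] at this
        exact this.2
      · exact ⟨heS, Or.inr heN⟩
    exact Set.Subset.antisymm (key _ _ heq) (key _ _ heq.symm)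

/-- A bipartite graph is strongly uniform if, for every set `F` of edges that contains a perfect
matching, the perfect matchings contained in `F` form a uniform family. -/
lemma stronglyUniform_of_isUniformFamily [Finite V] {c : V → Bool}
    (hc : ∀ x y, G.Adj x y → c x ≠ c y) (hG : Matchable G)
    (h : ∀ F : Set (Sym2 V), (∃ M ∈ perfectMatchings G, M ⊆ F) →
      IsUniformFamily {M | M ∈ perfectMatchings G ∧ M ⊆ F}) : StronglyUniform G := by
  refine ⟨hG, fun H hH hHm => le_antisymm (hH.gf_le_maxAf hHm h) ?_⟩
  exact maxAf_le_gf (fun x : H.verts => c x) fun x y hxy => hc _ _ (H.adj_sub hxy)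

end Conformal

/-! ### Hamilton cycles as periodic enumerations -/

/-- `v` runs periodically, with period `N`, through the vertices of a Hamilton cycle of `G`. -/
structure HamEnum {V : Type*} (G : SimpleGraph V) (N : ℤ) (v : ℤ → V) : Prop where
  three_le : 3 ≤ N
  adj : ∀ i, G.Adj (v i) (v (i + 1))
  eq_iff : ∀ i j, v i = v j ↔ N ∣ i - j
  surj : ∀ x, ∃ i, v i = x

namespace HamEnum

variable {V : Type*} {G : SimpleGraph V} {N : ℤ} {v : ℤ → V}

lemma shift (hv : HamEnum G N v) (k : ℤ) : HamEnum G N (fun i => v (i + k)) where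
  three_le := hv.three_le
  adj i := by have := hv.adj (i + k); rwa [show i + k + 1 = i + 1 + k by ring] at this
  eq_iff i j := by rw [hv.eq_iff]; ring_nf
  surj x := by
    obtain ⟨i, rfl⟩ := hv.surj x
    exact ⟨i - k, by simp⟩

lemma neg (hv : HamEnum G N v) : HamEnum G N (fun i => v (-i)) where
  three_le := hv.three_le
  adj i := by
    have := (hv.adj (-(i + 1))).symm
    rwa [show -(i + 1) + 1 = -i by ring] at this
  eq_iff i j := by
    rw [hv.eq_iff, ← dvd_neg, show -(-i - -j) = i - j by ring]
  surj x := by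
    obtain ⟨i, rfl⟩ := hv.surj x
    exact ⟨-i, by simp⟩

lemma add_period (hv : HamEnum G N v) (i : ℤ) : v (i + N) = v i :=
  (hv.eq_iff _ _).2 ⟨1, by ring⟩

lemma sub_period (hv : HamEnum G N v) (i : ℤ) : v (i - N) = v i :=
  (hv.eq_iff _ _).2 ⟨-1, by ring⟩

lemma exists_range (hv : HamEnum G N v) (x : V) : ∃ i, 0 ≤ i ∧ i < N ∧ v i = x := by
  obtain ⟨i, rfl⟩ := hv.surj x
  have := hv.three_le
  refine ⟨i % N, Int.emod_nonneg _ (by omega), Int.emod_lt_of_pos _ (by omega), ?_⟩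
  rw [hv.eq_iff]
  exact ⟨-(i / N), by have := Int.emod_add_mul_ediv i N; linarith⟩

lemma inj (hv : HamEnum G N v) {i j : ℤ} (h : v i = v j) (h1 : i - j < N) (h2 : j - i < N) :
    i = j := by
  have := Int.eq_zero_of_abs_lt_dvd ((hv.eq_iff i j).1 h) (abs_lt.2 ⟨by omega, by omega⟩)
  omega

/-- The edges of the Hamilton cycle that is enumerated by `v`. -/
def cycEdge (v : ℤ → V) (i : ℤ) : Sym2 V := s(v i, v (i + 1))

lemma cycEdge_mem (hv : HamEnum G N v) (i : ℤ) : cycEdge v i ∈ G.edgeSet := hv.adj i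

lemma cycEdge_eq_iff (hv : HamEnum G N v) (i j : ℤ) :
    cycEdge v i = cycEdge v j ↔ N ∣ i - j := by
  constructor
  · intro h
    rcases Sym2.eq_iff.1 h with ⟨h1, -⟩ | ⟨h1, h2⟩
    · exact (hv.eq_iff _ _).1 h1
    · have h3 := (hv.eq_iff _ _).1 h1
      have h4 := (hv.eq_iff _ _).1 h2
      have h5 := dvd_sub h4 h3
      have h6 := Int.le_of_dvd (by norm_num) (show N ∣ 2 by
        rwa [show i + 1 - j - (i - (j + 1)) = 2 by ring] at h5)
      have := hv.three_le
      omega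
  · intro h
    have h1 := (hv.eq_iff _ _).2 h
    have h2 : v (i + 1) = v (j + 1) :=
      (hv.eq_iff _ _).2 (by rwa [show i + 1 - (j + 1) = i - j by ring])
    rw [cycEdge, cycEdge, h1, h2]

lemma cycEdge_inj (hv : HamEnum G N v) {i j : ℤ} (h : cycEdge v i = cycEdge v j)
    (h1 : i - j < N) (h2 : j - i < N) : i = j := by
  have := Int.eq_zero_of_abs_lt_dvd ((hv.cycEdge_eq_iff i j).1 h) (abs_lt.2 ⟨by omega, by omega⟩)
  omega

lemma mem_cycEdge_iff (hv : HamEnum G N v) {i j : ℤ} (hi : -1 ≤ i) (hi' : i < N) (hj : 0 ≤ j)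
    (hj' : j < N) : v j ∈ cycEdge v i ↔ i = j ∨ i = j - 1 ∨ (i = -1 ∧ j = N - 1) ∨
      (i = N - 1 ∧ j = 0) := by
  have h3 := hv.three_le
  rw [cycEdge, Sym2.mem_iff]
  constructor
  · rintro (h | h)
    · by_cases hi0 : i = -1
      · have : v j = v (i + N) := by rw [hv.add_period]; exact h
        have := hv.inj this (by omega) (by omega)
        omega
      · left
        exact (hv.inj h (by omega) (by omega)).symm
    · by_cases hi0 : i = N - 1
      · have : v j = v (i + 1 - N) := by rw [hv.sub_period]; exact h
        have := hv.inj this (by omega) (by omega)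
        omega
      · have := hv.inj h (by omega) (by omega)
        omega
  · rintro (rfl | rfl | ⟨rfl, rfl⟩ | ⟨rfl, rfl⟩)
    · exact Or.inl rfl
    · right; rw [sub_add_cancel]
    · left; rw [hv.eq_iff]; exact ⟨1, by ring⟩
    · right; rw [hv.eq_iff]; exact ⟨-1, by ring⟩

end HamEnum

/-- A Hamilton cycle of even length `N` and pairwise disjoint chords that make up all edges of `G`.
The chord `k` joins the vertices in the even position `p k` and the odd position `q k > p k`. -/
structure ChordSystem {V : Type*} (G : SimpleGraph V) (N : ℤ) (v : ℤ → V) {ι : Type*}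
    (p q : ι → ℤ) : Prop where
  ham : HamEnum G N v
  even_N : Even N
  nonneg : ∀ k, 0 ≤ p k
  lt : ∀ k, p k < q k
  lt_N : ∀ k, q k < N
  even_p : ∀ k, Even (p k)
  odd_q : ∀ k, Odd (q k)
  p_inj : Function.Injective p
  q_inj : Function.Injective q
  adj : ∀ k, G.Adj (v (p k)) (v (q k))
  not_cyc : ∀ k i, s(v (p k), v (q k)) ≠ HamEnum.cycEdge v i
  edge : ∀ e ∈ G.edgeSet, (∃ i, e = HamEnum.cycEdge v i) ∨ ∃ k, e = s(v (p k), v (q k))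

namespace ChordSystem

open HamEnum

variable {V : Type*} {G : SimpleGraph V} {N : ℤ} {v : ℤ → V} {ι : Type*} {p q : ι → ℤ}

/-- The chord `k` of a chord system. -/
def chord (v : ℤ → V) (p q : ι → ℤ) (k : ι) : Sym2 V := s(v (p k), v (q k))

lemma p_ne_q (h : ChordSystem G N v p q) (k l : ι) : p k ≠ q l := by
  intro he
  have h1 := h.even_p k
  have h2 := h.odd_q l
  rw [he] at h1
  exact (Int.not_even_iff_odd.2 h2) h1

lemma mem_chord_iff (h : ChordSystem G N v p q) {k : ι} {j : ℤ} (hj : 0 ≤ j) (hj' : j < N) :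
    v j ∈ chord v p q k ↔ p k = j ∨ q k = j := by
  have h1 := h.nonneg k
  have h2 := h.lt k
  have h3 := h.lt_N k
  rw [chord, Sym2.mem_iff]
  constructor
  · rintro (h' | h')
    · exact Or.inl (h.ham.inj h' (by omega) (by omega)).symm
    · exact Or.inr (h.ham.inj h' (by omega) (by omega)).symm
  · rintro (rfl | rfl) <;> simp

lemma chord_inj (h : ChordSystem G N v p q) : Function.Injective (chord v p q) := by
  intro k l hkl
  have h1 := h.nonneg k
  have h2 := h.lt k
  have h3 := h.lt_N k
  have : v (p k) ∈ chord v p q l := by rw [← hkl]; exact Sym2.mem_mk_left _ _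
  rcases (h.mem_chord_iff h1 (by omega)).1 this with h4 | h4
  · exact (h.p_inj h4).symm
  · exact absurd h4.symm (h.p_ne_q k l)

lemma exists_cycEdge_range (h : ChordSystem G N v p q) (i : ℤ) :
    ∃ j, 0 ≤ j ∧ j < N ∧ cycEdge v i = cycEdge v j := by
  have := h.ham.three_le
  refine ⟨i % N, Int.emod_nonneg _ (by omega), Int.emod_lt_of_pos _ (by omega), ?_⟩
  rw [h.ham.cycEdge_eq_iff]
  exact ⟨i / N, by have := Int.emod_add_mul_ediv i N; linarith⟩

open Classical in
/-- The indicator of the `i`-th edge of the cycle in `M` for even `i`, and of its absence for odd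
`i`. Along the cycle it changes at the ends of the chords in `M` only. -/
noncomputable def pot (v : ℤ → V) (M : Set (Sym2 V)) (i : ℤ) : ℤ :=
  if (cycEdge v i ∈ M ↔ Even i) then 1 else 0

open Classical in
/-- The number of chords in `M` that leave the vertex in position `i` or an earlier one and end
after it. -/
noncomputable def cover [Fintype ι] (v : ℤ → V) (p q : ι → ℤ) (M : Set (Sym2 V)) (i : ℤ) : ℤ :=
  ∑ k, if chord v p q k ∈ M ∧ p k ≤ i ∧ i < q k then 1 else 0

lemma edges_at (h : ChordSystem G N v p q) {j : ℤ} (hj : 0 ≤ j) (hj' : j < N) {e : Sym2 V}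
    (he : e ∈ G.edgeSet) (hje : v j ∈ e) :
    e = cycEdge v (j - 1) ∨ e = cycEdge v j ∨ ∃ k, (p k = j ∨ q k = j) ∧ e = chord v p q k := by
  rcases h.edge e he with ⟨i, rfl⟩ | ⟨k, rfl⟩
  · obtain ⟨i', h0, h1, h2⟩ := h.exists_cycEdge_range i
    rw [h2] at hje ⊢
    rcases (h.ham.mem_cycEdge_iff (by omega) h1 hj hj').1 hje with rfl | rfl | ⟨rfl, rfl⟩ | ⟨rfl, rfl⟩
    · exact Or.inr (Or.inl rfl)
    · exact Or.inl rfl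
    · omega
    · left
      rw [h.ham.cycEdge_eq_iff]
      exact ⟨1, by ring⟩
  · exact Or.inr (Or.inr ⟨k, (h.mem_chord_iff hj hj').1 hje, rfl⟩)

open Classical in
lemma cover_sub_cover [Fintype ι] (h : ChordSystem G N v p q) (M : Set (Sym2 V)) {j : ℤ} {k : ι}
    (hk : p k = j ∨ q k = j) : cover v p q M j - cover v p q M (j - 1) =
      if chord v p q k ∈ M then (if Even j then 1 else -1) else 0 := by
  classical
  rw [cover, cover, ← Finset.sum_sub_distrib]
  rw [Finset.sum_eq_single k]
  · have h1 := h.lt k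
    have h2 := h.even_p k
    have h3 := Int.not_even_iff_odd.2 (h.odd_q k)
    rcases hk with rfl | rfl
    · by_cases hM : chord v p q k ∈ M <;> simp [hM, h1, h2]
    · have : p k ≤ q k - 1 := by omega
      by_cases hM : chord v p q k ∈ M <;> simp [hM, h3, this]
  · intro l _ hl
    have h1 : p l ≠ p k := h.p_inj.ne hl
    have h2 : q l ≠ q k := h.q_inj.ne hl
    have h3 := h.p_ne_q l k
    have h4 := h.p_ne_q k l
    have h5 : (p l ≤ j ∧ j < q l) ↔ (p l ≤ j - 1 ∧ j - 1 < q l) := by omega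
    simp only [h5, sub_self]
  · simp

lemma cover_sub_cover_of_forall [Fintype ι] (M : Set (Sym2 V)) {j : ℤ}
    (hk : ∀ k, ¬ (p k = j ∨ q k = j)) : cover v p q M j - cover v p q M (j - 1) = 0 := by
  classical
  rw [cover, cover, ← Finset.sum_sub_distrib]
  refine Finset.sum_eq_zero fun l _ => ?_
  have h1 := hk l
  have h5 : (p l ≤ j ∧ j < q l) ↔ (p l ≤ j - 1 ∧ j - 1 < q l) := by omega
  simp only [h5, sub_self]

lemma existsUnique_iff [Fintype ι] (h : ChordSystem G N v p q) {M : Set (Sym2 V)}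
    (hM : M ⊆ G.edgeSet) {j : ℤ} (hj : 0 ≤ j) (hj' : j < N) :
    (∃! e, e ∈ M ∧ v j ∈ e) ↔
      pot v M j - pot v M (j - 1) = - (cover v p q M j - cover v p q M (j - 1)) := by
  classical
  have h1 : v j ∈ cycEdge v (j - 1) :=
    (h.ham.mem_cycEdge_iff (by omega) (by omega) hj hj').2 (Or.inr (Or.inl rfl))
  have h2 : v j ∈ cycEdge v j :=
    (h.ham.mem_cycEdge_iff (by omega) (by omega) hj hj').2 (Or.inl rfl)
  have h12 : cycEdge v (j - 1) ≠ cycEdge v j := by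
    intro he
    have := h.ham.three_le
    have := h.ham.cycEdge_inj he (by omega) (by omega)
    omega
  have hev : Even (j - 1) ↔ ¬ Even j := by simp
  by_cases hk : ∃ k, p k = j ∨ q k = j
  · obtain ⟨k, hk⟩ := hk
    have h3 : v j ∈ chord v p q k := (h.mem_chord_iff hj hj').2 hk
    rw [h.cover_sub_cover M hk]
    have h13 : chord v p q k ≠ cycEdge v (j - 1) := h.not_cyc k _
    have h23 : chord v p q k ≠ cycEdge v j := h.not_cyc k _
    have hall : ∀ e ∈ M, v j ∈ e → e = cycEdge v (j - 1) ∨ e = cycEdge v j ∨ e = chord v p q k := by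
      intro e he hje
      rcases h.edges_at hj hj' (hM he) hje with h4 | h4 | ⟨l, hl, rfl⟩
      · exact Or.inl h4
      · exact Or.inr (Or.inl h4)
      · have : l = k := by
          rcases hl with hl | hl <;> rcases hk with hk | hk
          · exact h.p_inj (hl.trans hk.symm)
          · exact absurd (hl.trans hk.symm) (h.p_ne_q _ _)
          · exact absurd (hk.trans hl.symm) (h.p_ne_q _ _)
          · exact h.q_inj (hl.trans hk.symm)
        exact Or.inr (Or.inr (by rw [this]))
    have key : (∃! e, e ∈ M ∧ v j ∈ e) ↔
        (cycEdge v (j - 1) ∈ M ∧ cycEdge v j ∉ M ∧ chord v p q k ∉ M) ∨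
        (cycEdge v (j - 1) ∉ M ∧ cycEdge v j ∈ M ∧ chord v p q k ∉ M) ∨
        (cycEdge v (j - 1) ∉ M ∧ cycEdge v j ∉ M ∧ chord v p q k ∈ M) := by
      constructor
      · rintro ⟨e, ⟨he, hje⟩, hu⟩
        have e1 : cycEdge v (j - 1) ∈ M → cycEdge v (j - 1) = e := fun hh => hu _ ⟨hh, h1⟩
        have e2 : cycEdge v j ∈ M → cycEdge v j = e := fun hh => hu _ ⟨hh, h2⟩
        have e3 : chord v p q k ∈ M → chord v p q k = e := fun hh => hu _ ⟨hh, h3⟩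
        rcases hall e he hje with rfl | rfl | rfl
        · exact Or.inl ⟨he, fun hh => h12 (e2 hh).symm, fun hh => h13 (e3 hh)⟩
        · exact Or.inr (Or.inl ⟨fun hh => h12 (e1 hh), he, fun hh => h23 (e3 hh)⟩)
        · exact Or.inr (Or.inr ⟨fun hh => h13 (e1 hh).symm, fun hh => h23 (e2 hh).symm, he⟩)
      · rintro (⟨a, b, c⟩ | ⟨a, b, c⟩ | ⟨a, b, c⟩)
        · refine ⟨_, ⟨a, h1⟩, fun e he => ?_⟩
          rcases hall e he.1 he.2 with rfl | rfl | rfl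
          exacts [rfl, absurd he.1 b, absurd he.1 c]
        · refine ⟨_, ⟨b, h2⟩, fun e he => ?_⟩
          rcases hall e he.1 he.2 with rfl | rfl | rfl
          exacts [absurd he.1 a, rfl, absurd he.1 c]
        · refine ⟨_, ⟨c, h3⟩, fun e he => ?_⟩
          rcases hall e he.1 he.2 with rfl | rfl | rfl
          exacts [absurd he.1 a, absurd he.1 b, rfl]
    rw [key, pot, pot]
    simp only [hev]
    by_cases c1 : cycEdge v (j - 1) ∈ M <;> by_cases c2 : cycEdge v j ∈ M <;>
      by_cases c3 : chord v p q k ∈ M <;> by_cases c4 : Even j <;> simp [c1, c2, c3, c4]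
  · push Not at hk
    rw [cover_sub_cover_of_forall M fun k => by have := hk k; tauto]
    have hall : ∀ e ∈ M, v j ∈ e → e = cycEdge v (j - 1) ∨ e = cycEdge v j := by
      intro e he hje
      rcases h.edges_at hj hj' (hM he) hje with h4 | h4 | ⟨l, hl, rfl⟩
      · exact Or.inl h4
      · exact Or.inr h4
      · have := hk l
        tauto
    have key : (∃! e, e ∈ M ∧ v j ∈ e) ↔
        (cycEdge v (j - 1) ∈ M ∧ cycEdge v j ∉ M) ∨ (cycEdge v (j - 1) ∉ M ∧ cycEdge v j ∈ M) := by
      constructor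
      · rintro ⟨e, ⟨he, hje⟩, hu⟩
        have e1 : cycEdge v (j - 1) ∈ M → cycEdge v (j - 1) = e := fun hh => hu _ ⟨hh, h1⟩
        have e2 : cycEdge v j ∈ M → cycEdge v j = e := fun hh => hu _ ⟨hh, h2⟩
        rcases hall e he hje with rfl | rfl
        · exact Or.inl ⟨he, fun hh => h12 (e2 hh).symm⟩
        · exact Or.inr ⟨fun hh => h12 (e1 hh), he⟩
      · rintro (⟨a, b⟩ | ⟨a, b⟩)
        · refine ⟨_, ⟨a, h1⟩, fun e he => ?_⟩
          rcases hall e he.1 he.2 with rfl | rfl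
          exacts [rfl, absurd he.1 b]
        · refine ⟨_, ⟨b, h2⟩, fun e he => ?_⟩
          rcases hall e he.1 he.2 with rfl | rfl
          exacts [absurd he.1 a, rfl]
    rw [key, pot, pot]
    simp only [hev]
    by_cases c1 : cycEdge v (j - 1) ∈ M <;> by_cases c2 : cycEdge v j ∈ M <;>
      by_cases c4 : Even j <;> simp [c1, c2, c4]

lemma cover_neg_one [Fintype ι] (h : ChordSystem G N v p q) (M : Set (Sym2 V)) :
    cover v p q M (-1) = 0 := by
  classical
  refine Finset.sum_eq_zero fun k _ => if_neg ?_
  have := h.nonneg k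
  omega

/-- Perfect matchings are characterized by their potentials. -/
lemma mem_perfectMatchings_iff_pot [Fintype ι] (h : ChordSystem G N v p q) {M : Set (Sym2 V)} :
    M ∈ perfectMatchings G ↔ M ⊆ G.edgeSet ∧
      ∀ i, 0 ≤ i → i < N → pot v M i = pot v M (-1) - cover v p q M i := by
  rw [mem_perfectMatchings_iff]
  refine and_congr_right fun hM => ?_
  constructor
  · intro hu
    have key : ∀ n : ℕ, (n : ℤ) - 1 < N →
        pot v M ((n : ℤ) - 1) = pot v M (-1) - cover v p q M ((n : ℤ) - 1) := by
      intro n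
      induction n with
      | zero => intro _; simp [h.cover_neg_one M]
      | succ n ih =>
        intro hn
        push_cast at hn ⊢
        have h1 := ih (by omega)
        have h2 := (h.existsUnique_iff hM (j := (n : ℤ)) (by omega) (by omega)).1 (hu _)
        rw [show (n : ℤ) + 1 - 1 = n by ring]
        linarith
    intro i hi hi'
    have := key (i + 1).toNat (by omega)
    rwa [show (((i + 1).toNat : ℕ) : ℤ) - 1 = i by omega] at this
  · intro hp x
    obtain ⟨j, hj, hj', rfl⟩ := h.ham.exists_range x
    rw [h.existsUnique_iff hM hj hj']
    have h1 := hp j hj hj'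
    by_cases hj0 : j = 0
    · subst hj0
      have h2 := h.cover_neg_one M
      rw [show (0 : ℤ) - 1 = -1 by ring]
      linarith
    · have h2 := hp (j - 1) (by omega) (by omega)
      linarith

end ChordSystem

namespace ChordSystem

open HamEnum

variable {V : Type*} {G : SimpleGraph V} {N : ℤ} {v : ℤ → V} {ι : Type*} {p q : ι → ℤ}
  {M M₁ M₂ : Set (Sym2 V)}

lemma pot_eq_zero_or_one (M : Set (Sym2 V)) (i : ℤ) : pot v M i = 0 ∨ pot v M i = 1 := by
  classical
  unfold pot
  split_ifs <;> simp

lemma pot_eq_one_iff {i : ℤ} : pot v M i = 1 ↔ (cycEdge v i ∈ M ↔ Even i) := by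
  classical
  unfold pot
  split_ifs with h <;> simp [h]

lemma pot_neg_one_iff : pot v M (-1) = 1 ↔ cycEdge v (-1) ∉ M := by
  rw [pot_eq_one_iff]
  have : ¬ Even (-1 : ℤ) := by decide
  simp [this]

lemma cycEdge_neg_one (h : ChordSystem G N v p q) : cycEdge v (-1) = cycEdge v (N - 1) :=
  (h.ham.cycEdge_eq_iff _ _).2 ⟨-1, by ring⟩

/-- Perfect matchings that contain the same chords and have the same potential before the first
vertex are equal. -/
lemma eq_of_chords [Fintype ι] (h : ChordSystem G N v p q) (h₁ : M₁ ∈ perfectMatchings G)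
    (h₂ : M₂ ∈ perfectMatchings G) (ht : cycEdge v (-1) ∈ M₁ ↔ cycEdge v (-1) ∈ M₂)
    (hc : ∀ k, chord v p q k ∈ M₁ ↔ chord v p q k ∈ M₂) : M₁ = M₂ := by
  classical
  have hp : pot v M₁ (-1) = pot v M₂ (-1) := by
    have := pot_neg_one_iff (v := v) (M := M₁)
    have := pot_neg_one_iff (v := v) (M := M₂)
    rcases pot_eq_zero_or_one (v := v) M₁ (-1) with a | a <;>
      rcases pot_eq_zero_or_one (v := v) M₂ (-1) with b | b <;> simp_all
  have hcov : ∀ i, cover v p q M₁ i = cover v p q M₂ i := by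
    intro i
    simp only [cover, hc]
  refine eq_of_subset h₁ h₂ fun e he => ?_
  rcases h.edge e (subset_edgeSet h₁ he) with ⟨i, rfl⟩ | ⟨k, rfl⟩
  · obtain ⟨j, hj, hj', hij⟩ := h.exists_cycEdge_range i
    rw [hij] at he ⊢
    have e1 := (h.mem_perfectMatchings_iff_pot.1 h₁).2 j hj hj'
    have e2 := (h.mem_perfectMatchings_iff_pot.1 h₂).2 j hj hj'
    rw [hp, hcov, ← e2] at e1
    have e3 := pot_eq_one_iff (v := v) (M := M₁) (i := j)
    have e4 := pot_eq_one_iff (v := v) (M := M₂) (i := j)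
    rw [e1, e4] at e3
    tauto
  · exact (hc k).1 he

/-! ### Hamilton cycles with pairwise parallel chords -/

/-- The `i`-th edge of the Hamilton cycle lies between the ends of a chord in `Y`. -/
def IsCovered (p q : ι → ℤ) (Y : Set ι) (i : ℤ) : Prop := ∃ k ∈ Y, p k ≤ i ∧ i < q k

section Disjoint

variable [Fintype ι] (h : ChordSystem G N v p q) (hd : ∀ k l, k ≠ l → q k < p l ∨ q l < p k)
include h hd

open Classical in
lemma cover_eq (M : Set (Sym2 V)) (i : ℤ) :
    cover v p q M i = if ∃ k, chord v p q k ∈ M ∧ p k ≤ i ∧ i < q k then 1 else 0 := by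
  split_ifs with hk
  · obtain ⟨k, hk⟩ := hk
    rw [cover, Finset.sum_eq_single k]
    · rw [if_pos hk]
    · intro l _ hl
      refine if_neg ?_
      have := hd l k hl
      have := h.lt k
      have := h.lt l
      omega
    · simp
  · exact Finset.sum_eq_zero fun k _ => if_neg fun hh => hk ⟨k, hh⟩

lemma cycEdge_neg_one_notMem (hM : M ∈ perfectMatchings G) {k : ι} (hk : chord v p q k ∈ M) :
    cycEdge v (-1) ∉ M := by
  classical
  have h1 := h.nonneg k
  have h2 := h.lt k
  have h3 := h.lt_N k
  have := (h.mem_perfectMatchings_iff_pot.1 hM).2 (p k) h1 (by omega)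
  rw [h.cover_eq hd, if_pos ⟨k, hk, le_rfl, h2⟩] at this
  rw [← pot_neg_one_iff]
  have := pot_eq_zero_or_one (v := v) M (p k)
  have := pot_eq_zero_or_one (v := v) M (-1)
  omega

lemma cycEdge_mem_iff (hM : M ∈ perfectMatchings G) {Y : Set ι}
    (hY : ∀ k, chord v p q k ∈ M ↔ k ∈ Y) {i : ℤ} (hi : 0 ≤ i) (hi' : i < N) :
    (cycEdge v i ∈ M ↔ Even i) ↔ (cycEdge v (-1) ∉ M ∧ ¬ IsCovered p q Y i) := by
  classical
  simp only [IsCovered, ← hY]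
  rw [← pot_eq_one_iff, (h.mem_perfectMatchings_iff_pot.1 hM).2 i hi hi', h.cover_eq hd,
    ← pot_neg_one_iff]
  have h1 := pot_eq_zero_or_one (v := v) M (-1)
  split_ifs with hc
  · simp only [hc, not_true, and_false, iff_false]
    omega
  · simp [hc]

/-- Every set of chords is the set of chords of a perfect matching. -/
lemma exists_perfectMatching (Y : Set ι) : ∃ M ∈ perfectMatchings G, cycEdge v (-1) ∉ M ∧
    ∀ k, chord v p q k ∈ M ↔ k ∈ Y := by
  classical
  let M : Set (Sym2 V) := {e | (∃ k ∈ Y, e = chord v p q k) ∨ ∃ i, 0 ≤ i ∧ i < N ∧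
    e = cycEdge v i ∧ (Even i ↔ ¬ IsCovered p q Y i)}
  have hc : ∀ k, chord v p q k ∈ M ↔ k ∈ Y := by
    intro k
    constructor
    · rintro (⟨l, hl, he⟩ | ⟨i, -, -, he, -⟩)
      · rwa [h.chord_inj he]
      · exact absurd he (h.not_cyc k i)
    · exact fun hk => Or.inl ⟨k, hk, rfl⟩
  have hy : ∀ i, 0 ≤ i → i < N →
      (cycEdge v i ∈ M ↔ (Even i ↔ ¬ IsCovered p q Y i)) := by
    intro i hi hi'
    constructor
    · rintro (⟨l, hl, he⟩ | ⟨j, hj, hj', he, h2⟩)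
      · exact absurd he.symm (h.not_cyc l i)
      · rwa [h.ham.cycEdge_inj he (by omega) (by omega)]
    · exact fun h2 => Or.inr ⟨i, hi, hi', rfl, h2⟩
  have ht : cycEdge v (-1) ∉ M := by
    have h3 := h.ham.three_le
    rw [h.cycEdge_neg_one, hy _ (by omega) (by omega)]
    have h1 : ¬ Even (N - 1) := by simp [h.even_N]
    have h2 : ¬ IsCovered p q Y (N - 1) := by
      rintro ⟨k, -, -, hk⟩
      have := h.lt_N k
      omega
    simp only [h1, h2, not_false_iff]
    simp
  refine ⟨M, h.mem_perfectMatchings_iff_pot.2 ⟨?_, fun i hi hi' => ?_⟩, ht, hc⟩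
  · rintro e (⟨k, -, rfl⟩ | ⟨i, -, -, rfl, -⟩)
    · exact h.adj k
    · exact h.ham.adj i
  · rw [pot_neg_one_iff.2 ht, h.cover_eq hd]
    simp only [hc]
    have h1 : (cycEdge v i ∈ M ↔ Even i) ↔ ¬ IsCovered p q Y i := by
      rw [hy i hi hi']
      by_cases c1 : Even i <;> by_cases c2 : IsCovered p q Y i <;> simp [c1, c2]
    rw [← pot_eq_one_iff] at h1
    split_ifs with c2
    · rcases pot_eq_zero_or_one (v := v) M i with h2 | h2
      · simp [h2]
      · exact absurd c2 (h1.1 h2)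
    · simp [h1.2 c2]

/-- Choose the perfect matching with the largest possible set of chords. It changes independently
along the cycles that consist of a chord and the part of the Hamilton cycle it cuts off, and along
the cycle that remains when all these parts are replaced by their chords. -/
lemma isUniformFamily_of_disjoint {F : Set (Sym2 V)} (hF : ∃ M ∈ perfectMatchings G, M ⊆ F) :
    IsUniformFamily {M | M ∈ perfectMatchings G ∧ M ⊆ F} := by
  classical
  have hbot : ∀ {M₁ M₂}, M₁ ∈ perfectMatchings G → M₂ ∈ perfectMatchings G →
      cycEdge v (-1) ∈ M₁ → cycEdge v (-1) ∈ M₂ → M₁ = M₂ := by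
    intro M₁ M₂ h₁ h₂ t₁ t₂
    refine h.eq_of_chords h₁ h₂ (iff_of_true t₁ t₂) fun k => iff_of_false ?_ ?_
    · exact fun hk => h.cycEdge_neg_one_notMem hd h₁ hk t₁
    · exact fun hk => h.cycEdge_neg_one_notMem hd h₂ hk t₂
  by_cases htop : ∃ M ∈ perfectMatchings G, M ⊆ F ∧ cycEdge v (-1) ∉ M
  swap
  · push Not at htop
    obtain ⟨M, hM, hMF⟩ := hF
    refine IsUniformFamily.of_fintype (ι := Empty) ⟨hM, hMF⟩ (fun i => i.elim) (fun i => i.elim)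
      (fun i => i.elim) (fun i => i.elim) ?_
    rintro M₁ ⟨h₁, h₁'⟩ M₂ ⟨h₂, h₂'⟩ -
    exact hbot h₁ h₂ (htop _ h₁ h₁') (htop _ h₂ h₂')
  obtain ⟨M₀, hM₀, hM₀F, hM₀t⟩ := htop
  let J : Set ι := {k | ∃ M ∈ perfectMatchings G, M ⊆ F ∧ chord v p q k ∈ M}
  let Free : Set ι := {k | k ∈ J ∧ ∃ M ∈ perfectMatchings G, M ⊆ F ∧ cycEdge v (-1) ∉ M ∧
    chord v p q k ∉ M}
  have hreal : ∀ Y : Set ι, Y ⊆ J → (∀ k, k ∉ Y → ∃ M ∈ perfectMatchings G, M ⊆ F ∧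
      cycEdge v (-1) ∉ M ∧ chord v p q k ∉ M) → ∃ M ∈ perfectMatchings G, M ⊆ F ∧
      cycEdge v (-1) ∉ M ∧ ∀ k, chord v p q k ∈ M ↔ k ∈ Y := by
    intro Y hY hY'
    obtain ⟨M, hM, hMt, hMc⟩ := h.exists_perfectMatching hd Y
    refine ⟨M, hM, fun e he => ?_, hMt, hMc⟩
    rcases h.edge e (subset_edgeSet hM he) with ⟨i, rfl⟩ | ⟨k, rfl⟩
    · obtain ⟨j, hj, hj', hij⟩ := h.exists_cycEdge_range i
      rw [hij] at he ⊢
      have key := h.cycEdge_mem_iff hd hM hMc hj hj'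
      by_cases hcov : IsCovered p q Y j
      · have hev : ¬ Even j := by tauto
        obtain ⟨k, hk, hkj⟩ := hcov
        obtain ⟨M', hM', hMF', hk'⟩ := hY hk
        apply hMF'
        have key' := h.cycEdge_mem_iff hd hM' (fun _ => Iff.rfl) hj hj'
        have : IsCovered p q {k | chord v p q k ∈ M'} j := ⟨k, hk', hkj⟩
        tauto
      · have hev : Even j := by tauto
        by_cases hcov' : ∃ k, p k ≤ j ∧ j < q k
        · obtain ⟨k, hk⟩ := hcov'
          have hkY : k ∉ Y := fun hh => hcov ⟨k, hh, hk⟩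
          obtain ⟨M', hM', hMF', ht', hk'⟩ := hY' k hkY
          apply hMF'
          have key' := h.cycEdge_mem_iff hd hM' (fun _ => Iff.rfl) hj hj'
          have : ¬ IsCovered p q {k | chord v p q k ∈ M'} j := by
            rintro ⟨l, hl, hlj⟩
            have hlk : l ≠ k := by rintro rfl; exact hk' hl
            have := hd l k hlk
            omega
          tauto
        · apply hM₀F
          have key' := h.cycEdge_mem_iff hd hM₀ (fun _ => Iff.rfl) hj hj'
          have : ¬ IsCovered p q {k | chord v p q k ∈ M₀} j := by
            rintro ⟨l, -, hlj⟩
            exact hcov' ⟨l, hlj⟩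
          tauto
    · obtain ⟨M', hM', hMF', hk'⟩ := hY ((hMc k).1 he)
      exact hMF' hk'
  obtain ⟨MJ, hMJ, hMJF, hMJt, hMJc⟩ := hreal J subset_rfl fun k hk =>
    ⟨M₀, hM₀, hM₀F, hM₀t, fun hh => hk ⟨M₀, hM₀, hM₀F, hh⟩⟩
  have hflip : ∀ k : Free, ∃ M ∈ perfectMatchings G, M ⊆ F ∧ cycEdge v (-1) ∉ M ∧
      ∀ l, chord v p q l ∈ M ↔ l ∈ J \ {k.1} := by
    intro k
    refine hreal _ Set.sdiff_subset fun l hl => ?_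
    by_cases hlk : l = k
    · rw [hlk]; exact k.2.2
    · exact ⟨M₀, hM₀, hM₀F, hM₀t, fun hh => hl ⟨⟨M₀, hM₀, hM₀F, hh⟩, hlk⟩⟩
  choose m hm hmF hmt hmc using hflip
  have hmne : ∀ k, m k ≠ MJ := by
    intro k he
    have h1 := hmc k k
    rw [he, hMJc] at h1
    exact absurd (h1.1 k.2.1).2 (by simp)
  have hmsub : ∀ k, ∀ e ∈ m k \ MJ, ∃ i, 0 ≤ i ∧ i < N ∧ e = cycEdge v i ∧ Even i ∧
      p k ≤ i ∧ i < q k := by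
    rintro k e ⟨he, he'⟩
    rcases h.edge e (subset_edgeSet (hm k) he) with ⟨i, rfl⟩ | ⟨l, rfl⟩
    · obtain ⟨j, hj, hj', hij⟩ := h.exists_cycEdge_range i
      rw [hij] at he he' ⊢
      have k1 := h.cycEdge_mem_iff hd (hm k) (hmc k) hj hj'
      have k2 := h.cycEdge_mem_iff hd hMJ hMJc hj hj'
      have t1 := hmt k
      by_cases c2 : IsCovered p q J j
      · obtain ⟨l, hl, hlj⟩ := c2
        by_cases hlk : l = k
        · subst hlk
          have : ¬ IsCovered p q (J \ {k.1}) j := by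
            rintro ⟨l', hl', hlj'⟩
            have := hd l' k hl'.2
            omega
          exact ⟨j, hj, hj', rfl, by tauto, hlj⟩
        · have c1 : IsCovered p q (J \ {k.1}) j := ⟨l, ⟨hl, hlk⟩, hlj⟩
          have c2 : IsCovered p q J j := ⟨l, hl, hlj⟩
          tauto
      · have c1 : ¬ IsCovered p q (J \ {k.1}) j := by
          rintro ⟨l, hl, hlj⟩
          exact c2 ⟨l, hl.1, hlj⟩
        tauto
    · exact absurd ((hMJc l).2 ((hmc k l).1 he).1) he'
  have hmdisj : ∀ k l, k ≠ l → Disjoint (m k \ MJ) (m l \ MJ) := by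
    intro k l hkl
    rw [Set.disjoint_left]
    intro e h1 h2
    obtain ⟨i, hi, hi', rfl, -, hik⟩ := hmsub k e h1
    obtain ⟨j, hj, hj', hij, -, hjl⟩ := hmsub l _ h2
    have := h.ham.cycEdge_inj hij (by omega) (by omega)
    have := hd k l (fun hh => hkl (Subtype.ext hh))
    omega
  have hdist : ∀ M₁ M₂, M₁ ∈ perfectMatchings G → M₁ ⊆ F → M₂ ∈ perfectMatchings G → M₂ ⊆ F →
      (cycEdge v (-1) ∈ M₁ ↔ cycEdge v (-1) ∈ M₂) →
      (∀ k : Free, chord v p q k ∈ M₁ ↔ chord v p q k ∈ M₂) → M₁ = M₂ := by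
    intro M₁ M₂ h₁ h₁F h₂ h₂F ht hc
    by_cases ht1 : cycEdge v (-1) ∈ M₁
    · exact hbot h₁ h₂ ht1 (ht.1 ht1)
    · have ht2 : cycEdge v (-1) ∉ M₂ := fun hh => ht1 (ht.2 hh)
      refine h.eq_of_chords h₁ h₂ ht fun k => ?_
      by_cases hkf : k ∈ Free
      · exact hc ⟨k, hkf⟩
      · have key : ∀ M, M ∈ perfectMatchings G → M ⊆ F → cycEdge v (-1) ∉ M →
            (chord v p q k ∈ M ↔ k ∈ J) := by
          intro M hM hMF hMt
          refine ⟨fun hk => ⟨M, hM, hMF, hk⟩, fun hk => ?_⟩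
          by_contra hn
          exact hkf ⟨hk, M, hM, hMF, hMt, hn⟩
        rw [key M₁ h₁ h₁F ht1, key M₂ h₂ h₂F ht2]
  by_cases hB : ∃ M ∈ perfectMatchings G, M ⊆ F ∧ cycEdge v (-1) ∈ M
  · obtain ⟨Mb, hMb, hMbF, hMbt⟩ := hB
    have hbsub : ∀ e ∈ Mb \ MJ, ∃ i, 0 ≤ i ∧ i < N ∧ e = cycEdge v i ∧ ¬ Even i := by
      rintro e ⟨he, he'⟩
      rcases h.edge e (subset_edgeSet hMb he) with ⟨i, rfl⟩ | ⟨l, rfl⟩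
      · obtain ⟨j, hj, hj', hij⟩ := h.exists_cycEdge_range i
        rw [hij] at he ⊢
        have k1 := h.cycEdge_mem_iff hd hMb (fun _ => Iff.rfl) hj hj'
        exact ⟨j, hj, hj', rfl, by tauto⟩
      · exact absurd hMbt (h.cycEdge_neg_one_notMem hd hMb he)
    have hbdisj : ∀ k, Disjoint (m k \ MJ) (Mb \ MJ) := by
      intro k
      rw [Set.disjoint_left]
      intro e h1 h2
      obtain ⟨i, hi, hi', rfl, hev, hik⟩ := hmsub k e h1
      obtain ⟨j, hj, hj', hij, hodd⟩ := hbsub _ h2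
      rw [h.ham.cycEdge_inj hij (by omega) (by omega)] at hev
      exact hodd hev
    refine IsUniformFamily.of_fintype (ι := Option Free) ⟨hMJ, hMJF⟩
      (fun o => o.elim Mb m) ?_ ?_ (fun o => o.elim (cycEdge v (-1)) fun k => chord v p q k) ?_
    · rintro (_ | k)
      · exact ⟨⟨hMb, hMbF⟩, fun he => hMJt (he ▸ hMbt)⟩
      · exact ⟨⟨hm k, hmF k⟩, hmne k⟩
    · rintro (_ | k) (_ | l) hkl
      · exact absurd rfl hkl
      · exact (hbdisj l).symm
      · exact hbdisj k
      · exact hmdisj k l fun hh => hkl (by rw [hh])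
    · rintro M₁ ⟨h₁, h₁F⟩ M₂ ⟨h₂, h₂F⟩ hs
      exact hdist M₁ M₂ h₁ h₁F h₂ h₂F (hs none) fun k => hs (some k)
  · push Not at hB
    refine IsUniformFamily.of_fintype (ι := Free) ⟨hMJ, hMJF⟩ m
      (fun k => ⟨⟨hm k, hmF k⟩, hmne k⟩) hmdisj (fun k => chord v p q k) ?_
    rintro M₁ ⟨h₁, h₁F⟩ M₂ ⟨h₂, h₂F⟩ hs
    exact hdist M₁ M₂ h₁ h₁F h₂ h₂F (iff_of_false (hB _ h₁ h₁F) (hB _ h₂ h₂F)) hs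

end Disjoint

end ChordSystem

/-! ### Hamilton cycles with two strongly crossed chords -/

/-- The members of a family `P` are determined by the truth values of `s` and `t`, so they form
a subset of a `2 × 2` grid. Each edge depends on `s` only, or on `t` only, or belongs to at most
one member. Then all nonempty subfamilies are uniform: with at least three members, one of
them is a corner with both neighbours present. -/
lemma isUniformFamily_of_grid {E : Type*} {P Q : Set (Set E)} (hQP : Q ⊆ P) (hQ : Q.Nonempty)
    (s t : Set E → Prop)
    (hst : ∀ M₁ ∈ P, ∀ M₂ ∈ P, (s M₁ ↔ s M₂) → (t M₁ ↔ t M₂) → M₁ = M₂)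
    (he : ∀ M ∈ P, ∀ e ∈ M, (∀ M₁ ∈ P, ∀ M₂ ∈ P, (s M₁ ↔ s M₂) → (e ∈ M₁ ↔ e ∈ M₂)) ∨
      (∀ M₁ ∈ P, ∀ M₂ ∈ P, (t M₁ ↔ t M₂) → (e ∈ M₁ ↔ e ∈ M₂)) ∨
      (∀ M₁ ∈ P, ∀ M₂ ∈ P, e ∈ M₁ → e ∈ M₂ → M₁ = M₂))
    (a b : E) (ha : ∀ M ∈ P, a ∈ M ↔ s M) (hb : ∀ M ∈ P, b ∈ M ↔ ¬ t M)
    (hsub : ∀ M₁ ∈ P, ∀ M₂ ∈ P, M₁ ⊆ M₂ → M₁ = M₂) : IsUniformFamily Q := by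
  classical
  by_cases hc : ∃ M ∈ Q, ∃ M₁ ∈ Q, ∃ M₂ ∈ Q, (s M₁ ↔ ¬ s M) ∧ (t M₁ ↔ t M) ∧ (s M₂ ↔ s M) ∧
      (t M₂ ↔ ¬ t M)
  · obtain ⟨M, hM, M₁, h₁, M₂, h₂, s1, t1, s2, t2⟩ := hc
    have hdisj : Disjoint (M₁ \ M) (M₂ \ M) := by
      rw [Set.disjoint_left]
      rintro e ⟨e1, en⟩ ⟨e2, -⟩
      rcases he M₁ (hQP h₁) e e1 with h | h | h
      · exact en ((h _ (hQP h₂) _ (hQP hM) s2).1 e2)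
      · exact en ((h _ (hQP h₁) _ (hQP hM) t1).1 e1)
      · rw [h _ (hQP h₁) _ (hQP h₂) e1 e2] at s1
        tauto
    refine IsUniformFamily.of_fintype (ι := Bool) hM (fun i => bif i then M₁ else M₂) ?_ ?_
      (fun i => bif i then a else b) ?_
    · rintro (_ | _)
      · exact ⟨h₂, by rintro rfl; tauto⟩
      · exact ⟨h₁, by rintro rfl; tauto⟩
    · rintro (_ | _) (_ | _) hij
      exacts [absurd rfl hij, hdisj.symm, hdisj, absurd rfl hij]
    · intro N₁ n1 N₂ n2 h
      have h1 := h true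
      have h2 := h false
      simp only [cond_true, cond_false] at h1 h2
      rw [ha _ (hQP n1), ha _ (hQP n2)] at h1
      rw [hb _ (hQP n1), hb _ (hQP n2)] at h2
      exact hst _ (hQP n1) _ (hQP n2) h1 (by tauto)
  · obtain ⟨M, hM⟩ := hQ
    by_cases h1 : ∃ M₁ ∈ Q, M₁ ≠ M
    · obtain ⟨M₁, hM₁, hne⟩ := h1
      have hQ2 : ∀ M₂ ∈ Q, M₂ = M ∨ M₂ = M₁ := by
        intro M₂ hM₂
        by_contra! hn
        have c1 := fun A hA B hB C hC => not_exists.1 hc A ∘ fun h =>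
          ⟨hA, B, hB, C, hC, h⟩
        have d1 := c1 M hM M₁ hM₁ M₂ hM₂
        have d2 := c1 M hM M₂ hM₂ M₁ hM₁
        have d3 := c1 M₁ hM₁ M hM M₂ hM₂
        have d4 := c1 M₁ hM₁ M₂ hM₂ M hM
        have d5 := c1 M₂ hM₂ M hM M₁ hM₁
        have d6 := c1 M₂ hM₂ M₁ hM₁ M hM
        have n1 := fun u w => hne (hst M₁ (hQP hM₁) M (hQP hM) u w)
        have n2 := fun u w => hn.1 (hst M₂ (hQP hM₂) M (hQP hM) u w)
        have n3 := fun u w => hn.2 (hst M₂ (hQP hM₂) M₁ (hQP hM₁) u w)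
        clear c1 hc hst he ha hb hsub hn hne
        by_cases a1 : s M <;> by_cases a2 : s M₁ <;> by_cases a3 : s M₂ <;>
          by_cases b1 : t M <;> by_cases b2 : t M₁ <;> by_cases b3 : t M₂ <;>
          simp_all
      obtain ⟨e, he1, he2⟩ : ∃ e, e ∈ M₁ ∧ e ∉ M := by
        by_contra! hh
        exact hne (hsub _ (hQP hM₁) _ (hQP hM) hh)
      refine IsUniformFamily.of_fintype (ι := Unit) hM (fun _ => M₁) (fun _ => ⟨hM₁, hne⟩)
        (fun i j hij => absurd (Subsingleton.elim i j) hij) (fun _ => e) ?_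
      intro N₁ n1 N₂ n2 h
      have h := h ()
      rcases hQ2 N₁ n1 with rfl | rfl <;> rcases hQ2 N₂ n2 with rfl | rfl
      · rfl
      · exact absurd (h.2 he1) he2
      · exact absurd (h.1 he1) he2
      · rfl
    · push Not at h1
      refine IsUniformFamily.of_fintype (ι := Empty) hM (fun i => i.elim) (fun i => i.elim)
        (fun i => i.elim) (fun i => i.elim) ?_
      intro N₁ n1 N₂ n2 _
      rw [h1 _ n1, h1 _ n2]

namespace ChordSystem

open HamEnum

variable {V : Type*} {G : SimpleGraph V} {N : ℤ} {v : ℤ → V} {r : ℤ}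

/-- Two crossed chords are only jointly over the edge `r`, hence the potential is constant before and
after that edge. Its values `s` and `t` there determine the perfect matching, and each of its four
possible edges `y₁x₂`, `y₂x₁`, `x₁x₂`, `y₁y₂` belongs to only one of the four cells. -/
lemma pot_of_crossed {p q : Fin 2 → ℤ} (h : ChordSystem G N v p q) (p0 : p 0 = 0) (p1 : p 1 = r)
    (q0 : q 0 = r + 1) (q1 : q 1 = N - 1) {M : Set (Sym2 V)} (hM : M ∈ perfectMatchings G)
    (hr : 2 ≤ r) (hrN : r + 4 ≤ N) :
    (∀ i, 0 ≤ i → i < r → (pot v M i = 1 ↔ pot v M 0 = 1)) ∧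
    (∀ i, r + 1 ≤ i → i < N - 1 → (pot v M i = 1 ↔ pot v M (r + 1) = 1)) ∧
    (pot v M r = 1 ↔ pot v M 0 = 1 ∧ pot v M (r + 1) = 1) ∧
    (pot v M (-1) = 1 ↔ pot v M 0 = 1 ∨ pot v M (r + 1) = 1) ∧
    (chord v p q 0 ∈ M ↔ pot v M 0 ≠ 1 ∧ pot v M (r + 1) = 1) ∧
    (chord v p q 1 ∈ M ↔ pot v M 0 = 1 ∧ pot v M (r + 1) ≠ 1) := by
  classical
  obtain ⟨c0, hc0, hc0'⟩ : ∃ c0 : ℤ, (c0 = 0 ∨ c0 = 1) ∧ (chord v p q 0 ∈ M ↔ c0 = 1) :=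
    ⟨if chord v p q 0 ∈ M then 1 else 0, by split_ifs <;> simp, by split_ifs with a <;> simp [a]⟩
  obtain ⟨c1, hc1, hc1'⟩ : ∃ c1 : ℤ, (c1 = 0 ∨ c1 = 1) ∧ (chord v p q 1 ∈ M ↔ c1 = 1) :=
    ⟨if chord v p q 1 ∈ M then 1 else 0, by split_ifs <;> simp, by split_ifs with a <;> simp [a]⟩
  have hpot : ∀ i, 0 ≤ i → i < N → pot v M i = pot v M (-1) -
      ((if c0 = 1 ∧ i < r + 1 then 1 else 0) + (if c1 = 1 ∧ r ≤ i ∧ i < N - 1 then 1 else 0)) := by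
    intro i hi hi'
    rw [(h.mem_perfectMatchings_iff_pot.1 hM).2 i hi hi', cover, Fin.sum_univ_two]
    simp only [p0, p1, q0, q1, hc0', hc1', hi, true_and]
  rw [hc0', hc1']
  have hA : ∀ i, 0 ≤ i → i < r → pot v M i = pot v M (-1) - c0 := by
    intro i hi hi'
    rw [hpot i hi (by omega)]
    split_ifs <;> omega
  have hC : ∀ i, r + 1 ≤ i → i < N - 1 → pot v M i = pot v M (-1) - c1 := by
    intro i hi hi'
    rw [hpot i (by omega) (by omega)]
    split_ifs <;> omega
  have hR : pot v M r = pot v M (-1) - (c0 + c1) := by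
    rw [hpot r (by omega) (by omega)]
    split_ifs <;> omega
  have e1 := hA 0 le_rfl (by omega)
  have e2 := hC (r + 1) le_rfl (by omega)
  have a1 := pot_eq_zero_or_one (v := v) M 0
  have a2 := pot_eq_zero_or_one (v := v) M (r + 1)
  have a3 := pot_eq_zero_or_one (v := v) M r
  have a4 := pot_eq_zero_or_one (v := v) M (-1)
  refine ⟨fun i hi hi' => by rw [hA i hi hi', e1], fun i hi hi' => by rw [hC i hi hi', e2], ?_⟩
  clear hA hC hpot h
  omega

/-- The four perfect matchings are distinguished by what they do on the two paths of the Hamilton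
cycle between the edges `y₁x₂` and `y₂x₁`. -/
lemma isUniformFamily_of_crossed {p q : Fin 2 → ℤ} (h : ChordSystem G N v p q) (p0 : p 0 = 0)
    (p1 : p 1 = r) (q0 : q 0 = r + 1) (q1 : q 1 = N - 1) (hr : 2 ≤ r)
    (hrN : r + 4 ≤ N) {F : Set (Sym2 V)} (hF : ∃ M ∈ perfectMatchings G, M ⊆ F) :
    IsUniformFamily {M | M ∈ perfectMatchings G ∧ M ⊆ F} := by
  have hodd : ¬ Even (r + 1) := Int.not_even_iff_odd.2 (q0 ▸ h.odd_q 0)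
  have heven : Even r := p1 ▸ h.even_p 1
  have hP := fun M hM => h.pot_of_crossed p0 p1 q0 q1 (M := M) hM hr hrN
  have hst : ∀ M₁ ∈ perfectMatchings G, ∀ M₂ ∈ perfectMatchings G,
      (pot v M₁ 0 = 1 ↔ pot v M₂ 0 = 1) → (pot v M₁ (r + 1) = 1 ↔ pot v M₂ (r + 1) = 1) →
      M₁ = M₂ := by
    intro M₁ h₁ M₂ h₂ hs ht
    obtain ⟨-, -, -, a2, a3, a4⟩ := hP M₁ h₁
    obtain ⟨-, -, -, b2, b3, b4⟩ := hP M₂ h₂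
    refine h.eq_of_chords h₁ h₂ ?_ fun k => ?_
    · rw [pot_neg_one_iff] at a2 b2
      rw [← not_iff_not, a2, b2, hs, ht]
    · revert k
      rw [Fin.forall_fin_two]
      exact ⟨by rw [a3, b3, ne_eq, ne_eq, hs, ht], by rw [a4, b4, ne_eq, ne_eq, hs, ht]⟩
  refine isUniformFamily_of_grid (P := perfectMatchings G) (fun M hM => hM.1)
    (by obtain ⟨M, hM⟩ := hF; exact ⟨M, hM⟩) (fun M => pot v M 0 = 1)
    (fun M => pot v M (r + 1) = 1) hst ?_ (cycEdge v 0) (cycEdge v (r + 1)) ?_ ?_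
    (fun M₁ h₁ M₂ h₂ => eq_of_subset h₁ h₂)
  · intro M hM e he
    rcases h.edge e (subset_edgeSet hM he) with ⟨i, rfl⟩ | ⟨k, rfl⟩
    · obtain ⟨j, hj, hj', hij⟩ := h.exists_cycEdge_range i
      rw [hij]
      by_cases j1 : j < r
      · left
        intro M₁ h₁ M₂ h₂ hs
        have e1 := (hP M₁ h₁).1 j hj j1
        have e2 := (hP M₂ h₂).1 j hj j1
        rw [← hs, ← e1, pot_eq_one_iff, pot_eq_one_iff] at e2
        tauto
      by_cases j2 : j = r
      · subst j2
        right; right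
        intro M₁ h₁ M₂ h₂ m1 m2
        have b1 := (hP M₁ h₁).2.2.1.1 (pot_eq_one_iff.2 (iff_of_true m1 heven))
        have b2 := (hP M₂ h₂).2.2.1.1 (pot_eq_one_iff.2 (iff_of_true m2 heven))
        exact hst _ h₁ _ h₂ (iff_of_true b1.1 b2.1) (iff_of_true b1.2 b2.2)
      by_cases j3 : j < N - 1
      · right; left
        intro M₁ h₁ M₂ h₂ hs
        have e1 := (hP M₁ h₁).2.1 j (by omega) j3
        have e2 := (hP M₂ h₂).2.1 j (by omega) j3
        rw [← hs, ← e1, pot_eq_one_iff, pot_eq_one_iff] at e2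
        tauto
      · have : j = N - 1 := by omega
        rw [this, ← h.cycEdge_neg_one]
        right; right
        intro M₁ h₁ M₂ h₂ m1 m2
        have b1 := (hP M₁ h₁).2.2.2.1
        have b2 := (hP M₂ h₂).2.2.2.1
        rw [pot_neg_one_iff] at b1 b2
        exact hst _ h₁ _ h₂ (by tauto) (by tauto)
    · right; right
      intro M₁ h₁ M₂ h₂ m1 m2
      change chord v p q k ∈ M₁ at m1
      change chord v p q k ∈ M₂ at m2
      obtain ⟨-, -, -, -, a3, a4⟩ := hP M₁ h₁
      obtain ⟨-, -, -, -, b3, b4⟩ := hP M₂ h₂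
      obtain rfl | rfl : k = 0 ∨ k = 1 := by omega
      · exact hst _ h₁ _ h₂ (iff_of_false (a3.1 m1).1 (b3.1 m2).1)
          (iff_of_true (a3.1 m1).2 (b3.1 m2).2)
      · exact hst _ h₁ _ h₂ (iff_of_true (a4.1 m1).1 (b4.1 m2).1)
          (iff_of_false (a4.1 m1).2 (b4.1 m2).2)
  · intro M _
    rw [pot_eq_one_iff]
    simp
  · intro M _
    rw [pot_eq_one_iff]
    simp only [hodd]
    tauto

end ChordSystem

/-! ### The vertices of a Hamilton cycle in cyclic order -/

/-- The vertices `a`, `b`, `c`, `d` appear in this order within one period of `v`. -/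
def InOrder {V : Type*} (v : ℤ → V) (N : ℤ) (a b c d : V) : Prop :=
  ∃ i j k l : ℤ, i < j ∧ j < k ∧ k < l ∧ l < i + N ∧ v i = a ∧ v j = b ∧ v k = c ∧ v l = d

section Lists

variable {V : Type*}

lemma rotate_map_range {w : ℤ → V} {n : ℕ} (hw : ∀ i j, (n : ℤ) ∣ i - j → w i = w j)
    (k : ℕ) : ((List.range n).map fun i : ℕ => w i).rotate k =
      (List.range n).map fun i : ℕ => w (i + k) := by
  refine List.ext_getElem (by simp) fun i h1 h2 => ?_
  rw [List.getElem_rotate]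
  simp only [List.getElem_map, List.getElem_range, List.length_map, List.length_range]
  apply hw
  refine ⟨-(((i + k) / n : ℕ) : ℤ), ?_⟩
  have := Nat.mod_add_div (i + k) n
  zify at this ⊢
  linarith

lemma sublist_map_range_iff {w : ℕ → V} {n : ℕ} {a b c d : V} :
    List.Sublist [a, b, c, d] ((List.range n).map w) ↔
      ∃ i j k l : ℕ, i < j ∧ j < k ∧ k < l ∧ l < n ∧ w i = a ∧ w j = b ∧ w k = c ∧ w l = d := by
  rw [List.sublist_map_iff]
  constructor
  · rintro ⟨l', hl, he⟩
    have h4 : l'.length = 4 := by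
      have := congrArg List.length he
      simpa using this.symm
    obtain ⟨i, j, k, l, rfl⟩ : ∃ i j k l, l' = [i, j, k, l] := by
      match l', h4 with
      | [i, j, k, l], _ => exact ⟨i, j, k, l, rfl⟩
    have hp := List.pairwise_lt_range.sublist hl
    have hm : l ∈ List.range n := hl.subset (by simp)
    simp only [List.map_cons, List.map_nil, List.cons.injEq, and_true] at he
    simp only [List.pairwise_cons, List.mem_cons, List.not_mem_nil, or_false, forall_eq_or_imp,
      forall_eq] at hp
    exact ⟨i, j, k, l, by tauto, by tauto, by tauto, List.mem_range.1 hm, he.1.symm, he.2.1.symm,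
      he.2.2.1.symm, he.2.2.2.symm⟩
  · rintro ⟨i, j, k, l, hij, hjk, hkl, hl, rfl, rfl, rfl, rfl⟩
    refine ⟨[i, j, k, l], ?_, rfl⟩
    have hp : [i, j, k, l].Pairwise (· < ·) := by
      simp only [List.pairwise_cons, List.mem_cons, List.not_mem_nil, or_false, forall_eq_or_imp,
        forall_eq, IsEmpty.forall_iff, implies_true, List.Pairwise.nil, and_true]
      omega
    refine List.sublist_of_subperm_of_pairwise (r := (· < ·)) ?_ hp List.pairwise_lt_range
    refine List.Nodup.subperm (hp.imp fun h => h.ne) ?_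
    intro x hx
    simp only [List.mem_cons, List.not_mem_nil, or_false] at hx
    rw [List.mem_range]
    omega

lemma exists_isRotated_iff {w : ℤ → V} {n : ℕ} (hn : 0 < n)
    (hw : ∀ i j, (n : ℤ) ∣ i - j → w i = w j) {a b c d : V} :
    (∃ t, t ~r ((List.range n).map fun i : ℕ => w (i + 1)) ∧ List.Sublist [a, b, c, d] t) ↔
      InOrder w n a b c d := by
  have hrot := fun k => rotate_map_range (n := n) (w := fun i => w (i + 1))
    (fun i j hij => hw _ _ (by rwa [show i + 1 - (j + 1) = i - j by ring])) k
  constructor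
  · rintro ⟨t, ht, hs⟩
    obtain ⟨k, rfl⟩ := ht.symm
    rw [hrot, sublist_map_range_iff] at hs
    obtain ⟨i, j, m, l, h1, h2, h3, h4, h5, h6, h7, h8⟩ := hs
    exact ⟨_, _, _, _, by omega, by omega, by omega, by omega, h5, h6, h7, h8⟩
  · rintro ⟨i, j, m, l, h1, h2, h3, h4, rfl, rfl, rfl, rfl⟩
    refine ⟨_, List.IsRotated.symm ⟨((i - 1) % n).toNat, rfl⟩, ?_⟩
    rw [hrot, sublist_map_range_iff]
    have h0 : 0 ≤ (i - 1) % (n : ℤ) := Int.emod_nonneg _ (by omega)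
    have key : ∀ x : ℤ, i ≤ x →
        w (((x - i).toNat : ℤ) + (((i - 1) % (n : ℤ)).toNat : ℤ) + 1) = w x := by
      intro x hx
      apply hw
      rw [Int.toNat_of_nonneg (by omega), Int.toNat_of_nonneg h0]
      refine ⟨-((i - 1) / n), ?_⟩
      have := Int.emod_add_mul_ediv (i - 1) n
      linarith
    exact ⟨(i - i).toNat, (j - i).toNat, (m - i).toNat, (l - i).toNat, by omega, by omega,
      by omega, by omega, key _ le_rfl, key _ (by omega), key _ (by omega), key _ (by omega)⟩

end Lists

open HamEnum

/-- `v` runs periodically through the Hamilton cycle `C`, which has length `N`, in one of its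
directions. -/
structure CycleEnum {V : Type*} {G : SimpleGraph V} {a : V} (C : G.Walk a a) (N : ℤ) (v : ℤ → V) :
    Prop where
  ham : HamEnum G N v
  length : (C.length : ℤ) = N
  mem_edges : ∀ e, e ∈ C.edges ↔ ∃ i, e = cycEdge v i
  ordered : ∀ x y z t, Ordered C [x, y, z, t] ↔ InOrder v N x y z t ∨ InOrder v N t z y x

section

variable {V : Type*} {v : ℤ → V} {N : ℤ} {a b c d : V}

lemma inOrder_shift_iff (k : ℤ) :
    InOrder (fun i => v (i + k)) N a b c d ↔ InOrder v N a b c d := by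
  constructor
  · rintro ⟨i, j, m, l, h1, h2, h3, h4, h⟩
    exact ⟨_, _, _, _, by omega, by omega, by omega, by omega, h⟩
  · rintro ⟨i, j, m, l, h1, h2, h3, h4, h⟩
    exact ⟨i - k, j - k, m - k, l - k, by omega, by omega, by omega, by omega, by simpa using h⟩

lemma inOrder_neg_iff : InOrder (fun i => v (-i)) N a b c d ↔ InOrder v N d c b a := by
  constructor
  · rintro ⟨i, j, m, l, h1, h2, h3, h4, h5, h6, h7, h8⟩
    exact ⟨-l, -m, -j, -i, by omega, by omega, by omega, by omega, h8, h7, h6, h5⟩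
  · rintro ⟨i, j, m, l, h1, h2, h3, h4, h5, h6, h7, h8⟩
    exact ⟨-l, -m, -j, -i, by omega, by omega, by omega, by omega, by simpa, by simpa, by simpa,
      by simpa⟩

/-- The order of the positions of four vertices in a period. -/
lemma HamEnum.inOrder_iff {G : SimpleGraph V} (hv : HamEnum G N v) {i j k l : ℤ} (hi : 0 ≤ i)
    (hi' : i < N) (hj : 0 ≤ j) (hj' : j < N) (hk : 0 ≤ k) (hk' : k < N) (hl : 0 ≤ l) (hl' : l < N) :
    InOrder v N (v i) (v j) (v k) (v l) ↔ (i < j ∧ j < k ∧ k < l) ∨ (j < k ∧ k < l ∧ l < i) ∨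
      (k < l ∧ l < i ∧ i < j) ∨ (l < i ∧ i < j ∧ j < k) := by
  constructor
  · rintro ⟨i', j', k', l', h1, h2, h3, h4, e1, e2, e3, e4⟩
    have key : ∀ {x x' : ℤ}, v x' = v x → i' ≤ x' → x' < i' + N → 0 ≤ x → x < N → 0 ≤ i → i < N →
        ∀ {y : ℤ}, v i' = v y → y = i → x' - i' = x - i ∨ x' - i' = x - i + N := by
      rintro x x' hx a1 a2 a3 a4 a5 a6 y hy rfl
      have d1 := dvd_sub ((hv.eq_iff _ _).1 hx) ((hv.eq_iff _ _).1 hy)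
      obtain ⟨m, hm⟩ := d1
      have : x' - i' = x - y + N * m := by linarith
      have m1 : m < 2 := by
        by_contra! hh
        nlinarith
      have m2 : -1 < m := by
        by_contra! hh
        nlinarith
      obtain rfl | rfl : m = 0 ∨ m = 1 := by omega
      · left; linarith
      · right; linarith
    have k2 := key e2 (by omega) (by omega) hj hj' hi hi' e1 rfl
    have k3 := key e3 (by omega) (by omega) hk hk' hi hi' e1 rfl
    have k4 := key e4 (by omega) (by omega) hl hl' hi hi' e1 rfl
    omega
  · have hp := hv.add_period
    rintro (h | h | h | h)
    · exact ⟨i, j, k, l, by omega, by omega, by omega, by omega, rfl, rfl, rfl, rfl⟩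
    · exact ⟨i, j + N, k + N, l + N, by omega, by omega, by omega, by omega, rfl, hp _, hp _, hp _⟩
    · exact ⟨i, j, k + N, l + N, by omega, by omega, by omega, by omega, rfl, rfl, hp _, hp _⟩
    · exact ⟨i, j, k, l + N, by omega, by omega, by omega, by omega, rfl, rfl, rfl, hp _⟩

end

namespace CycleEnum

variable {V : Type*} {G : SimpleGraph V} {a : V} {C : G.Walk a a} {N : ℤ} {v : ℤ → V}

lemma shift (h : CycleEnum C N v) (k : ℤ) : CycleEnum C N (fun i => v (i + k)) where
  ham := h.ham.shift k
  length := h.length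
  mem_edges e := by
    rw [h.mem_edges]
    constructor
    · rintro ⟨i, rfl⟩
      exact ⟨i - k, by simp [cycEdge, sub_add_eq_add_sub]⟩
    · rintro ⟨i, rfl⟩
      exact ⟨i + k, by simp [cycEdge, add_right_comm]⟩
  ordered x y z t := by rw [h.ordered, inOrder_shift_iff, inOrder_shift_iff]

lemma neg (h : CycleEnum C N v) : CycleEnum C N (fun i => v (-i)) where
  ham := h.ham.neg
  length := h.length
  mem_edges e := by
    rw [h.mem_edges]
    constructor
    · rintro ⟨i, rfl⟩
      exact ⟨-(i + 1), by simp [cycEdge, Sym2.eq_swap]⟩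
    · rintro ⟨i, rfl⟩
      exact ⟨-(i + 1), by simp [cycEdge, Sym2.eq_swap]⟩
  ordered x y z t := by rw [h.ordered, inOrder_neg_iff, inOrder_neg_iff, or_comm]

lemma exists_of_isHamiltonianCycle [DecidableEq V] (hC : C.IsHamiltonianCycle) :
    ∃ v, CycleEnum C C.length v := by
  have h3 := hC.isCycle.three_le_length
  have hpos : (0 : ℤ) < C.length := by omega
  let v : ℤ → V := fun i => C.getVert (i % C.length).toNat
  have hv : ∀ n : ℕ, n ≤ C.length → v n = C.getVert n := by
    intro n hn
    simp only [v]
    rcases hn.lt_or_eq with hn | rfl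
    · rw [Int.emod_eq_of_lt (by omega) (by omega)]
      simp
    · simp
  have hper : ∀ i j, (C.length : ℤ) ∣ i - j → v i = v j := by
    intro i j hij
    simp only [v]
    rw [(Int.emod_emod_of_dvd _ dvd_rfl).symm.trans
      ((Int.emod_emod_of_dvd _ dvd_rfl).trans (Int.ModEq.symm (Int.modEq_iff_dvd.2 hij)))]
  have hnorm : ∀ i, ∃ n : ℕ, n < C.length ∧ (C.length : ℤ) ∣ i - n := by
    intro i
    have := Int.emod_nonneg i hpos.ne'
    have := Int.emod_lt_of_pos i hpos
    refine ⟨(i % C.length).toNat, by omega, ?_⟩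
    rw [Int.toNat_of_nonneg (by omega)]
    exact ⟨i / C.length, by have := Int.emod_add_mul_ediv i C.length; linarith⟩
  have hcyc : ∀ i, ∃ n : ℕ, n < C.length ∧ v i = C.getVert n ∧ v (i + 1) = C.getVert (n + 1) := by
    intro i
    obtain ⟨n, hn, hd⟩ := hnorm i
    refine ⟨n, hn, ?_, ?_⟩
    · rw [hper _ _ hd, hv n hn.le]
    · rw [← hv (n + 1) hn]
      exact hper _ _ (by push_cast; rwa [show i + 1 - ((n : ℤ) + 1) = i - n by ring])
  refine ⟨v, ⟨by omega, fun i => ?_, fun i j => ⟨fun hij => ?_, hper i j⟩, fun x => ?_⟩, rfl,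
    fun e => ?_, fun x y z t => ?_⟩
  · obtain ⟨n, hn, h1, h2⟩ := hcyc i
    rw [h1, h2]
    exact C.adj_getVert_succ hn
  · obtain ⟨n, hn, hd⟩ := hnorm i
    obtain ⟨m, hm, hd'⟩ := hnorm j
    rw [hper _ _ hd, hper _ _ hd', hv n hn.le, hv m hm.le] at hij
    have := hC.isCycle.getVert_injOn' (by simp only [Set.mem_ofPred_eq]; omega)
      (by simp only [Set.mem_ofPred_eq]; omega) hij
    subst this
    have := dvd_sub hd hd'
    rwa [show i - n - (j - n) = i - j by ring] at this
  · obtain ⟨n, hn, hn'⟩ := Walk.mem_support_iff_exists_getVert.1 (hC.mem_support x)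
    exact ⟨n, by rw [hv n hn', hn]⟩
  · rw [C.mem_edges_iff_getVert]
    constructor
    · rintro ⟨n, hn, rfl⟩
      refine ⟨n, ?_⟩
      rw [cycEdge, hv n hn.le, ← hv (n + 1) hn]
      push_cast
      rfl
    · rintro ⟨i, rfl⟩
      obtain ⟨n, hn, h1, h2⟩ := hcyc i
      exact ⟨n, hn, by rw [cycEdge, h1, h2]⟩
  · have e1 : C.support.tail = (List.range C.length).map fun i : ℕ => v (i + 1) := by
      refine List.ext_getElem (by simp) fun i h1 h2 => ?_
      have hi : i < C.length := by simpa using h2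
      simp only [List.getElem_tail, List.getElem_map, List.getElem_range,
        Walk.support_getElem_eq_getVert]
      rw [← hv (i + 1) hi]
      push_cast
      rfl
    have e2 : C.reverse.support.tail =
        (List.range C.length).map fun i : ℕ => (fun i => v (-i)) (i + 1) := by
      refine List.ext_getElem (by simp) fun i h1 h2 => ?_
      have hi : i < C.length := by simpa using h2
      simp only [List.getElem_tail, List.getElem_map, List.getElem_range,
        Walk.support_getElem_eq_getVert, Walk.getVert_reverse]
      rw [← hv _ (Nat.sub_le _ _)]
      apply hper
      rw [Nat.cast_sub (by omega)]
      exact ⟨1, by push_cast; ring⟩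
    have hper' : ∀ i j, (C.length : ℤ) ∣ i - j → v (-i) = v (-j) := by
      intro i j hij
      exact hper _ _ (by rw [← dvd_neg]; rwa [show -(-i - -j) = i - j by ring])
    rw [← inOrder_neg_iff (a := x), ← exists_isRotated_iff (by omega) hper,
      ← exists_isRotated_iff (by omega) hper', ← e1, ← e2, Ordered]
    simp only [or_and_right, exists_or]

end CycleEnum

open HamEnum

/-! ### The relative position of two chords of a Hamilton cycle -/

/-- The integers `i`, `j`, `k`, `l` are in this cyclic order. -/
def CycLT (i j k l : ℤ) : Prop := (i < j ∧ j < k ∧ k < l) ∨ (j < k ∧ k < l ∧ l < i) ∨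
  (k < l ∧ l < i ∧ i < j) ∨ (l < i ∧ i < j ∧ j < k)

lemma CycLT.rotate {i j k l : ℤ} (h : CycLT i j k l) : CycLT j k l i := by
  rcases h with ⟨h1, h2, h3⟩ | ⟨h1, h2, h3⟩ | ⟨h1, h2, h3⟩ | ⟨h1, h2, h3⟩
  exacts [Or.inr (Or.inr (Or.inr ⟨h1, h2, h3⟩)), Or.inl ⟨h1, h2, h3⟩, Or.inr (Or.inl ⟨h1, h2, h3⟩),
    Or.inr (Or.inr (Or.inl ⟨h1, h2, h3⟩))]

namespace HamEnum

variable {V : Type*} {G : SimpleGraph V} {N : ℤ} {v : ℤ → V} {c : V → Bool}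

lemma color_eq_iff (hc : ∀ i, c (v i) ≠ c (v (i + 1))) (i j : ℤ) :
    c (v i) = c (v j) ↔ Even (i - j) := by
  have key : ∀ (n : ℕ) (i : ℤ), c (v (i + n)) = c (v i) ↔ Even n := by
    intro n i
    induction n with
    | zero => simp
    | succ n ih =>
      have := hc (i + n)
      push_cast
      rw [← add_assoc, Nat.even_add_one, ← ih]
      revert this
      cases c (v (i + n)) <;> cases c (v (i + n + 1)) <;> cases c (v i) <;> decide
  rcases le_total i j with h | h
  · obtain ⟨n, hn⟩ := Int.le.dest h
    rw [eq_comm, ← hn, key, show i - (i + n) = -(n : ℤ) by ring, even_neg, Int.even_coe_nat]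
  · obtain ⟨n, hn⟩ := Int.le.dest h
    rw [← hn, key, show j + (n : ℤ) - j = n by ring, Int.even_coe_nat]

lemma even_period (hv : HamEnum G N v) (hc : ∀ i, c (v i) ≠ c (v (i + 1))) : Even N := by
  have := (color_eq_iff hc N 0).1 (by rw [← hv.add_period 0, zero_add])
  simpa using this

lemma odd_sub_of_adj (hv : HamEnum G N v) (hc : ∀ x y, G.Adj x y → c x ≠ c y) {i j : ℤ}
    (hij : G.Adj (v i) (v j)) : Odd (i - j) := by
  rw [← Int.not_even_iff_odd, ← color_eq_iff (c := c) fun i => hc _ _ (hv.adj i)]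
  exact hc _ _ hij

lemma exists_eq_cycEdge_iff (hv : HamEnum G N v) {i j : ℤ} (hi : 0 ≤ i) (hi' : i < N) (hj : 0 ≤ j)
    (hj' : j < N) : (∃ k, s(v i, v j) = cycEdge v k) ↔
      j = i + 1 ∨ i = j + 1 ∨ (i = 0 ∧ j = N - 1) ∨ (j = 0 ∧ i = N - 1) := by
  have h3 := hv.three_le
  have hp := hv.add_period
  constructor
  · rintro ⟨k, hk⟩
    obtain ⟨l, hl, hl', hlk⟩ := hv.exists_range (v k)
    have e : cycEdge v k = cycEdge v l := by
      rw [hv.cycEdge_eq_iff, ← hv.eq_iff, hlk]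
    rw [e] at hk
    have h1 := (hv.mem_cycEdge_iff (by omega) hl' hi hi').1 (hk ▸ Sym2.mem_mk_left _ _)
    have h2 := (hv.mem_cycEdge_iff (by omega) hl' hj hj').1 (hk ▸ Sym2.mem_mk_right _ _)
    have h4 : i ≠ j := by
      rintro rfl
      have := hv.cycEdge_mem l
      rw [← hk] at this
      exact G.loopless.irrefl _ this
    omega
  · rintro (rfl | rfl | ⟨rfl, rfl⟩ | ⟨rfl, rfl⟩)
    · exact ⟨i, rfl⟩
    · exact ⟨j, Sym2.eq_swap⟩
    · exact ⟨N - 1, by rw [cycEdge, Sym2.eq_swap, sub_add_cancel, ← hp 0, zero_add]⟩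
    · exact ⟨N - 1, by rw [cycEdge, sub_add_cancel, ← hp 0, zero_add]⟩

end HamEnum

namespace CycleEnum

variable {V : Type*} {G : SimpleGraph V} {a : V} {C : G.Walk a a} {N : ℤ} {v : ℤ → V}
  {c : V → Bool}

lemma color_ne (h : CycleEnum C N v) (hc : IsColoring C c) (i : ℤ) : c (v i) ≠ c (v (i + 1)) :=
  hc _ _ ((h.mem_edges _).2 ⟨i, rfl⟩)

lemma ordered_iff (h : CycleEnum C N v) {i j k l : ℤ} (hi : 0 ≤ i)
    (hi' : i < N) (hj : 0 ≤ j) (hj' : j < N) (hk : 0 ≤ k) (hk' : k < N) (hl : 0 ≤ l) (hl' : l < N) :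
    Ordered C [v i, v j, v k, v l] ↔ CycLT i j k l ∨ CycLT l k j i := by
  rw [h.ordered, h.ham.inOrder_iff hi hi' hj hj' hk hk' hl hl',
    h.ham.inOrder_iff hl hl' hk hk' hj hj' hi hi', CycLT, CycLT]

lemma exists_of_mem_chords (h : CycleEnum C N v) (hc : ∀ x y, G.Adj x y → c x ≠ c y) {e : Sym2 V}
    (he : e ∈ chords C) : ∃ p q, 0 ≤ p ∧ p < N ∧ 0 ≤ q ∧ q < N ∧ Even p ∧ Odd q ∧
      e = s(v p, v q) := by
  induction e with
  | h x y =>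
    obtain ⟨i, hi, hi', rfl⟩ := h.ham.exists_range x
    obtain ⟨j, hj, hj', rfl⟩ := h.ham.exists_range y
    have hodd := h.ham.odd_sub_of_adj hc he.1
    rcases Int.even_or_odd i with hev | hod
    · refine ⟨i, j, hi, hi', hj, hj', hev, ?_, rfl⟩
      rw [Int.odd_sub] at hodd
      rw [← Int.not_even_iff_odd] at hodd ⊢
      tauto
    · refine ⟨j, i, hj, hj', hi, hi', ?_, hod, Sym2.eq_swap⟩
      rw [Int.odd_sub] at hodd
      tauto

/-- Two chords, given by their ends in even and in odd positions, are parallel if these ends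
alternate along the cycle and no chord separates the ends of the other one. -/
lemma parallel_iff (h : CycleEnum C N v) (hc : IsColoring C c) {p q p' q' : ℤ}
    (hp : 0 ≤ p ∧ p < N ∧ Even p) (hq : 0 ≤ q ∧ q < N ∧ Odd q) (hp' : 0 ≤ p' ∧ p' < N ∧ Even p')
    (hq' : 0 ≤ q' ∧ q' < N ∧ Odd q') :
    Parallel C c s(v p, v q) s(v p', v q') ↔ CycLT p q p' q' ∨ CycLT q' p' q p := by
  have hne : ∀ x y : ℤ, Even x → Odd y → c (v x) ≠ c (v y) := by
    intro x y hx hy he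
    rw [color_eq_iff (h.color_ne hc)] at he
    exact Int.not_even_iff_odd.2 (hx.sub_odd hy) he
  constructor
  · rintro ⟨x₁, x₂, y₁, y₂, he, hf, hcol, ho⟩
    rcases Sym2.eq_iff.1 he with ⟨rfl, rfl⟩ | ⟨rfl, rfl⟩ <;>
      rcases Sym2.eq_iff.1 hf with ⟨rfl, rfl⟩ | ⟨rfl, rfl⟩
    · rwa [h.ordered_iff hp.1 hp.2.1 hq.1 hq.2.1 hp'.1 hp'.2.1 hq'.1 hq'.2.1] at ho
    · exact absurd hcol (hne _ _ hp.2.2 hq'.2.2)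
    · exact absurd hcol.symm (hne _ _ hp'.2.2 hq.2.2)
    · rw [h.ordered_iff hq.1 hq.2.1 hp.1 hp.2.1 hq'.1 hq'.2.1 hp'.1 hp'.2.1] at ho
      exact ho.symm.imp (fun hh => hh.rotate.rotate) fun hh => hh.rotate.rotate
  · intro ho
    refine ⟨_, _, _, _, rfl, rfl, ?_, (h.ordered_iff hp.1 hp.2.1 hq.1 hq.2.1 hp'.1 hp'.2.1 hq'.1
      hq'.2.1).2 ho⟩
    rw [color_eq_iff (h.color_ne hc)]
    exact hp.2.2.sub hp'.2.2

lemma stronglyCrossed_iff (h : CycleEnum C N v) (hc : IsColoring C c) {p q p' q' : ℤ}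
    (hp : 0 ≤ p ∧ p < N ∧ Even p) (hq : 0 ≤ q ∧ q < N ∧ Odd q) (hp' : 0 ≤ p' ∧ p' < N ∧ Even p')
    (hq' : 0 ≤ q' ∧ q' < N ∧ Odd q') :
    StronglyCrossed C c s(v p, v q) s(v p', v q') ↔ (CycLT p p' q q' ∨ CycLT q' q p' p) ∧
      s(v p, v q') ∈ C.edges ∧ s(v q, v p') ∈ C.edges := by
  have hne : ∀ x y : ℤ, Even x → Odd y → c (v x) ≠ c (v y) := by
    intro x y hx hy he
    rw [color_eq_iff (h.color_ne hc)] at he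
    exact Int.not_even_iff_odd.2 (hx.sub_odd hy) he
  constructor
  · rintro ⟨x₁, x₂, y₁, y₂, he, hf, hcol, ho, h1, h2⟩
    rcases Sym2.eq_iff.1 he with ⟨rfl, rfl⟩ | ⟨rfl, rfl⟩ <;>
      rcases Sym2.eq_iff.1 hf with ⟨rfl, rfl⟩ | ⟨rfl, rfl⟩
    · rw [h.ordered_iff hp.1 hp.2.1 hp'.1 hp'.2.1 hq.1 hq.2.1 hq'.1 hq'.2.1] at ho
      exact ⟨ho, h1, h2⟩
    · exact absurd hcol (hne _ _ hp.2.2 hq'.2.2)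
    · exact absurd hcol.symm (hne _ _ hp'.2.2 hq.2.2)
    · rw [h.ordered_iff hq.1 hq.2.1 hq'.1 hq'.2.1 hp.1 hp.2.1 hp'.1 hp'.2.1] at ho
      exact ⟨ho.imp (fun hh => hh.rotate.rotate) fun hh => hh.rotate.rotate, h2, h1⟩
  · rintro ⟨ho, h1, h2⟩
    refine ⟨_, _, _, _, rfl, rfl, ?_, (h.ordered_iff hp.1 hp.2.1 hp'.1 hp'.2.1 hq.1 hq.2.1 hq'.1
      hq'.2.1).2 ho, h1, h2⟩
    rw [color_eq_iff (h.color_ne hc)]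
    exact hp.2.2.sub hp'.2.2

end CycleEnum

/-! ### Strong uniformity of Hamilton cycles with restricted chords -/

namespace CycleEnum

variable {V : Type*} {G : SimpleGraph V} {a : V} {C : G.Walk a a} {N : ℤ} {v : ℤ → V}
  {c : V → Bool}

lemma chordSystem (h : CycleEnum C N v) (hN : Even N) {ι : Type*} {p q : ι → ℤ}
    (hp : ∀ k, 0 ≤ p k ∧ Even (p k)) (hq : ∀ k, q k < N ∧ Odd (q k)) (hpq : ∀ k, p k < q k)
    (p_inj : Function.Injective p) (q_inj : Function.Injective q)
    (hch : chords C = Set.range fun k => s(v (p k), v (q k))) : ChordSystem G N v p q where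
  ham := h.ham
  even_N := hN
  nonneg k := (hp k).1
  lt := hpq
  lt_N k := (hq k).1
  even_p k := (hp k).2
  odd_q k := (hq k).2
  p_inj := p_inj
  q_inj := q_inj
  adj k := by
    have : s(v (p k), v (q k)) ∈ chords C := by rw [hch]; exact ⟨k, rfl⟩
    exact this.1
  not_cyc k i he := by
    have : s(v (p k), v (q k)) ∈ chords C := by rw [hch]; exact ⟨k, rfl⟩
    exact this.2 ((h.mem_edges _).2 ⟨i, he⟩)
  edge e he := by
    by_cases hC : e ∈ C.edges
    · exact Or.inl ((h.mem_edges _).1 hC)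
    · have : e ∈ chords C := ⟨he, hC⟩
      rw [hch] at this
      obtain ⟨k, rfl⟩ := this
      exact Or.inr ⟨k, rfl⟩

/-- If all chords are parallel to a chord at the vertex in position `0` and lie on the side of it
that ends with position `N`, then the parts of the cycle cut off by the chords are disjoint. -/
lemma exists_disjoint_positions (h : CycleEnum C N v) (hcG : ∀ x y, G.Adj x y → c x ≠ c y)
    {c' : V → Bool} (hc' : IsColoring C c')
    (hpar : ∀ e ∈ chords C, ∀ f ∈ chords C, e ≠ f → Parallel C c' e f)
    {s : ℤ} (hs0 : 0 < s) (hs : s < N) (hs' : Odd s)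
    (hside : ∀ p q, 0 ≤ p ∧ p < N ∧ Even p → 0 ≤ q ∧ q < N ∧ Odd q → s(v p, v q) ∈ chords C →
      s(v p, v q) ≠ s(v 0, v s) → s < p ∧ p < q) :
    ∃ p q : chords C → ℤ, ChordSystem G N v p q ∧ ∀ k l, k ≠ l → q k < p l ∨ q l < p k := by
  choose p q hp hp' hq hq' hpe hqo he using fun e : chords C => h.exists_of_mem_chords hcG e.2
  have hP : ∀ e, 0 ≤ p e ∧ p e < N ∧ Even (p e) := fun e => ⟨hp e, hp' e, hpe e⟩
  have hQ : ∀ e, 0 ≤ q e ∧ q e < N ∧ Odd (q e) := fun e => ⟨hq e, hq' e, hqo e⟩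
  have hlt : ∀ e, p e < q e := by
    intro e
    by_cases hes : s(v (p e), v (q e)) = s(v 0, v s)
    · have h1 := hp e
      have h2 := hp' e
      have h3 := hq e
      have h4 := hq' e
      rcases Sym2.eq_iff.1 hes with ⟨e1, e2⟩ | ⟨e1, e2⟩
      · have := h.ham.inj e1 (by omega) (by omega)
        have := h.ham.inj e2 (by omega) (by omega)
        omega
      · have := h.ham.inj e1 (by omega) (by omega)
        exact absurd (this ▸ hpe e) (Int.not_even_iff_odd.2 hs')
    · exact (hside _ _ (hP e) (hQ e) (he e ▸ e.2) hes).2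
  have hd : ∀ k l, k ≠ l → q k < p l ∨ q l < p k := by
    intro k l hkl
    have h1 := hpar k k.2 l l.2 (fun hh => hkl (Subtype.ext hh))
    rw [he k, he l, h.parallel_iff hc' (hP k) (hQ k) (hP l) (hQ l)] at h1
    have h2 := hlt k
    have h3 := hlt l
    unfold CycLT at h1
    omega
  refine ⟨p, q, h.chordSystem (h.ham.even_period (c := c) fun i => hcG _ _ (h.ham.adj i))
    (fun k => ⟨hp k, hpe k⟩) (fun k => ⟨hq' k, hqo k⟩) hlt ?_ ?_ ?_, hd⟩
  · intro k l hkl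
    by_contra hne
    have := hd k l hne
    have := hlt k
    have := hlt l
    omega
  · intro k l hkl
    by_contra hne
    have := hd k l hne
    have := hlt k
    have := hlt l
    omega
  · ext e
    constructor
    · exact fun hh => ⟨⟨e, hh⟩, (he ⟨e, hh⟩).symm⟩
    · rintro ⟨k, rfl⟩
      have := k.2
      rwa [he k] at this

lemma neg_pos (h : CycleEnum C N v) (i : ℤ) : v i = (fun i => v (-i)) (N - i) := by
  change _ = v (-(N - i))
  rw [neg_sub, h.ham.sub_period]

lemma exists_eq_mk_zero (h : CycleEnum C N v) (hcG : ∀ x y, G.Adj x y → c x ≠ c y) {e : Sym2 V}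
    (he : e ∈ chords C) : ∃ w s, CycleEnum C N w ∧ 0 < s ∧ s < N ∧ Odd s ∧ e = s(w 0, w s) := by
  obtain ⟨p, q, h1, h2, h3, h4, h5, h6, rfl⟩ := h.exists_of_mem_chords hcG he
  have hw := h.shift p
  have hodd := hw.ham.odd_sub_of_adj hcG (i := q - p) (j := 0) (by simpa using he.1.symm)
  rw [sub_zero] at hodd
  rcases lt_trichotomy p q with h7 | rfl | h7
  · exact ⟨_, q - p, hw, by omega, by omega, hodd, by simp⟩
  · simp at hodd
  · refine ⟨_, q - p + N, hw, by omega, by omega, ?_, ?_⟩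
    · exact hodd.add_even (h.ham.even_period (c := c) fun i => hcG _ _ (h.ham.adj i))
    · rw [hw.ham.add_period]
      simp

/-- Two chords that cross can be numbered so that their ends are in increasing positions. -/
lemma exists_crossing_positions (h : CycleEnum C N v) (hcG : ∀ x y, G.Adj x y → c x ≠ c y)
    {s p q : ℤ} (hsp : Odd s) (hp : Even p ∧ p < N) (hq : Odd q ∧ q < N)
    (hcr : (0 < p ∧ p < s ∧ s < q) ∨ (0 < q ∧ q < s ∧ s < p)) :
    ∃ w s' p' q', CycleEnum C N w ∧ 0 < p' ∧ p' < s' ∧ s' < q' ∧ q' < N ∧ Even p' ∧ Odd s' ∧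
      Odd q' ∧ s(v 0, v s) = s(w 0, w s') ∧ s(v p, v q) = s(w p', w q') := by
  rcases hcr with hcr | hcr
  · exact ⟨v, s, p, q, h, by omega, by omega, by omega, by omega, hp.1, hsp, hq.1, rfl, rfl⟩
  · have hN := h.ham.even_period (c := c) fun i => hcG _ _ (h.ham.adj i)
    refine ⟨_, N - s, N - p, N - q, h.neg, by omega, by omega, by omega, by omega, hN.sub hp.1,
      hN.sub_odd hsp, hN.sub_odd hq.1, ?_, ?_⟩
    · rw [h.neg_pos s]
      simp
    · rw [h.neg_pos p, h.neg_pos q]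

lemma exists_stronglyCrossed_positions (h : CycleEnum C N v)
    (hcG : ∀ x y, G.Adj x y → c x ≠ c y) {c' : V → Bool} (hc' : IsColoring C c') {e f : Sym2 V}
    (he : e ∈ chords C) (hf : f ∈ chords C) (hef : StronglyCrossed C c' e f) :
    ∃ w r, CycleEnum C N w ∧ Even r ∧ 2 ≤ r ∧ r + 4 ≤ N ∧ e = s(w 0, w (r + 1)) ∧
      f = s(w r, w (N - 1)) := by
  obtain ⟨w, s, hw, hs0, hs, hs', rfl⟩ := h.exists_eq_mk_zero hcG he
  obtain ⟨p, q, hp, hp', hq, hq', hpe, hqo, rfl⟩ := hw.exists_of_mem_chords hcG hf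
  have hN := hw.ham.even_period (c := c) fun i => hcG _ _ (hw.ham.adj i)
  have hcr := ((hw.stronglyCrossed_iff hc' ⟨le_rfl, by omega, by simp⟩ ⟨by omega, hs, hs'⟩
    ⟨hp, hp', hpe⟩ ⟨hq, hq', hqo⟩).1 hef).1
  obtain ⟨w', s', p', q', hw', h1, h2, h3, h4, h5, h6, h7, h8, h9⟩ :=
    hw.exists_crossing_positions hcG hs' ⟨hpe, hp'⟩ ⟨hqo, hq'⟩ (by
      unfold CycLT at hcr
      omega)
  rw [h8, h9] at hef
  obtain ⟨-, c1, c2⟩ := (hw'.stronglyCrossed_iff hc' ⟨le_rfl, by omega, by simp⟩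
    ⟨by omega, by omega, h6⟩ ⟨by omega, by omega, h5⟩ ⟨by omega, by omega, h7⟩).1 hef
  rw [hw'.mem_edges, hw'.ham.exists_eq_cycEdge_iff (by omega) (by omega) (by omega)
    (by omega)] at c1 c2
  obtain ⟨k, rfl⟩ := h5
  obtain ⟨l, rfl⟩ := hN
  obtain rfl : s' = k + k + 1 := by omega
  obtain rfl : q' = l + l - 1 := by omega
  obtain ⟨m, hm⟩ := h7
  exact ⟨w', k + k, hw', by simp, by omega, by omega, h8, h9⟩

lemma isUniformFamily_of_stronglyCrossed (h : CycleEnum C N v)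
    (hcG : ∀ x y, G.Adj x y → c x ≠ c y) {c' : V → Bool} (hc' : IsColoring C c') {e f : Sym2 V}
    (hch : chords C = {e, f}) (hef : StronglyCrossed C c' e f)
    {F : Set (Sym2 V)} (hF : ∃ M ∈ perfectMatchings G, M ⊆ F) :
    IsUniformFamily {M | M ∈ perfectMatchings G ∧ M ⊆ F} := by
  obtain ⟨w, r, hw, hr, h2, h4, rfl, rfl⟩ := h.exists_stronglyCrossed_positions hcG hc'
    (e := e) (f := f) (by rw [hch]; simp) (by rw [hch]; simp) hef
  have hN := hw.ham.even_period (c := c) fun i => hcG _ _ (hw.ham.adj i)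
  have hs : ChordSystem G N w ![0, r] ![r + 1, N - 1] := by
    refine hw.chordSystem hN ?_ ?_ ?_ ?_ ?_ ?_
    · rw [Fin.forall_fin_two]
      exact ⟨⟨le_rfl, by simp⟩, ⟨by simp; omega, by simpa⟩⟩
    · rw [Fin.forall_fin_two]
      exact ⟨⟨by simp; omega, by simpa using hr.add_one⟩, ⟨by simp, by simpa using hN.sub_odd odd_one⟩⟩
    · rw [Fin.forall_fin_two]
      exact ⟨by simp; omega, by simp; omega⟩
    · intro i j
      revert i j
      simp [Fin.forall_fin_two]
      omega
    · intro i j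
      revert i j
      simp [Fin.forall_fin_two]
      omega
    · rw [hch]
      ext e
      simp [Fin.exists_fin_two, eq_comm]
  exact hs.isUniformFamily_of_crossed rfl rfl rfl rfl h2 h4 hF

lemma isUniformFamily_of_parallel [Finite V] (h : CycleEnum C N v)
    (hcG : ∀ x y, G.Adj x y → c x ≠ c y) {c' : V → Bool} (hc' : IsColoring C c')
    (hpar : ∀ e ∈ chords C, ∀ f ∈ chords C, e ≠ f → Parallel C c' e f)
    {F : Set (Sym2 V)} (hF : ∃ M ∈ perfectMatchings G, M ⊆ F) :
    IsUniformFamily {M | M ∈ perfectMatchings G ∧ M ⊆ F} := by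
  classical
  have := Fintype.ofFinite (chords C)
  suffices ∃ v, ∃ p q : chords C → ℤ, ChordSystem G N v p q ∧
      ∀ k l, k ≠ l → q k < p l ∨ q l < p k by
    obtain ⟨v, p, q, hs, hd⟩ := this
    exact hs.isUniformFamily_of_disjoint hd hF
  by_cases hne : (chords C).Nonempty
  swap
  · rw [Set.not_nonempty_iff_eq_empty] at hne
    have hE : IsEmpty (chords C) := Set.isEmpty_coe_sort.2 hne
    refine ⟨v, hE.elim, hE.elim, h.chordSystem
      (h.ham.even_period (c := c) fun i => hcG _ _ (h.ham.adj i))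
      hE.elim hE.elim hE.elim (fun k => hE.elim k) (fun k => hE.elim k) ?_, hE.elim⟩
    rw [Set.range_eq_empty]
    exact hne
  obtain ⟨e, he⟩ := hne
  obtain ⟨w, s, hw, hs0, hs, hs', rfl⟩ := h.exists_eq_mk_zero hcG he
  have hN := h.ham.even_period (c := c) fun i => hcG _ _ (h.ham.adj i)
  have h0 : (0 : ℤ) ≤ 0 ∧ 0 < N ∧ Even (0 : ℤ) := ⟨le_rfl, by omega, by simp⟩
  have hsP : 0 ≤ s ∧ s < N ∧ Odd s := ⟨hs0.le, hs, hs'⟩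
  -- Either all chords lie beyond `s`, or one lies on the other side, and then all others do. The second
  -- case becomes the first one when the direction of the cycle is reversed.
  by_cases hside : ∃ p q, (0 ≤ p ∧ p < N ∧ Even p) ∧ (0 ≤ q ∧ q < N ∧ Odd q) ∧
    s(w p, w q) ∈ chords C ∧ s(w p, w q) ≠ s(w 0, w s) ∧ q < p
  · obtain ⟨p, q, hp, hq, hch, hn, hqp⟩ := hside
    have hpar0 := hpar _ hch _ he hn
    rw [hw.parallel_iff hc' hp hq h0 hsP] at hpar0
    refine ⟨_, hw.neg.exists_disjoint_positions hcG hc' hpar (s := N - s) (by omega) (by omega)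
      (hN.sub_odd hs') ?_⟩
    intro p' q' hp' hq' hch' hn'
    have e1 := hw.neg_pos p
    have e2 := hw.neg_pos q
    have e3 := hw.neg_pos s
    have e4 : w 0 = (fun i => w (-i)) 0 := by simp
    rw [e3, e4] at he
    rw [e1, e2] at hch
    have hodd : ∀ i, Odd i → Odd (N - i) := fun i hi => hN.sub_odd hi
    have b1 := hpar _ hch' _ he hn'
    rw [hw.neg.parallel_iff hc' hp' hq' h0 ⟨by omega, by omega, hodd _ hs'⟩] at b1
    by_cases hsame : s(w (-p'), w (-q')) =
        s((fun i => w (-i)) (N - p), (fun i => w (-i)) (N - q))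
    · rcases Sym2.eq_iff.1 hsame with ⟨a1, a2⟩ | ⟨a1, a2⟩
      · unfold CycLT at hpar0
        have := hw.neg.ham.inj a1 (by omega) (by omega)
        have := hw.neg.ham.inj a2 (by omega) (by omega)
        omega
      · unfold CycLT at hpar0
        have := hw.neg.ham.inj a1 (by omega) (by omega)
        exact absurd (this ▸ hp'.2.2) (Int.not_even_iff_odd.2 (hodd _ hq.2.2))
    · have b2 := hpar _ hch' _ hch hsame
      have h3 : p' ≠ q' := by rintro rfl; exact Int.not_even_iff_odd.2 hq'.2.2 hp'.2.2
      unfold CycLT at hpar0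
      rw [hw.neg.parallel_iff hc' hp' hq' ⟨by omega, by omega, hN.sub hp.2.2⟩
        ⟨by omega, by omega, hodd _ hq.2.2⟩] at b2
      unfold CycLT at b1 b2
      omega
  · push Not at hside
    refine ⟨w, hw.exists_disjoint_positions hcG hc' hpar hs0 hs hs' ?_⟩
    intro p q hp hq hch hn
    have h1 := hside p q hp hq hch hn
    have hpar0 := hpar _ hch _ he hn
    rw [hw.parallel_iff hc' hp hq h0 hsP] at hpar0
    unfold CycLT at hpar0
    have := hp.2.2.add_odd hq.2.2
    have : p ≠ q := by rintro rfl; exact Int.not_even_iff_odd.2 hq.2.2 hp.2.2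
    omega

end CycleEnum

lemma MatchingCovered.matchable {V : Type*} [Nontrivial V] {G : SimpleGraph V}
    (h : MatchingCovered G) : Matchable G := by
  obtain ⟨y, hxy⟩ := h.1.preconnected.exists_adj_of_nontrivial (Classical.arbitrary V)
  obtain ⟨M, hM, -⟩ := h.2 s(_, _) hxy
  exact ⟨M, hM⟩

theorem stronglyUniform_of_isB {V : Type*} [Finite V] [DecidableEq V] {G : SimpleGraph V}
    {c : V → Bool} (hc : ∀ x y, G.Adj x y → c x ≠ c y) (hG : Matchable G)
    (h : IsB₀ G ∨ IsB₁ G ∨ IsB₂ G ∨ IsB₃ G) : StronglyUniform G := by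
  refine stronglyUniform_of_isUniformFamily hc hG fun F hF => ?_
  have hcol : ∀ {a : V} (C : G.Walk a a), IsColoring C c := fun C x y hxy =>
    hc _ _ (C.edges_subset_edgeSet hxy)
  rcases h with ⟨a, C, hC, -, hch⟩ | ⟨-, a, C, hC, e, hch⟩ | ⟨a, C, c', hC, hc', e, f, -, hch, hef⟩ |
    ⟨-, a, C, c', hC, hc', hpar⟩
  all_goals obtain ⟨v, hv⟩ := CycleEnum.exists_of_isHamiltonianCycle hC
  · refine hv.isUniformFamily_of_parallel hc (hcol C) ?_ hF
    simp [hch]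
  · refine hv.isUniformFamily_of_parallel hc (hcol C) ?_ hF
    rw [hch]
    rintro _ rfl _ rfl h
    exact absurd rfl h
  · exact hv.isUniformFamily_of_stronglyCrossed hc hc' hch hef hF
  · exact hv.isUniformFamily_of_parallel hc hc' hpar hF

/-! ### Constructing conformal minors -/

section Minor

variable {V : Type*} {G : SimpleGraph V} {W : Type*} {J : SimpleGraph W}

lemma exists_walk_coe (H : G.Subgraph) {x y : V} (p : G.Walk x y) (hx : x ∈ H.verts)
    (hy : y ∈ H.verts) (he : ∀ z t, s(z, t) ∈ p.edges → H.Adj z t) :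
    ∃ q : H.coe.Walk ⟨x, hx⟩ ⟨y, hy⟩, q.support.map Subtype.val = p.support ∧
      q.edges.map (Sym2.map Subtype.val) = p.edges ∧ q.length = p.length := by
  induction p with
  | nil => exact ⟨Walk.nil, by simp⟩
  | @cons x z y hxz p ih =>
    have hadj : H.Adj x z := he _ _ (by simp)
    obtain ⟨q, h1, h2, h3⟩ := ih (H.edge_vert hadj.symm) hy fun z t hzt => he z t (by simp [hzt])
    exact ⟨Walk.cons (H.coe_adj _ _ ▸ hadj) q, by simp [h1], by simp [h2], by simp [h3]⟩

/-- Paths of odd length in `G` that connect given vertices in the way prescribed by `J`, have no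
inner vertices in common, and leave a matchable rest form a conformal minor. -/
lemma isConformalMinor_of_darts {β : W → V} (hβ : Function.Injective β)
    (P : ∀ d : J.Dart, G.Walk (β d.fst) (β d.snd)) (hP : ∀ d, (P d).IsPath)
    (hodd : ∀ d, Odd (P d).length) (hsymm : ∀ d, P d.symm = (P d).reverse)
    (hbranch : ∀ d w, β w ∈ (P d).support → w = d.fst ∨ w = d.snd)
    (hdisj : ∀ d d', d.edge ≠ d'.edge → ∀ x, x ∈ (P d).support → x ∈ (P d').support →
      x ∈ Set.range β)
    (hrest : Matchable (G.induce {x | x ∉ Set.range β ∧ ∀ d, x ∉ (P d).support})) :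
    IsConformalMinor J G := by
  let H : G.Subgraph :=
    { verts := {x | x ∈ Set.range β ∨ ∃ d, x ∈ (P d).support}
      Adj := fun x y => ∃ d, s(x, y) ∈ (P d).edges
      adj_sub := fun ⟨d, hd⟩ => (P d).edges_subset_edgeSet hd
      edge_vert := fun ⟨d, hd⟩ => Or.inr ⟨d, (P d).fst_mem_support_of_mem_edges hd⟩
      symm := ⟨fun x y ⟨d, hd⟩ => ⟨d, by rwa [Sym2.eq_swap]⟩⟩ }
  have hmem : ∀ w, β w ∈ H.verts := fun w => Or.inl ⟨w, rfl⟩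
  choose Q hQs hQe hQl using fun d => exists_walk_coe H (P d) (hmem _) (hmem _)
    fun z t hzt => ⟨d, hzt⟩
  have hsup : ∀ d (x : H.verts), x ∈ (Q d).support ↔ x.1 ∈ (P d).support := by
    intro d x
    rw [← hQs d]
    exact (List.mem_map_of_injective Subtype.val_injective).symm
  have hedge : ∀ d (x y : H.verts), s(x, y) ∈ (Q d).edges ↔ s(x.1, y.1) ∈ (P d).edges := by
    intro d x y
    rw [← hQe d, show s(x.1, y.1) = Sym2.map Subtype.val s(x, y) from rfl]
    exact (List.mem_map_of_injective (Sym2.map.injective Subtype.val_injective)).symm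
  refine ⟨H, ?_, ⟨⟨⟨fun w => ⟨β w, hmem w⟩, fun x y hxy => hβ (congrArg Subtype.val hxy)⟩,
    Q, fun d => ?_, fun d => ?_, fun d => ?_, fun d w hw => ?_, fun d d' hd x hx hx' => ?_,
    fun x => ?_, fun e he => ?_⟩⟩⟩
  · have : H.vertsᶜ = {x | x ∉ Set.range β ∧ ∀ d, x ∉ (P d).support} := by
      ext x
      change ¬ (_ ∨ _) ↔ _
      simp
    rw [IsConformal, this]
    exact hrest
  · rw [Walk.isPath_def]
    exact List.Nodup.of_map Subtype.val (by rw [hQs]; exact (hP d).support_nodup)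
  · exact hQl d ▸ hodd d
  · have : (Q d.symm).support = (Q d).support.reverse := by
      apply List.map_injective_iff.2 Subtype.val_injective
      rw [List.map_reverse, hQs d]
      exact (hQs d.symm).trans ((congrArg Walk.support (hsymm d)).trans (Walk.support_reverse _))
    exact Walk.ext_support (this.trans (Walk.support_reverse _).symm)
  · exact hbranch d w ((hsup d _).1 hw)
  · obtain ⟨w, hw⟩ := hdisj d d' hd x ((hsup _ _).1 hx) ((hsup _ _).1 hx')
    exact ⟨w, Subtype.ext hw⟩
  · rcases x.2 with ⟨w, hw⟩ | ⟨d, hd⟩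
    · exact Or.inl ⟨w, Subtype.ext hw⟩
    · exact Or.inr ⟨d, (hsup d x).2 hd⟩
  · induction e with
    | h x y =>
      obtain ⟨d, hd⟩ : ∃ d, s(x.1, y.1) ∈ (P d).edges := he
      exact ⟨d, (hedge d x y).2 hd⟩

/-- A variant of `isConformalMinor_of_darts` in which each edge of `J` has one orientation, from the
smaller to the larger rank `r`, and the inner vertices of its path are those with the label `s(i, j)`.
The labels of the remaining vertices are not edges of `J`. -/
lemma isConformalMinor_of_label {β : W → V} (hβ : Function.Injective β) {r : W → ℕ}
    (hr : Function.Injective r) (lab : V → Sym2 W) (hlab : ∀ w, lab (β w) ∉ J.edgeSet)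
    (hP : ∀ i j, J.Adj i j → r i < r j → ∃ p : G.Walk (β i) (β j), p.IsPath ∧ Odd p.length ∧
      ∀ x, x ∈ p.support ↔ x = β i ∨ x = β j ∨ lab x = s(i, j))
    (hrest : Matchable (G.induce {x | x ∉ Set.range β ∧ lab x ∉ J.edgeSet})) :
    IsConformalMinor J G := by
  choose q hq hodd hsup using hP
  have hflip : ∀ d : J.Dart, ¬ r d.fst < r d.snd → r d.snd < r d.fst := by
    intro d hd
    have := hr.ne d.adj.ne
    omega
  -- The other orientation of an edge gets the reversed path.
  let P : ∀ d : J.Dart, G.Walk (β d.fst) (β d.snd) := fun d =>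
    if h : r d.fst < r d.snd then q _ _ d.adj h else (q _ _ d.adj.symm (hflip d h)).reverse
  have hPs : ∀ d x, x ∈ (P d).support ↔ x = β d.fst ∨ x = β d.snd ∨ lab x = d.edge := by
    intro d x
    simp only [P]
    split_ifs with h
    · exact hsup _ _ d.adj h x
    · rw [Walk.support_reverse, List.mem_reverse, hsup _ _ d.adj.symm (hflip d h)]
      rw [Sym2.eq_swap, or_left_comm]
      rfl
  refine isConformalMinor_of_darts hβ P (fun d => ?_) (fun d => ?_) (fun d => ?_) (fun d w hw => ?_)
    (fun d d' hd x hx hx' => ?_) ?_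
  · simp only [P]
    split_ifs with h
    · exact hq _ _ d.adj h
    · exact (hq _ _ d.adj.symm (hflip d h)).reverse
  · simp only [P]
    split_ifs with h
    · exact hodd _ _ d.adj h
    · rw [Walk.length_reverse]
      exact hodd _ _ d.adj.symm (hflip d h)
  · simp only [P]
    by_cases h : r d.fst < r d.snd
    · rw [dif_pos h, dif_neg (by change ¬ r d.snd < r d.fst; omega)]
      rfl
    · rw [dif_neg h, dif_pos (show r d.symm.fst < r d.symm.snd from hflip d h), Walk.reverse_reverse]
      rfl
  · rcases (hPs d _).1 hw with h | h | h
    · exact Or.inl (hβ h)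
    · exact Or.inr (hβ h)
    · exact absurd (h ▸ d.edge_mem) (hlab w)
  · rcases (hPs d x).1 hx with rfl | rfl | h
    · exact ⟨_, rfl⟩
    · exact ⟨_, rfl⟩
    rcases (hPs d' x).1 hx' with rfl | rfl | h'
    · exact ⟨_, rfl⟩
    · exact ⟨_, rfl⟩
    exact absurd (h.symm.trans h') hd
  · suffices hset : {x | x ∉ Set.range β ∧ ∀ d, x ∉ (P d).support} =
        {x | x ∉ Set.range β ∧ lab x ∉ J.edgeSet} by rwa [hset]
    ext x
    refine and_congr_right fun hx => ?_
    constructor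
    · intro hd he
      obtain ⟨d, hd'⟩ : ∃ d : J.Dart, d.edge = lab x := by
        induction h : lab x with
        | h i j => rw [h] at he; exact ⟨⟨(i, j), he⟩, rfl⟩
      exact hd d ((hPs d x).2 (Or.inr (Or.inr hd'.symm)))
    · intro he d hd
      rcases (hPs d x).1 hd with rfl | rfl | h
      · exact hx ⟨_, rfl⟩
      · exact hx ⟨_, rfl⟩
      · exact he (h ▸ d.edge_mem)

end Minor

lemma matchable_induce_of_eq_empty {V : Type*} {G : SimpleGraph V} {S : Set V} (hS : S = ∅) :
    Matchable (G.induce S) := by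
  rw [matchable_induce_iff]
  exact ⟨id, by simp [hS]⟩

namespace HamEnum

variable {V : Type*} {G : SimpleGraph V} {N : ℤ} {v : ℤ → V}

/-- The part of the Hamilton cycle from position `i` to position `j`. -/
lemma exists_walk (hv : HamEnum G N v) {i j : ℤ} (hij : i ≤ j) (hj : j < i + N) :
    ∃ p : G.Walk (v i) (v j), p.IsPath ∧ (p.length : ℤ) = j - i ∧
      ∀ z, z ∈ p.support ↔ ∃ x, i ≤ x ∧ x ≤ j ∧ v x = z := by
  obtain ⟨n, rfl⟩ := Int.le.dest hij
  clear hij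
  induction n with
  | zero =>
    refine ⟨Walk.nil.copy rfl (by simp), by simp, by simp, fun z => ?_⟩
    simp only [Nat.cast_zero, Walk.support_copy, Walk.support_nil, List.mem_singleton, add_zero]
    constructor
    · rintro rfl
      exact ⟨i, le_rfl, le_rfl, rfl⟩
    · rintro ⟨x, h1, h2, rfl⟩
      rw [le_antisymm h1 h2]
  | succ n ih =>
    push_cast at hj ⊢
    obtain ⟨p, hp, hl, hs⟩ := ih (by omega)
    have hadj := hv.adj (i + n)
    rw [add_assoc] at hadj
    refine ⟨p.concat hadj, ?_, ?_, fun z => ?_⟩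
    · refine hp.concat ?_ hadj
      rw [hs]
      rintro ⟨x, h1, h2, h3⟩
      have := hv.inj h3 (by omega) (by omega)
      omega
    · rw [Walk.length_concat]
      push_cast
      linarith
    · rw [Walk.support_concat, List.mem_append, hs, List.mem_singleton]
      constructor
      · rintro (⟨x, h1, h2, rfl⟩ | rfl)
        · exact ⟨x, h1, by omega, rfl⟩
        · exact ⟨_, by omega, le_rfl, rfl⟩
      · rintro ⟨x, h1, h2, rfl⟩
        rcases h2.lt_or_eq with h2 | rfl
        · exact Or.inl ⟨x, h1, by omega, rfl⟩
        · exact Or.inr rfl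

/-- A Hamilton cycle together with some chords contains a bisubdivision of a Hamilton cycle
with chords. The vertex `i` of the latter is in position `t i`. -/
lemma isConformalMinor (hv : HamEnum G N v) (hN : Even N) {m : ℕ} (hm : 2 ≤ m) (hm' : Odd m)
    {J : SimpleGraph (Fin (m + 1))} {t : Fin (m + 1) → ℤ} (ht : StrictMono t) (ht0 : t 0 = 0)
    (htN : ∀ i, t i < N) (hpar : ∀ i, Even (t i) ↔ Even i.val)
    (hcyc : ∀ i, J.Adj i (i + 1))
    (hch : ∀ i j, J.Adj i j → i < j → j = i + 1 ∨ i = j + 1 ∨ G.Adj (v (t i)) (v (t j))) :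
    IsConformalMinor J G := by
  classical
  have hpos : ∀ i, 0 ≤ t i := fun i => ht0 ▸ ht.monotone (Fin.zero_le i)
  have hβ : Function.Injective fun i => v (t i) := by
    intro i j hij
    have h1 := hpos i
    have h2 := hpos j
    have h3 := htN i
    have h4 := htN j
    exact ht.injective (hv.inj hij (by omega) (by omega))
  have hidx : ∀ z, ∃ k : Fin (m + 1), ∃ x, t k ≤ x ∧ x < N ∧ (∀ j, k < j → x < t j) ∧ v x = z := by
    intro z
    obtain ⟨x, hx, hx', rfl⟩ := hv.exists_range z
    obtain ⟨k, hk, hmax⟩ := Finset.exists_max_image (Finset.univ.filter fun k => t k ≤ x) id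
      ⟨0, by simp [ht0, hx]⟩
    refine ⟨k, x, by simpa using hk, hx', fun j hj => ?_, rfl⟩
    by_contra! hh
    exact absurd (hmax j (by simpa using hh)) (not_le.2 hj)
  choose idx pos hle hlt hnext hpv using hidx
  have huniq : ∀ z k x, v x = z → t k ≤ x → x < N → (∀ j, k < j → x < t j) → idx z = k := by
    intro z k x hx h1 h2 h3
    have h4 := hpos k
    have h5 := hpos (idx z)
    have h6 := hle z
    have h7 := hlt z
    have : x = pos z := hv.inj (hx.trans (hpv z).symm) (by omega) (by omega)
    rcases lt_trichotomy (idx z) k with h | h | h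
    · have := hnext z k h
      omega
    · exact h
    · have := h3 _ h
      omega
  -- The vertices between the positions `t k` and `t (k + 1)` belong to the edge from `k` to `k + 1`. The
  -- addition in `Fin (m + 1)` is cyclic, so this includes the part after the last position.
  let lab : V → Sym2 (Fin (m + 1)) := fun z =>
    if z ∈ Set.range fun i => v (t i) then s(0, 0) else s(idx z, idx z + 1)
  have hseg : ∀ (k : Fin (m + 1)) (y : ℤ), t k < y → (∀ j, k < j → y ≤ t j) → y ≤ N → ∀ z,
      z ∉ (Set.range fun i => v (t i)) → (v y ∈ Set.range fun i => v (t i)) →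
      (y < N → ∃ j, k < j ∧ y = t j) →
      ((∃ x, t k ≤ x ∧ x ≤ y ∧ v x = z) ↔ idx z = k) := by
    intro k y hky hy hyN z hz hyr hyj
    constructor
    · rintro ⟨x, h1, h2, rfl⟩
      have : x ≠ y := by rintro rfl; exact hz hyr
      exact huniq _ _ x rfl h1 (by omega) fun j hj => by have := hy j hj; omega
    · rintro rfl
      refine ⟨pos z, hle z, ?_, hpv z⟩
      rcases hyN.lt_or_eq with h | h
      · obtain ⟨j, hj, rfl⟩ := hyj h
        exact (hnext z j hj).le
      · exact h ▸ (hlt z).le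
  refine isConformalMinor_of_label hβ (r := Fin.val) Fin.val_injective lab ?_ ?_ ?_
  · intro w
    simp only [lab]
    rw [if_pos ⟨w, rfl⟩]
    exact fun h => J.loopless.irrefl _ h
  · intro i j hij hlt
    have hval : ∀ k : Fin (m + 1), (k.val = m ∧ (k + 1).val = 0) ∨
        (k.val < m ∧ (k + 1).val = k.val + 1) := by
      intro k
      rw [Fin.val_add_one]
      split_ifs with h
      · exact Or.inl ⟨by rw [h]; rfl, rfl⟩
      · refine Or.inr ⟨?_, rfl⟩
        have := Fin.val_ne_of_ne h
        have := k.2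
        rw [Fin.val_last] at *
        omega
    have hi := hval i
    have hj := hval j
    have hlab : ∀ x, lab x = s(i, j) ↔ x ∉ (Set.range fun i => v (t i)) ∧
        ((idx x = i ∧ j = i + 1) ∨ (idx x = j ∧ i = j + 1)) := by
      intro x
      simp only [lab]
      split_ifs with hx
      · simp only [hx, not_true, false_and, iff_false, Sym2.eq_iff]
        rintro (⟨rfl, rfl⟩ | ⟨rfl, rfl⟩) <;> omega
      · simp only [hx, not_false_iff, true_and, Sym2.eq_iff]
        constructor
        · rintro (⟨rfl, rfl⟩ | ⟨rfl, rfl⟩) <;> simp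
        · rintro (⟨rfl, rfl⟩ | ⟨rfl, rfl⟩) <;> simp
    simp only [hlab]
    by_cases c1 : j = i + 1
    · have c2 : i ≠ j + 1 := by
        rintro hh
        rw [Fin.ext_iff] at hh c1
        omega
      have hji : i < j := hlt
      obtain ⟨p, hp, hl, hs⟩ := hv.exists_walk (ht hji).le (by
        have := hpos i
        have := htN j
        omega)
      refine ⟨p, hp, ?_, fun x => ?_⟩
      · rw [← Int.odd_coe_nat, hl, ← Int.not_even_iff_odd, Int.even_sub, hpar, hpar, c1]
        have : (i + 1).val = i.val + 1 := by rw [← c1]; omega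
        rw [this, Nat.even_add_one]
        tauto
      · rw [hs]
        have hl : (idx x = i ∧ j = i + 1 ∨ idx x = j ∧ i = j + 1) ↔ idx x = i := by tauto
        rw [hl]
        by_cases hx : x ∈ Set.range fun i => v (t i)
        · obtain ⟨k, rfl⟩ := hx
          simp only [Set.mem_range, exists_apply_eq_apply, not_true, false_and, or_false]
          constructor
          · rintro ⟨x, h1, h2, h3⟩
            have := hv.inj h3 (by have := htN j; have := hpos k; omega)
              (by have := htN k; have := hpos i; omega)
            subst this
            rw [ht.le_iff_le] at h1 h2
            rcases h1.eq_or_lt with h1 | h1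
            · exact Or.inl (by rw [h1])
            · right
              have : k = j := by
                rw [Fin.lt_def] at h1
                rw [Fin.le_def] at h2
                rw [Fin.ext_iff] at c1 ⊢
                omega
              rw [this]
          · rintro (h | h)
            · exact ⟨t i, le_rfl, (ht hji).le, h.symm⟩
            · exact ⟨t j, (ht hji).le, le_rfl, h.symm⟩
        · rw [hseg i (t j) (ht hji) (fun k hk => ht.monotone (by
            rw [Fin.lt_def] at hk
            rw [Fin.ext_iff] at c1
            rw [Fin.le_def]
            omega)) (htN j).le x hx ⟨j, rfl⟩ (fun _ => ⟨j, hji, rfl⟩)]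
          have : ∀ k, x ≠ v (t k) := fun k hk => hx ⟨k, hk.symm⟩
          simp [this, hx]
    by_cases c2 : i = j + 1
    · rw [Fin.ext_iff] at c2
      obtain rfl : i = 0 := by rw [Fin.ext_iff, Fin.val_zero]; omega
      have hjm : ∀ k, ¬ j < k := by
        intro k hk
        have := k.2
        rw [Fin.lt_def] at hk
        omega
      obtain ⟨p, hp, hl, hs⟩ := hv.exists_walk (i := t j) (j := N) (htN j).le (by
        have := ht (show 0 < j from hlt)
        omega)
      have hN0 : v N = v (t 0) := by rw [ht0, ← hv.add_period 0, zero_add]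
      refine ⟨p.reverse.copy hN0 rfl, by simpa using hp, ?_, fun x => ?_⟩
      · rw [Walk.length_copy, Walk.length_reverse, ← Int.odd_coe_nat, hl, ← Int.not_even_iff_odd,
          Int.even_sub, hpar, show j.val = m by omega]
        rw [← Nat.not_even_iff_odd] at hm'
        tauto
      · rw [Walk.support_copy, Walk.support_reverse, List.mem_reverse, hs]
        have c3 : (0 : Fin (m + 1)) = j + 1 := by rw [Fin.ext_iff]; exact c2
        simp only [c1, and_false, false_or]
        rw [and_iff_left c3]
        by_cases hx : x ∈ Set.range fun i => v (t i)
        · obtain ⟨k, rfl⟩ := hx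
          simp only [Set.mem_range, exists_apply_eq_apply, not_true, false_and, or_false]
          constructor
          · rintro ⟨x, h1, h2, h3⟩
            rcases h2.eq_or_lt with rfl | h2
            · left
              rw [← h3, hN0]
            · have := hv.inj h3 (by have := hpos k; omega)
                (by have := htN k; have := hpos j; omega)
              subst this
              rw [ht.le_iff_le] at h1
              right
              rw [(h1.eq_or_lt).resolve_right (hjm k)]
          · rintro (h | h)
            · exact ⟨N, (htN j).le, le_rfl, hN0.trans h.symm⟩
            · exact ⟨t j, le_rfl, (htN j).le, h.symm⟩
        · rw [hseg j N (htN j) (fun k hk => absurd hk (hjm k)) le_rfl x hx ⟨0, hN0.symm⟩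
            (fun h => absurd h (lt_irrefl _))]
          have : ∀ k, x ≠ v (t k) := fun k hk => hx ⟨k, hk.symm⟩
          simp [this, hx]
    · have hadj := ((hch i j hij hlt).resolve_left c1).resolve_left c2
      refine ⟨hadj.toWalk, by simpa using hadj.ne, by simp, fun x => ?_⟩
      simp [c1, c2]
  · refine matchable_induce_of_eq_empty ?_
    rw [Set.eq_empty_iff_forall_notMem]
    rintro x ⟨hx, hx'⟩
    apply hx'
    simp only [lab]
    rw [if_neg hx]
    exact hcyc _

end HamEnum

section Theta

variable {V : Type*} {G : SimpleGraph V}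

lemma exists_eq_cons_cons {u w : V} {p : G.Walk u w} (hp : p.IsPath) (h3 : 3 ≤ p.length) :
    ∃ (x y : V) (t : G.Walk y w), G.Adj u x ∧ G.Adj x y ∧ t.IsPath ∧ t.length + 2 = p.length ∧
      p.support = u :: x :: t.support ∧ y ≠ w := by
  cases p with
  | nil => simp at h3
  | cons h0 p =>
    cases p with
    | nil => simp at h3
    | @cons _ y _ h1 t =>
      refine ⟨_, _, t, h0, h1, hp.of_cons.of_cons, rfl, rfl, ?_⟩
      rintro rfl
      have := (Walk.isPath_iff_nil (p := t)).1 hp.of_cons.of_cons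
      rw [← Walk.length_eq_zero_iff] at this
      simp [this] at h3

/-- Three internally disjoint paths of odd length at least three form a bisubdivision of `A₁`: their
first two edges remain, and the rest of each path replaces its third edge. -/
lemma isConformalMinor_A₁ {u w : V} (p : Fin 3 → G.Walk u w) (hp : ∀ k, (p k).IsPath)
    (hodd : ∀ k, Odd (p k).length) (h3 : ∀ k, 3 ≤ (p k).length)
    (hd : ∀ k l, k ≠ l → ∀ z, z ∈ (p k).support → z ∈ (p l).support → z = u ∨ z = w)
    (hrest : Matchable (G.induce {z | ∀ k, z ∉ (p k).support})) : IsConformalMinor A₁ G := by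
  classical
  choose x y t hux hxy ht htl hs hyw using fun k => exists_eq_cons_cons (hp k) (h3 k)
  have hnd := fun k => (hp k).support_nodup
  simp only [hs, List.nodup_cons, List.mem_cons, not_or] at hnd
  have htm : ∀ k z, z ∈ (t k).support → z ∈ (p k).support := fun k z hz => by simp [hs, hz]
  have hxm : ∀ k, x k ∈ (p k).support := fun k => by simp [hs]
  have hym : ∀ k, y k ∈ (p k).support := fun k => htm k _ (t k).start_mem_support
  have hxu : ∀ k, x k ≠ u := fun k => Ne.symm (hnd k).1.1
  have hxt : ∀ k, x k ∉ (t k).support := fun k => (hnd k).2.1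
  have hut : ∀ k, u ∉ (t k).support := fun k => (hnd k).1.2
  have hxw : ∀ k, x k ≠ w := fun k h => hxt k (by rw [h]; exact (t k).end_mem_support)
  have hyu : ∀ k, y k ≠ u := fun k h => hut k (h ▸ (t k).start_mem_support)
  have huw : u ≠ w := fun h => hut 0 (by rw [h]; exact (t 0).end_mem_support)
  have hxy' : ∀ k, x k ≠ y k := fun k h => hxt k (by rw [h]; exact (t k).start_mem_support)
  have hx_mem : ∀ {k l}, x k ∈ (p l).support → k = l := by
    intro k l h
    by_contra hkl
    rcases hd k l hkl _ (hxm k) h with h | h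
    exacts [hxu k h, hxw k h]
  have hy_mem : ∀ {k l}, y k ∈ (p l).support → k = l := by
    intro k l h
    by_contra hkl
    rcases hd k l hkl _ (hym k) h with h | h
    exacts [hyu k h, hyw k h]
  let β : Fin 8 → V := ![u, w, x 0, y 0, x 1, y 1, x 2, y 2]
  let a : Fin 3 → Fin 8 := ![2, 4, 6]
  let b : Fin 3 → Fin 8 := ![3, 5, 7]
  have hβ : ∀ i, β i = u ∧ i = 0 ∨ β i = w ∧ i = 1 ∨ (∃ k, β i = x k ∧ i = a k) ∨
      ∃ k, β i = y k ∧ i = b k := by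
    intro i
    fin_cases i
    · exact Or.inl ⟨rfl, rfl⟩
    · exact Or.inr (Or.inl ⟨rfl, rfl⟩)
    · exact Or.inr (Or.inr (Or.inl ⟨0, rfl, rfl⟩))
    · exact Or.inr (Or.inr (Or.inr ⟨0, rfl, rfl⟩))
    · exact Or.inr (Or.inr (Or.inl ⟨1, rfl, rfl⟩))
    · exact Or.inr (Or.inr (Or.inr ⟨1, rfl, rfl⟩))
    · exact Or.inr (Or.inr (Or.inl ⟨2, rfl, rfl⟩))
    · exact Or.inr (Or.inr (Or.inr ⟨2, rfl, rfl⟩))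
  have hβx : ∀ k, β (a k) = x k := by intro k; fin_cases k <;> rfl
  have hβy : ∀ k, β (b k) = y k := by intro k; fin_cases k <;> rfl
  have hinj : Function.Injective β := by
    intro i j hij
    rcases hβ i with ⟨h1, rfl⟩ | ⟨h1, rfl⟩ | ⟨k, h1, rfl⟩ | ⟨k, h1, rfl⟩ <;>
      rcases hβ j with ⟨h2, rfl⟩ | ⟨h2, rfl⟩ | ⟨l, h2, rfl⟩ | ⟨l, h2, rfl⟩ <;>
      replace hij := h1.symm.trans (hij.trans h2)
    · rfl
    · exact absurd hij huw
    · exact absurd hij.symm (hxu l)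
    · exact absurd hij.symm (hyu l)
    · exact absurd hij.symm huw
    · rfl
    · exact absurd hij.symm (hxw l)
    · exact absurd hij.symm (hyw l)
    · exact absurd hij (hxu k)
    · exact absurd hij (hxw k)
    · rw [hx_mem (k := k) (l := l) (by rw [hij]; exact hxm l)]
    · obtain rfl := hx_mem (k := k) (l := l) (by rw [hij]; exact hym l)
      exact absurd hij (hxy' k)
    · exact absurd hij (hyu k)
    · exact absurd hij (hyw k)
    · obtain rfl := hx_mem (k := l) (l := k) (by rw [← hij]; exact hym k)
      exact absurd hij.symm (hxy' l)
    · rw [hy_mem (k := k) (l := l) (by rw [hij]; exact hym l)]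
  let inner : Fin 3 → V → Prop := fun k z => z ∈ (t k).support ∧ z ≠ y k ∧ z ≠ w
  let e : Fin 3 → Sym2 (Fin 8) := fun k => s(1, b k)
  have he_inj : ∀ k l, e k = e l → k = l := by decide
  have he_ne : ∀ k, e k ≠ s(0, 0) := by decide
  have huniq : ∀ k l z, inner k z → inner l z → k = l := by
    rintro k l z ⟨h1, h2, h3⟩ ⟨h4, -⟩
    by_contra hkl
    rcases hd k l hkl z (htm _ _ h1) (htm _ _ h4) with rfl | rfl
    · exact hut k h1
    · exact h3 rfl
  let lab : V → Sym2 (Fin 8) := fun z => if h : ∃ k, inner k z then e h.choose else s(0, 0)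
  have hlab : ∀ z k, lab z = e k ↔ inner k z := by
    intro z k
    simp only [lab]
    split_ifs with h
    · constructor
      · intro hk
        rw [← he_inj _ _ hk]
        exact h.choose_spec
      · intro hk
        rw [huniq _ _ _ hk h.choose_spec]
    · exact iff_of_false (he_ne k).symm fun hk => h ⟨k, hk⟩
  have hlab0 : ∀ z, (∀ k, ¬ inner k z) → lab z = s(0, 0) := fun z hz =>
    dif_neg (not_exists.2 hz)
  have hlab_range : ∀ z, lab z = s(0, 0) ∨ ∃ k, lab z = e k := by
    intro z
    by_cases h : ∃ k, inner k z
    · obtain ⟨k, hk⟩ := h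
      exact Or.inr ⟨k, (hlab z k).2 hk⟩
    · exact Or.inl (hlab0 z (not_exists.1 h))
  refine isConformalMinor_of_label hinj (r := Fin.val) Fin.val_injective lab ?_ ?_ ?_
  · intro i
    rw [hlab0]
    · exact fun h => A₁.loopless.irrefl _ h
    · rintro k ⟨h1, h2, h3⟩
      rcases hβ i with ⟨h, -⟩ | ⟨h, -⟩ | ⟨l, h, -⟩ | ⟨l, h, -⟩ <;> rw [h] at h1 h2 h3
      · exact hut k h1
      · exact h3 rfl
      · obtain rfl := hx_mem (htm _ _ h1)
        exact hxt l h1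
      · exact h2 (by rw [hy_mem (htm _ _ h1)])
  · intro i j hij hlt
    obtain ⟨k, ⟨rfl, rfl⟩ | ⟨rfl, rfl⟩ | ⟨rfl, rfl⟩⟩ : ∃ k, (i = 0 ∧ j = a k) ∨
        (i = a k ∧ j = b k) ∨ (i = 1 ∧ j = b k) := by
      revert i j
      decide
    · have h1 : ∀ z, lab z ≠ s(0, a k) := by
        intro z
        have d1 : s((0 : Fin 8), 0) ≠ s(0, a k) := by revert k; decide
        have d2 : ∀ l, e l ≠ s(0, a k) := by revert k; decide
        rcases hlab_range z with h | ⟨l, h⟩ <;> rw [h]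
        exacts [d1, d2 l]
      have hadj : G.Adj (β 0) (β (a k)) := by rw [hβx]; exact hux k
      refine ⟨hadj.toWalk, by simpa using hadj.ne, by simp, fun z => ?_⟩
      simp [h1]
    · have h1 : ∀ z, lab z ≠ s(a k, b k) := by
        intro z
        have d1 : s((0 : Fin 8), 0) ≠ s(a k, b k) := by revert k; decide
        have d2 : ∀ l, e l ≠ s(a k, b k) := by revert k; decide
        rcases hlab_range z with h | ⟨l, h⟩ <;> rw [h]
        exacts [d1, d2 l]
      have hadj : G.Adj (β (a k)) (β (b k)) := by rw [hβx, hβy]; exact hxy k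
      refine ⟨hadj.toWalk, by simpa using hadj.ne, by simp, fun z => ?_⟩
      simp [h1]
    · refine ⟨(t k).reverse.copy (show w = β 1 from rfl) (hβy k).symm, ?_, ?_, fun z => ?_⟩
      · rw [Walk.isPath_copy]
        exact (ht k).reverse
      · rw [Walk.length_copy, Walk.length_reverse]
        have := hodd k
        rw [← htl, Nat.odd_add] at this
        simpa using this
      · rw [Walk.support_copy, Walk.support_reverse, List.mem_reverse, hβy]
        change _ ↔ z = w ∨ z = y k ∨ lab z = e k
        rw [hlab]
        by_cases h1 : z = w
        · simp [h1, (t k).end_mem_support]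
        by_cases h2 : z = y k
        · simp [h2, (t k).start_mem_support]
        simp [inner, h1, h2]
  · suffices hset : {z | z ∉ Set.range β ∧ lab z ∉ A₁.edgeSet} =
        {z | ∀ k, z ∉ (p k).support} by rwa [hset]
    ext z
    have hee : ∀ k, e k ∈ A₁.edgeSet := by
      have : ∀ k, A₁.Adj 1 (b k) := by decide
      exact this
    constructor
    · rintro ⟨h1, h2⟩ k hk
      rw [hs, List.mem_cons, List.mem_cons] at hk
      rcases hk with hk | hk | hk
      · exact h1 ⟨0, hk.symm⟩
      · exact h1 ⟨a k, (hβx k).trans hk.symm⟩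
      · apply h2
        rw [(hlab z k).2 ⟨hk, fun h => h1 ⟨b k, (hβy k).trans h.symm⟩,
          fun h => h1 ⟨1, h.symm⟩⟩]
        exact hee k
    · intro hz
      refine ⟨?_, ?_⟩
      · rintro ⟨i, rfl⟩
        rcases hβ i with ⟨h, -⟩ | ⟨h, -⟩ | ⟨l, h, -⟩ | ⟨l, h, -⟩
        · exact hz 0 (by rw [h]; exact (p 0).start_mem_support)
        · exact hz 0 (by rw [h]; exact (p 0).end_mem_support)
        · exact hz l (h ▸ hxm l)
        · exact hz l (h ▸ hym l)
      · rw [hlab0 z fun k hk => hz k (htm _ _ hk.1)]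
        exact fun h => A₁.loopless.irrefl _ h

end Theta

/-! ### Pairs of chords that give conformal minors -/

namespace HamEnum

variable {V : Type*} {G : SimpleGraph V} {N : ℤ} {v : ℤ → V}

/-- Two chords at the vertex in position `0`. The vertices `1`, `2`, `4`, `6`, `7` of `A₂` are placed next
to other vertices, so that all but one of the edges in each of the parts of the cycle are not
subdivided. -/
lemma isConformalMinor_A₂ (hv : HamEnum G N v) (hN : Even N) {p q : ℤ} (hp : Odd p) (hq : Odd q)
    (hp2 : 1 < p) (hpq : p < q) (hqN : q < N - 1) (h1 : G.Adj (v 0) (v p))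
    (h2 : G.Adj (v 0) (v q)) : IsConformalMinor A₂ G := by
  have hp' := Int.odd_iff.1 hp
  have hq' := Int.odd_iff.1 hq
  have hN' := Int.even_iff.1 hN
  refine hv.isConformalMinor hN (m := 7) (by norm_num) (by decide)
    (t := ![0, 1, 2, p, p + 1, q, q + 1, q + 2]) ?_ rfl ?_ ?_ (by decide) ?_
  · rw [Fin.strictMono_iff_lt_succ]
    intro i
    fin_cases i <;> simp <;> omega
  · intro i
    fin_cases i <;> simp <;> omega
  · intro i
    rw [Int.even_iff, Nat.even_iff]
    fin_cases i <;> simp <;> omega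
  · intro i j hij hlt
    have : j = i + 1 ∨ i = j + 1 ∨ (i = 0 ∧ j = 3) ∨ (i = 0 ∧ j = 5) := by
      revert i j
      decide
    rcases this with h | h | ⟨rfl, rfl⟩ | ⟨rfl, rfl⟩
    exacts [Or.inl h, Or.inr (Or.inl h), Or.inr (Or.inr h1), Or.inr (Or.inr h2)]

/-- Two disjoint chords that do not cross and whose ends in even and in odd positions do not
alternate. -/
lemma isConformalMinor_A₃ (hv : HamEnum G N v) (hN : Even N) {p q s : ℤ} (hp : Odd p) (hq : Odd q)
    (hs : Even s) (hp2 : 1 < p) (hpq : p < q) (hqs : q + 1 < s) (hsN : s < N)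
    (h1 : G.Adj (v 0) (v p)) (h2 : G.Adj (v q) (v s)) : IsConformalMinor A₃ G := by
  have hp' := Int.odd_iff.1 hp
  have hq' := Int.odd_iff.1 hq
  have hs' := Int.even_iff.1 hs
  have hN' := Int.even_iff.1 hN
  refine hv.isConformalMinor hN (m := 9) (by norm_num) (by decide)
    (t := ![0, 1, 2, p, p + 1, q, q + 1, q + 2, s, s + 1]) ?_ rfl ?_ ?_ (by decide) ?_
  · rw [Fin.strictMono_iff_lt_succ]
    intro i
    fin_cases i <;> simp <;> omega
  · intro i
    fin_cases i <;> simp <;> omega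
  · intro i
    rw [Int.even_iff, Nat.even_iff]
    fin_cases i <;> simp <;> omega
  · intro i j hij hlt
    have : j = i + 1 ∨ i = j + 1 ∨ (i = 0 ∧ j = 3) ∨ (i = 5 ∧ j = 8) := by
      revert i j
      decide
    rcases this with h | h | ⟨rfl, rfl⟩ | ⟨rfl, rfl⟩
    exacts [Or.inl h, Or.inr (Or.inl h), Or.inr (Or.inr h1), Or.inr (Or.inr h2)]

/-- A bipartite graph with a Hamilton cycle of length six and its three long chords is `K₃,₃`. -/
lemma isConformalMinor_A₄ (hv : HamEnum G 6 v) (h0 : G.Adj (v 0) (v 3)) (h1 : G.Adj (v 1) (v 4))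
    (h2 : G.Adj (v 2) (v 5)) : IsConformalMinor A₄ G := by
  let t : Fin 3 ⊕ Fin 3 → ℤ := Sum.elim ![0, 2, 4] ![1, 3, 5]
  have ht : ∀ w, 0 ≤ t w ∧ t w < 6 := by decide
  have htinj : Function.Injective t := by decide
  have hβ : Function.Injective fun w => v (t w) := by
    intro w w' h
    have := ht w
    have := ht w'
    exact htinj (hv.inj h (by omega) (by omega))
  refine isConformalMinor_of_label hβ (r := fun w => (t w).toNat) ?_
    (fun _ => s(Sum.inl 0, Sum.inl 0)) ?_ ?_ ?_
  · intro w w' h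
    have := ht w
    have := ht w'
    simp only at h
    exact htinj (by omega)
  · exact fun _ h => A₄.loopless.irrefl _ h
  · intro i j hij _
    have hadj : G.Adj (v (t i)) (v (t j)) := by
      have key : ∀ i j : Fin 3, G.Adj (v (t (Sum.inl i))) (v (t (Sum.inr j))) := by
        have h6 := hv.adj 5
        rw [show v (5 + 1) = v 0 from hv.add_period 0] at h6
        intro i j
        fin_cases i <;> fin_cases j
        exacts [hv.adj 0, h0, h6.symm, (hv.adj 1).symm, hv.adj 2, h2, h1.symm, (hv.adj 3).symm,
          hv.adj 4]
      rcases i with i | i <;> rcases j with j | j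
      · simp [A₄] at hij
      · exact key i j
      · exact (key j i).symm
      · simp [A₄] at hij
    refine ⟨hadj.toWalk, by simpa using hadj.ne, by simp, fun z => ?_⟩
    have : s(Sum.inl 0, Sum.inl 0) ≠ s(i, j) := by
      intro h
      rcases Sym2.eq_iff.1 h with ⟨rfl, rfl⟩ | ⟨rfl, rfl⟩ <;> exact hij.ne rfl
    simp [this]
  · refine matchable_induce_of_eq_empty ?_
    rw [Set.eq_empty_iff_forall_notMem]
    rintro x ⟨hx, -⟩
    apply hx
    obtain ⟨i, hi, hi', rfl⟩ := hv.exists_range x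
    have : ∃ w, t w = i := by
      interval_cases i
      exacts [⟨Sum.inl 0, rfl⟩, ⟨Sum.inr 0, rfl⟩, ⟨Sum.inl 1, rfl⟩, ⟨Sum.inr 1, rfl⟩,
        ⟨Sum.inl 2, rfl⟩, ⟨Sum.inr 2, rfl⟩]
    obtain ⟨w, rfl⟩ := this
    exact ⟨w, rfl⟩

end HamEnum

namespace HamEnum

variable {V : Type*} {G : SimpleGraph V} {N : ℤ} {v : ℤ → V}

lemma matchable_induce_Ioo (hv : HamEnum G N v) {q : ℤ} (hN : Even N) (hq : Odd q) (hq0 : 0 ≤ q) :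
    Matchable (G.induce {z | ∃ x, q < x ∧ x < N ∧ v x = z}) := by
  classical
  rw [matchable_induce_iff]
  choose pos h0 h1 h2 using hv.exists_range
  have hpos : ∀ x, 0 ≤ x → x < N → pos (v x) = x := by
    intro x hx hx'
    have := h0 (v x)
    have := h1 (v x)
    exact hv.inj (h2 (v x)) (by omega) (by omega)
  have hN' := Int.even_iff.1 hN
  have hq' := Int.odd_iff.1 hq
  refine ⟨fun z => if pos z % 2 = 0 then v (pos z + 1) else v (pos z - 1), ?_⟩
  rintro _ ⟨x, hx, hx', rfl⟩
  have hx0 := hpos x (by omega) hx'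
  simp only [hx0]
  by_cases hx2 : x % 2 = 0
  · rw [if_pos hx2]
    refine ⟨⟨x + 1, by omega, by omega, rfl⟩, hv.adj x, ?_⟩
    rw [hpos (x + 1) (by omega) (by omega), if_neg (by omega), add_sub_cancel_right]
  · rw [if_neg hx2]
    refine ⟨⟨x - 1, by omega, by omega, rfl⟩, ?_, ?_⟩
    · have := (hv.adj (x - 1)).symm
      rwa [sub_add_cancel] at this
    · rw [hpos (x - 1) (by omega) (by omega), if_pos (by omega), sub_add_cancel]

/-- Let the chords `x₁x₂` and `y₁y₂` cross, with ends in the positions `0`, `s` and `p`, `q`. If the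
odd path between `y₁` and `x₂` is not a single edge, then it is one of three paths between these
vertices, which avoid exactly the inner vertices of the odd path between `y₂` and `x₁`. -/
lemma isConformalMinor_A₁_of_lt (hv : HamEnum G N v) (hN : Even N) {p s q : ℤ} (hp : Even p)
    (hs : Odd s) (hq : Odd q) (hp0 : 0 < p) (hps : p + 1 < s) (hsq : s < q) (hqN : q < N)
    (h1 : G.Adj (v 0) (v s)) (h2 : G.Adj (v p) (v q)) : IsConformalMinor A₁ G := by
  have hp' := Int.even_iff.1 hp
  have hs' := Int.odd_iff.1 hs
  have hq' := Int.odd_iff.1 hq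
  obtain ⟨a, ha, hal, has⟩ := hv.exists_walk (i := 0) (j := p) (by omega) (by omega)
  obtain ⟨b, hb, hbl, hbs⟩ := hv.exists_walk (i := p) (j := s) (by omega) (by omega)
  obtain ⟨c, hc, hcl, hcs⟩ := hv.exists_walk (i := s) (j := q) (by omega) (by omega)
  have hinj : ∀ {x y}, v x = v y → 0 ≤ x → x < N → 0 ≤ y → y < N → x = y :=
    fun h _ _ _ _ => hv.inj h (by omega) (by omega)
  let P : Fin 3 → G.Walk (v p) (v s) := ![b, a.reverse.concat h1, Walk.cons h2 c.reverse]
  have s0 : ∀ z, z ∈ (P 0).support ↔ ∃ x, p ≤ x ∧ x ≤ s ∧ v x = z := hbs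
  have s1 : ∀ z, z ∈ (P 1).support ↔ ∃ x, ((0 ≤ x ∧ x ≤ p) ∨ x = s) ∧ v x = z := by
    intro z
    change z ∈ (a.reverse.concat h1).support ↔ _
    rw [Walk.support_concat, Walk.support_reverse, List.mem_append, List.mem_reverse, has,
      List.mem_singleton]
    constructor
    · rintro (⟨x, h1, h2, rfl⟩ | rfl)
      exacts [⟨x, Or.inl ⟨h1, h2⟩, rfl⟩, ⟨s, Or.inr rfl, rfl⟩]
    · rintro ⟨x, ⟨h1, h2⟩ | rfl, rfl⟩
      exacts [Or.inl ⟨x, h1, h2, rfl⟩, Or.inr rfl]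
  have s2 : ∀ z, z ∈ (P 2).support ↔ ∃ x, ((s ≤ x ∧ x ≤ q) ∨ x = p) ∧ v x = z := by
    intro z
    change z ∈ (Walk.cons h2 c.reverse).support ↔ _
    rw [Walk.support_cons, Walk.support_reverse, List.mem_cons, List.mem_reverse, hcs]
    constructor
    · rintro (rfl | ⟨x, h1, h2, rfl⟩)
      exacts [⟨p, Or.inr rfl, rfl⟩, ⟨x, Or.inl ⟨h1, h2⟩, rfl⟩]
    · rintro ⟨x, ⟨h1, h2⟩ | rfl, rfl⟩
      exacts [Or.inr ⟨x, h1, h2, rfl⟩, Or.inl rfl]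
  have p1 : (P 1).IsPath := by
    refine ha.reverse.concat ?_ h1
    rw [Walk.support_reverse, List.mem_reverse, has]
    rintro ⟨x, h3, h4, h5⟩
    have := hinj h5 (by omega) (by omega) (by omega) (by omega)
    omega
  have p2 : (P 2).IsPath := by
    refine hc.reverse.cons ?_
    rw [Walk.support_reverse, List.mem_reverse, hcs]
    rintro ⟨x, h3, h4, h5⟩
    have := hinj h5 (by omega) (by omega) (by omega) (by omega)
    omega
  have l1 : ((P 1).length : ℤ) = p + 1 := by
    change ((a.reverse.concat h1).length : ℤ) = _
    rw [Walk.length_concat, Walk.length_reverse]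
    push_cast
    omega
  have l2 : ((P 2).length : ℤ) = q - s + 1 := by
    change ((Walk.cons h2 c.reverse).length : ℤ) = _
    rw [Walk.length_cons, Walk.length_reverse]
    push_cast
    omega
  have l0 : ((P 0).length : ℤ) = s - p := hbl
  have d01 : ∀ z, z ∈ (P 0).support → z ∈ (P 1).support → z = v p ∨ z = v s := by
    intro z hz hz'
    obtain ⟨x, h3, h4, rfl⟩ := (s0 _).1 hz
    obtain ⟨y, h5, h6⟩ := (s1 _).1 hz'
    have := hinj h6 (by omega) (by omega) (by omega) (by omega)
    obtain rfl | rfl : x = p ∨ x = s := by omega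
    exacts [Or.inl rfl, Or.inr rfl]
  have d02 : ∀ z, z ∈ (P 0).support → z ∈ (P 2).support → z = v p ∨ z = v s := by
    intro z hz hz'
    obtain ⟨x, h3, h4, rfl⟩ := (s0 _).1 hz
    obtain ⟨y, h5, h6⟩ := (s2 _).1 hz'
    have := hinj h6 (by omega) (by omega) (by omega) (by omega)
    obtain rfl | rfl : x = p ∨ x = s := by omega
    exacts [Or.inl rfl, Or.inr rfl]
  have d12 : ∀ z, z ∈ (P 1).support → z ∈ (P 2).support → z = v p ∨ z = v s := by
    intro z hz hz'
    obtain ⟨x, h3, rfl⟩ := (s1 _).1 hz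
    obtain ⟨y, h5, h6⟩ := (s2 _).1 hz'
    have := hinj h6 (by omega) (by omega) (by omega) (by omega)
    obtain rfl | rfl : x = p ∨ x = s := by omega
    exacts [Or.inl rfl, Or.inr rfl]
  refine isConformalMinor_A₁ P ?_ ?_ ?_ ?_ ?_
  · simp only [Fin.forall_fin_succ, IsEmpty.forall_iff, and_true]
    exact ⟨hb, p1, p2⟩
  · simp only [Fin.forall_fin_succ, IsEmpty.forall_iff, and_true]
    refine ⟨?_, ?_, ?_⟩ <;> rw [Nat.odd_iff]
    exacts [by omega, by change (P 1).length % 2 = 1; omega, by change (P 2).length % 2 = 1; omega]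
  · simp only [Fin.forall_fin_succ, IsEmpty.forall_iff, and_true]
    exact ⟨by omega, by change 3 ≤ (P 1).length; omega, by change 3 ≤ (P 2).length; omega⟩
  · intro k l hkl z hz hz'
    fin_cases k <;> fin_cases l
    exacts [absurd rfl hkl, d01 z hz hz', d02 z hz hz', d01 z hz' hz, absurd rfl hkl,
      d12 z hz hz', d02 z hz' hz, d12 z hz' hz, absurd rfl hkl]
  · suffices hset : {z | ∀ k, z ∉ (P k).support} = {z | ∃ x, q < x ∧ x < N ∧ v x = z} by
      rw [hset]
      exact hv.matchable_induce_Ioo hN hq (by omega)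
    ext z
    obtain ⟨x, hx, hx', rfl⟩ := hv.exists_range z
    constructor
    · intro hz
      refine ⟨x, ?_, hx', rfl⟩
      by_contra! hxq
      by_cases c1 : x ≤ p
      · exact hz 1 ((s1 _).2 ⟨x, Or.inl ⟨hx, c1⟩, rfl⟩)
      by_cases c2 : x ≤ s
      · exact hz 0 ((s0 _).2 ⟨x, by omega, c2, rfl⟩)
      · exact hz 2 ((s2 _).2 ⟨x, Or.inl ⟨by omega, hxq⟩, rfl⟩)
    · rintro ⟨y, h3, h4, h5⟩
      obtain rfl := hinj h5 (by omega) (by omega) hx hx'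
      have n0 : v y ∉ (P 0).support := by
        rw [s0]
        rintro ⟨y', h6, h7, h8⟩
        have := hinj h8 (by omega) (by omega) (by omega) (by omega)
        omega
      have n1 : v y ∉ (P 1).support := by
        rw [s1]
        rintro ⟨y', h6, h8⟩
        have := hinj h8 (by omega) (by omega) (by omega) (by omega)
        omega
      have n2 : v y ∉ (P 2).support := by
        rw [s2]
        rintro ⟨y', h6, h8⟩
        have := hinj h8 (by omega) (by omega) (by omega) (by omega)
        omega
      change ∀ k, v y ∉ (P k).support
      simp only [Fin.forall_fin_succ, IsEmpty.forall_iff, and_true]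
      exact ⟨n0, n1, n2⟩

/-- If two chords cross and one of the two odd paths between them is not a single edge, then there
is a conformal minor `A₁`. -/
lemma isConformalMinor_A₁_of_crossing (hv : HamEnum G N v) (hN : Even N) {p s q : ℤ} (hp : Even p)
    (hs : Odd s) (hq : Odd q) (hp0 : 0 < p) (hps : p < s) (hsq : s < q) (hqN : q < N)
    (h1 : G.Adj (v 0) (v s)) (h2 : G.Adj (v p) (v q)) (hgap : ¬ (s = p + 1 ∧ q = N - 1)) :
    IsConformalMinor A₁ G := by
  by_cases hgap' : s = p + 1
  · -- Starting at the vertex in position `s` exchanges the two odd paths.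
    refine (hv.shift s).isConformalMinor_A₁_of_lt hN (p := q - s) (s := N - s) (q := N - s + p)
      (hq.sub_odd hs) (hN.sub_odd hs) ((hN.sub_odd hs).add_even hp) (by omega) (by omega) (by omega)
      (by omega) ?_ ?_
    · simp only [zero_add, sub_add_cancel]
      rw [← zero_add N, hv.add_period]
      exact h1.symm
    · simp only [sub_add_cancel]
      rw [show N - s + p + s = p + N by ring, hv.add_period]
      exact h2.symm
  · exact hv.isConformalMinor_A₁_of_lt hN hp hs hq hp0 (by omega) hsq hqN h1 h2

end HamEnum

namespace CycleEnum

variable {V : Type*} {G : SimpleGraph V} {a : V} {C : G.Walk a a} {N : ℤ} {v : ℤ → V}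
  {c : V → Bool}

lemma ne_of_mem_chords (h : CycleEnum C N v) {i j : ℤ} (hi : 0 ≤ i) (hi' : i < N) (hj : 0 ≤ j)
    (hj' : j < N) (he : s(v i, v j) ∈ chords C) : j ≠ i + 1 ∧ i ≠ j + 1 ∧
      ¬ (i = 0 ∧ j = N - 1) ∧ ¬ (j = 0 ∧ i = N - 1) := by
  have h1 := he.2
  rw [h.mem_edges, h.ham.exists_eq_cycEdge_iff hi hi' hj hj'] at h1
  omega

/-- Two chords that are neither parallel nor strongly crossed lead to a conformal minor `A₁`, `A₂`
or `A₃`. -/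
lemma parallel_or_stronglyCrossed (h : CycleEnum C N v) (hc : ∀ x y, G.Adj x y → c x ≠ c y)
    (hA₁ : ¬ IsConformalMinor A₁ G) (hA₂ : ¬ IsConformalMinor A₂ G)
    (hA₃ : ¬ IsConformalMinor A₃ G) {e f : Sym2 V} (he : e ∈ chords C) (hf : f ∈ chords C)
    (hef : e ≠ f) : Parallel C c e f ∨ StronglyCrossed C c e f := by
  have hcC : IsColoring C c := fun x y hxy => hc _ _ (C.edges_subset_edgeSet hxy)
  obtain ⟨w, s, hw, hs0, hs, hs', rfl⟩ := h.exists_eq_mk_zero hc he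
  obtain ⟨p, q, hp, hp', hq, hq', hpe, hqo, rfl⟩ := hw.exists_of_mem_chords hc hf
  have hN := hw.ham.even_period (c := c) fun i => hc _ _ (hw.ham.adj i)
  have e1 := hw.ne_of_mem_chords le_rfl (by omega) hs0.le hs he
  have e2 := hw.ne_of_mem_chords hp hp' hq hq' hf
  have a1 : G.Adj (w 0) (w s) := he.1
  have a2 : G.Adj (w p) (w q) := hf.1
  have hps : p ≠ s := by rintro rfl; exact Int.not_even_iff_odd.2 hs' hpe
  have hpq : p ≠ q := by rintro rfl; exact Int.not_even_iff_odd.2 hqo hpe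
  have hq0 : q ≠ 0 := by rintro rfl; exact Int.not_even_iff_odd.2 hqo (by simp)
  -- The chords share the end in position `0`, or the one in position `s`.
  by_cases c1 : p = 0
  · subst c1
    exfalso
    have hsq : s ≠ q := by rintro rfl; exact hef rfl
    rcases hsq.lt_or_gt with hsq | hsq
    · exact hA₂ (hw.ham.isConformalMinor_A₂ hN hs' hqo (by omega) hsq (by omega) a1 a2)
    · exact hA₂ (hw.ham.isConformalMinor_A₂ hN hqo hs' (by omega) hsq (by omega) a2 a1)
  by_cases c2 : q = s
  · subst c2
    exfalso
    have b1 : G.Adj ((fun i => w (i + q)) 0) ((fun i => w (i + q)) (N - q)) := by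
      simp only [zero_add, sub_add_cancel]
      rw [← zero_add N, hw.ham.add_period]
      exact a1.symm
    rcases hpq.lt_or_gt with hpq | hpq
    · refine hA₂ ((hw.ham.shift q).isConformalMinor_A₂ hN (p := N - q) (q := p - q + N)
        (hN.sub_odd hqo) ((hpe.sub_odd hqo).add_even hN) (by omega) (by omega) (by omega) b1 ?_)
      simp only [zero_add]
      rw [show p - q + N + q = p + N by ring, hw.ham.add_period]
      exact a2.symm
    · refine hA₂ ((hw.ham.shift q).isConformalMinor_A₂ hN (p := p - q) (q := N - q)
        (hpe.sub_odd hqo) (hN.sub_odd hqo) (by omega) (by omega) (by omega) ?_ b1)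
      simp only [zero_add, sub_add_cancel]
      exact a2.symm
  have hpar : (CycLT 0 s p q ∨ CycLT q p s 0) → Parallel C c s(w 0, w s) s(w p, w q) :=
    (hw.parallel_iff hcC ⟨le_rfl, by omega, by simp⟩ ⟨by omega, hs, hs'⟩ ⟨hp, hp', hpe⟩
      ⟨hq, hq', hqo⟩).2
  by_cases hcr : (0 < p ∧ p < s ∧ s < q) ∨ (0 < q ∧ q < s ∧ s < p)
  · right
    obtain ⟨w', s', p', q', hw', h1, h2, h3, h4, h5, h6, h7, h8, h9⟩ :=
      hw.exists_crossing_positions hc hs' ⟨hpe, hp'⟩ ⟨hqo, hq'⟩ hcr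
    rw [h8] at he ⊢
    rw [h9] at hf ⊢
    by_cases hgap : s' = p' + 1 ∧ q' = N - 1
    · rw [hw'.stronglyCrossed_iff hcC ⟨le_rfl, by omega, by simp⟩ ⟨by omega, by omega, h6⟩
        ⟨by omega, by omega, h5⟩ ⟨by omega, by omega, h7⟩, hw'.mem_edges, hw'.mem_edges,
        hw'.ham.exists_eq_cycEdge_iff (by omega) (by omega) (by omega) (by omega),
        hw'.ham.exists_eq_cycEdge_iff (by omega) (by omega) (by omega) (by omega)]
      exact ⟨Or.inl (Or.inl ⟨h1, h2, h3⟩), by omega, by omega⟩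
    · exact absurd (hw'.ham.isConformalMinor_A₁_of_crossing hN h5 h6 h7 h1 h2 h3 h4 he.1 hf.1 hgap)
        hA₁
  left
  rcases lt_or_ge s p with hsp | hsp
  · have hsq : s < q := by omega
    rcases hpq.lt_or_gt with hpq | hpq
    · exact hpar (Or.inl (Or.inl ⟨hs0, hsp, hpq⟩))
    · exact absurd (hw.ham.isConformalMinor_A₃ hN hs' hqo hpe (by omega) hsq (by omega) hp' a1
        a2.symm) hA₃
  · have hqs : q < s := by omega
    rcases hpq.lt_or_gt with hpq | hpq
    · -- Starting at position `p` puts both ends of the first chord behind the second chord.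
      refine absurd ((hw.ham.shift p).isConformalMinor_A₃ hN (p := q - p) (q := s - p) (s := N - p)
        (hqo.sub_even hpe) (hs'.sub_even hpe) (hN.sub hpe) (by omega) (by omega) (by omega)
        (by omega) ?_ ?_) hA₃
      · simpa using a2
      · simp only [sub_add_cancel]
        rw [← zero_add N, hw.ham.add_period]
        exact a1.symm
    · exact hpar (Or.inr (Or.inr (Or.inr (Or.inr ⟨by omega, by omega, by omega⟩))))

/-- Two strongly crossed chords and a third chord that is parallel to or strongly crossed with each
of them are the three long chords of a cycle of length six. -/
lemma isConformalMinor_A₄_of_stronglyCrossed (h : CycleEnum C N v)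
    (hc : ∀ x y, G.Adj x y → c x ≠ c y) {e f g : Sym2 V} (he : e ∈ chords C) (hf : f ∈ chords C)
    (hg : g ∈ chords C) (hef : StronglyCrossed C c e f)
    (heg : Parallel C c e g ∨ StronglyCrossed C c e g)
    (hfg : Parallel C c f g ∨ StronglyCrossed C c f g) : IsConformalMinor A₄ G := by
  have hcC : IsColoring C c := fun x y hxy => hc _ _ (C.edges_subset_edgeSet hxy)
  obtain ⟨w, r, hw, hr, h2, h4, rfl, rfl⟩ := h.exists_stronglyCrossed_positions hc hcC he hf hef
  obtain ⟨p, q, hp, hp', hq, hq', hpe, hqo, rfl⟩ := hw.exists_of_mem_chords hc hg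
  have hN := hw.ham.even_period (c := c) fun i => hc _ _ (hw.ham.adj i)
  have p0 : 0 ≤ (0 : ℤ) ∧ 0 < N ∧ Even (0 : ℤ) := ⟨le_rfl, by omega, by simp⟩
  have p1 : 0 ≤ r + 1 ∧ r + 1 < N ∧ Odd (r + 1) := ⟨by omega, by omega, hr.add_one⟩
  have p2 : 0 ≤ r ∧ r < N ∧ Even r := ⟨by omega, by omega, hr⟩
  have p3 : 0 ≤ N - 1 ∧ N - 1 < N ∧ Odd (N - 1) := ⟨by omega, by omega, hN.sub_odd odd_one⟩
  rw [hw.parallel_iff hcC p0 p1 ⟨hp, hp', hpe⟩ ⟨hq, hq', hqo⟩,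
    hw.stronglyCrossed_iff hcC p0 p1 ⟨hp, hp', hpe⟩ ⟨hq, hq', hqo⟩, hw.mem_edges, hw.mem_edges,
    hw.ham.exists_eq_cycEdge_iff (by omega) (by omega) (by omega) (by omega),
    hw.ham.exists_eq_cycEdge_iff (by omega) (by omega) (by omega) (by omega)] at heg
  rw [hw.parallel_iff hcC p2 p3 ⟨hp, hp', hpe⟩ ⟨hq, hq', hqo⟩,
    hw.stronglyCrossed_iff hcC p2 p3 ⟨hp, hp', hpe⟩ ⟨hq, hq', hqo⟩, hw.mem_edges, hw.mem_edges,
    hw.ham.exists_eq_cycEdge_iff (by omega) (by omega) (by omega) (by omega),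
    hw.ham.exists_eq_cycEdge_iff (by omega) (by omega) (by omega) (by omega)] at hfg
  have hpq : p % 2 = 0 ∧ q % 2 = 1 ∧ r % 2 = 0 ∧ N % 2 = 0 :=
    ⟨Int.even_iff.1 hpe, Int.odd_iff.1 hqo, Int.even_iff.1 hr, Int.even_iff.1 hN⟩
  unfold CycLT at heg hfg
  obtain ⟨hq1, hp4, hr2, hN6⟩ : q = 1 ∧ p = 4 ∧ r = 2 ∧ N = 6 := by
    rcases heg with heg | ⟨-, heg⟩ <;> rcases hfg with hfg | ⟨-, hfg⟩
    · omega
    · omega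
    · omega
    · omega
  subst hq1 hp4 hr2 hN6
  exact hw.ham.isConformalMinor_A₄ he.1 hg.1.symm hf.1

/-- A Hamilton cycle whose chords are pairwise parallel or strongly crossed, without conformal minor
`A₄`. -/
lemma isB₂_or_isB₃ [DecidableEq V] (h : CycleEnum C N v) (hC : C.IsHamiltonianCycle)
    (hb : G.IsBipartite) (hc : ∀ x y, G.Adj x y → c x ≠ c y) (hA₁ : ¬ IsConformalMinor A₁ G)
    (hA₂ : ¬ IsConformalMinor A₂ G) (hA₃ : ¬ IsConformalMinor A₃ G)
    (hA₄ : ¬ IsConformalMinor A₄ G) : IsB₂ G ∨ IsB₃ G := by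
  have hcC : IsColoring C c := fun x y hxy => hc _ _ (C.edges_subset_edgeSet hxy)
  have key := fun {e f} => h.parallel_or_stronglyCrossed hc hA₁ hA₂ hA₃ (e := e) (f := f)
  by_cases hcr : ∃ e ∈ chords C, ∃ f ∈ chords C, e ≠ f ∧ StronglyCrossed C c e f
  · obtain ⟨e, he, f, hf, hef, hst⟩ := hcr
    refine Or.inl ⟨a, C, c, hC, hcC, e, f, hef, Set.Subset.antisymm (fun g hg => ?_) ?_, hst⟩
    · by_contra hg'
      rw [Set.mem_insert_iff, Set.mem_singleton_iff, not_or] at hg'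
      exact hA₄ (h.isConformalMinor_A₄_of_stronglyCrossed hc he hf hg hst
        (key he hg (Ne.symm hg'.1)) (key hf hg (Ne.symm hg'.2)))
    · rintro g (rfl | rfl)
      exacts [he, hf]
  · refine Or.inr ⟨hb, a, C, c, hC, hcC, fun e he f hf hef => ?_⟩
    exact (key he hf hef).resolve_right fun hst => hcr ⟨e, he, f, hf, hef, hst⟩

end CycleEnum

/-! ### The existence of a Hamilton cycle -/

variable {V : Type*} {G : SimpleGraph V} {c : V → Bool}

lemma odd_length_of_color_ne (hc : ∀ x y, G.Adj x y → c x ≠ c y) {x y : V} (p : G.Walk x y)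
    (hxy : c x ≠ c y) : Odd p.length := by
  have := (Coloring.mk c fun {x y} h => hc x y h).odd_length_iff_not_congr p
  rw [this]
  change ¬ c x = true ↔ c y = true
  revert hxy
  cases c x <;> cases c y <;> simp

/-- Let `m` be a perfect matching of `G - X`, and let `m'` be a perfect matching of `G` that joins
`u ∈ X` to a vertex outside `X`. The alternating path that starts with the edge of `m'` at `u` ends
with an edge of `m'` when it first returns to `X`. -/
lemma exists_ear [Finite V] (hc : ∀ x y, G.Adj x y → c x ≠ c y) {X : Set V} {m m' : V → V}
    (hm : ∀ x ∈ Xᶜ, m x ∈ Xᶜ ∧ G.Adj x (m x) ∧ m (m x) = x) (hm' : IsMate G m') {u : V}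
    (hu : u ∈ X) (hmu : m' u ∉ X) : ∃ (w : V) (P : G.Walk u w), w ∈ X ∧ u ≠ w ∧ P.IsPath ∧
      Odd P.length ∧ 3 ≤ P.length ∧ (∀ z ∈ P.support, z ∈ X → z = u ∨ z = w) ∧
      Matchable (G.induce {z | z ∉ X ∧ z ∉ P.support}) := by
  classical
  have := Fintype.ofFinite V
  by_contra hcon
  -- The alternating path can be prolonged as long as it does not return to `X`.
  have key : ∀ n : ℕ, ∃ (y : V) (Q : G.Walk u y), Q.IsPath ∧ Q.length = 2 * n ∧
      (∀ z ∈ Q.support, z ∈ X → z = u) ∧ (∀ z ∈ Q.support, z ≠ u → m z ∈ Q.support) ∧ c y = c u ∧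
      ∀ z ∈ Q.support, c z ≠ c u → m' z ∈ Q.support ∧ m' z ≠ y := by
    intro n
    induction n with
    | zero =>
      refine ⟨u, Walk.nil, by simp, by simp, by simp, ?_, rfl, ?_⟩
      · intro z hz hzu
        exact absurd (by simpa using hz) hzu
      · intro z hz hzu
        rw [show z = u by simpa using hz] at hzu
        exact absurd rfl hzu
    | succ n ih =>
      obtain ⟨y, Q, hQ, hl, hX, hmQ, hcy, hQ'⟩ := ih
      have hyz := (hm' y).1
      have hcz : c (m' y) ≠ c u := by
        rw [← hcy]
        exact (hc _ _ hyz).symm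
      by_cases hz : m' y ∈ X
      · exfalso
        have hzQ : m' y ∉ Q.support := fun h => hcz (by rw [hX _ h hz])
        have hn : n ≠ 0 := by
          rintro rfl
          have hnil : u = y := Walk.eq_of_length_eq_zero (by rw [hl])
          rw [← hnil] at hz
          exact hmu hz
        refine hcon ⟨_, Q.concat hyz, hz, fun h => hcz (by rw [← h]), hQ.concat hzQ hyz, ?_, ?_, ?_,
          ?_⟩
        · rw [Walk.length_concat, hl]
          exact ⟨n, rfl⟩
        · rw [Walk.length_concat, hl]
          omega
        · intro z hzs hzX
          rw [Walk.support_concat, List.mem_append, List.mem_singleton] at hzs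
          exact hzs.imp (fun h => hX z h hzX) id
        · rw [matchable_induce_iff]
          refine ⟨m, fun z hzm => ?_⟩
          obtain ⟨hzX, hzs⟩ := hzm
          obtain ⟨h1, h2, h3⟩ := hm z hzX
          refine ⟨⟨h1, fun h4 => hzs ?_⟩, h2, h3⟩
          rw [Walk.support_concat, List.mem_append, List.mem_singleton] at h4 ⊢
          rcases h4 with h4 | h4
          · left
            rw [← h3]
            exact hmQ _ h4 fun h5 => h1 (by rw [h5]; exact hu)
          · exact absurd (by rw [h4]; exact hz) h1
      · have hzQ : m' y ∉ Q.support := by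
          intro h
          exact (hQ' _ h hcz).2 (hm' y).2
        obtain ⟨h1, h2, h3⟩ := hm _ hz
        have hct : c (m (m' y)) = c u := by
          have := hc _ _ h2
          revert this hcz
          cases c (m (m' y)) <;> cases c (m' y) <;> cases c u <;> decide
        have htQ : m (m' y) ∉ Q.support := by
          intro h
          have h4 := hmQ _ h fun h5 => h1 (by rw [h5]; exact hu)
          rw [h3] at h4
          exact hzQ h4
        have hQ1 := hQ.concat hzQ hyz
        have hs1 : ∀ x, x ∈ (Q.concat hyz).support ↔ x ∈ Q.support ∨ x = m' y := by
          intro x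
          rw [Walk.support_concat, List.mem_append, List.mem_singleton]
        have hs2 : ∀ x, x ∈ ((Q.concat hyz).concat h2).support ↔
            (x ∈ Q.support ∨ x = m' y) ∨ x = m (m' y) := by
          intro x
          rw [Walk.support_concat, List.mem_append, List.mem_singleton, hs1]
        refine ⟨_, (Q.concat hyz).concat h2, hQ1.concat ?_ h2, ?_, ?_, ?_, hct, ?_⟩
        · rw [hs1, not_or]
          exact ⟨htQ, h2.ne'⟩
        · rw [Walk.length_concat, Walk.length_concat, hl]
          ring
        · intro x hx hxX
          rcases (hs2 x).1 hx with (h | rfl) | rfl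
          exacts [hX x h hxX, absurd hxX hz, absurd hxX h1]
        · intro x hx hxu
          rw [hs2]
          rcases (hs2 x).1 hx with (h | rfl) | rfl
          exacts [Or.inl (Or.inl (hmQ x h hxu)), Or.inr rfl, Or.inl (Or.inr h3)]
        · intro x hx hxc
          rw [hs2]
          rcases (hs2 x).1 hx with (h | rfl) | rfl
          · obtain ⟨h4, h5⟩ := hQ' x h hxc
            exact ⟨Or.inl (Or.inl h4), fun h6 => htQ (by rw [← h6]; exact h4)⟩
          · rw [(hm' y).2]
            exact ⟨Or.inl (Or.inl Q.end_mem_support),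
              fun h6 => htQ (by rw [← h6]; exact Q.end_mem_support)⟩
          · exact absurd hct hxc
  obtain ⟨y, Q, hQ, hl, -⟩ := key (Fintype.card V)
  have := hQ.length_lt
  omega

/-- Two vertices of a cycle divide it into two paths. -/
lemma exists_isPath_isPath_of_isCycle [DecidableEq V] {a : V} {C : G.Walk a a} (hC : C.IsCycle)
    {x w : V} (hx : x ∈ C.support) (hw : w ∈ C.support) (hxw : x ≠ w) :
    ∃ Q R : G.Walk x w, Q.IsPath ∧ R.IsPath ∧
      (∀ z, z ∈ Q.support → z ∈ R.support → z = x ∨ z = w) ∧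
      (∀ z, z ∈ C.support ↔ z ∈ Q.support ∨ z ∈ R.support) ∧ Q.length + R.length = C.length := by
  have hC' := hC.rotate hx
  have hw' : w ∈ (C.rotate x hx).support := (C.mem_support_rotate_iff x hx).2 hw
  have hspec := (C.rotate x hx).take_spec hw'
  have hmem := fun z => C.mem_support_rotate_iff (w := z) x hx
  have hlen := C.length_rotate x hx
  generalize C.rotate x hx = D at *
  generalize D.takeUntil w hw' = Q at *
  generalize D.dropUntil w hw' = R at *
  subst hspec
  have hQ : ¬ Q.Nil := Walk.not_nil_of_ne hxw
  have hR : ¬ R.Nil := Walk.not_nil_of_ne hxw.symm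
  refine ⟨Q, R.reverse, hC'.isPath_of_append_left hR, (hC'.isPath_of_append_right hQ).reverse,
    fun z hz hz' => ?_, fun z => ?_, ?_⟩
  · have hnd := hC'.support_nodup
    rw [Walk.tail_support_append, List.nodup_append'] at hnd
    rw [Walk.support_reverse, List.mem_reverse] at hz'
    rw [Walk.mem_support_iff] at hz hz'
    rcases hz with hz | hz
    · exact Or.inl hz
    rcases hz' with hz' | hz'
    · exact Or.inr hz'
    exact absurd hz' (hnd.2.2 hz)
  · rw [Walk.support_reverse, List.mem_reverse, ← hmem, Walk.mem_support_append_iff]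
  · rw [Walk.length_reverse, ← hlen, Walk.length_append]

lemma isCycle_append_reverse {x w : V} {P R : G.Walk x w} (hP : P.IsPath) (hR : R.IsPath)
    (h : ∀ z, z ∈ P.support → z ∈ R.support → z = x ∨ z = w) (hl : 1 < P.length) :
    (P.append R.reverse).IsCycle := by
  refine hP.isCycle_append hR.reverse (fun z hz hz' => ?_) (Or.inl hl)
  have hzR := List.mem_of_mem_tail hz'
  rw [Walk.support_reverse, List.mem_reverse] at hzR
  have h1 := hP.support_nodup
  have h2 := hR.reverse.support_nodup
  rw [← Walk.cons_tail_support, List.nodup_cons] at h1 h2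
  rcases h z (List.mem_of_mem_tail hz) hzR with rfl | rfl
  exacts [h1.1 hz, h2.1 hz']

/-- In a matching covered graph, every set of vertices other than the empty set and the set of all
vertices is left by an edge of a perfect matching. -/
lemma MatchingCovered.exists_mate_notMem (h : MatchingCovered G) {X : Set V} {x y : V} (hx : x ∈ X)
    (hy : y ∉ X) : ∃ m, IsMate G m ∧ ∃ u ∈ X, m u ∉ X := by
  obtain ⟨p⟩ := h.1.preconnected x y
  obtain ⟨d, -, hd1, hd2⟩ := p.exists_boundary_dart X hx hy
  obtain ⟨M, hM, hdM⟩ := h.2 s(d.fst, d.snd) d.adj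
  obtain ⟨m, hm, rfl⟩ := mem_perfectMatchings_iff_mate.1 hM
  exact ⟨m, hm, d.fst, hd1, by rwa [hm.mk_mem.1 hdM]⟩

/-- A longest conformal cycle is a Hamilton cycle: otherwise it has an ear, whose ends divide it into
two paths. If both of them have length at least three, then there is a conformal minor `A₁`, and
otherwise the ear forms a longer conformal cycle with one of them. -/
theorem exists_isHamiltonianCycle [Fintype V] [DecidableEq V] (hG : MatchingCovered G)
    (hc : ∀ x y, G.Adj x y → c x ≠ c y) (hcard : 4 ≤ Fintype.card V)
    (hA₁ : ¬ IsConformalMinor A₁ G) : ∃ (a : V) (C : G.Walk a a), C.IsHamiltonianCycle := by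
  have hne : Nontrivial V := Fintype.one_lt_card_iff_nontrivial.1 (by omega)
  let L : Set ℕ := {n | ∃ (a : V) (C : G.Walk a a), C.IsCycle ∧
    Matchable (G.induce {z | z ∉ C.support}) ∧ C.length = n}
  have hbdd : ∀ n ∈ L, n ≤ Fintype.card V := by
    rintro _ ⟨a, C, hC, -, rfl⟩
    have := hC.support_nodup.length_le_card
    simpa using this
  have hcyc : ∀ {x w : V} {P R : G.Walk x w}, P.IsPath → R.IsPath → 1 < P.length →
      (∀ z, z ∈ P.support → z ∈ R.support → z = x ∨ z = w) →
      Matchable (G.induce {z | z ∉ P.support ∧ z ∉ R.support}) → P.length + R.length ∈ L := by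
    intro x w P R hP hR hl hd hrest
    refine ⟨x, _, isCycle_append_reverse hP hR hd hl, ?_, by simp⟩
    suffices hset : {z | z ∉ (P.append R.reverse).support} =
        {z | z ∉ P.support ∧ z ∉ R.support} by rwa [hset]
    ext z
    change ¬ _ ↔ ¬ _ ∧ ¬ _
    rw [Walk.mem_support_append_iff, Walk.support_reverse, List.mem_reverse, not_or]
  have hLne : L.Nonempty := by
    obtain ⟨m, hm⟩ := matchable_iff_mate.1 hG.matchable
    obtain ⟨x⟩ := hne.to_nonempty
    -- The first ear is added to an edge of the perfect matching `m`.
    obtain ⟨y, hy⟩ : ∃ y, y ∉ ({x, m x} : Set V) := by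
      by_contra! hh
      have h1 : (Finset.univ : Finset V) ⊆ {x, m x} := fun z _ => by simpa using hh z
      have h2 := Finset.card_le_card h1
      have h3 := Finset.card_le_two (a := x) (b := m x)
      rw [Finset.card_univ] at h2
      omega
    obtain ⟨m', hm', u, hu, hu'⟩ := hG.exists_mate_notMem (X := {x, m x}) (x := x) (by simp) hy
    have hmX : ∀ z ∈ ({x, m x} : Set V), m z ∈ ({x, m x} : Set V) := by
      rintro z (rfl | rfl)
      · simp
      · rw [(hm x).2]
        simp
    obtain ⟨w, P, hw, huw, hP, hodd, h3, hd, hrest⟩ := exists_ear hc (m := m)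
      (fun z hz => ⟨fun h => hz (by rw [← (hm z).2]; exact hmX _ h), (hm z).1, (hm z).2⟩)
      hm' hu hu'
    have hadj : G.Adj u w := by
      rcases hu with rfl | rfl <;> rcases hw with rfl | rfl
      exacts [absurd rfl huw, (hm _).1, (hm _).1.symm, absurd rfl huw]
    refine ⟨_, hcyc hP (R := hadj.toWalk) (by simpa using huw) (by omega) ?_ ?_⟩
    · intro z _ hz
      simpa using hz
    · suffices hset : {z | z ∉ P.support ∧ z ∉ hadj.toWalk.support} =
          {z | z ∉ ({x, m x} : Set V) ∧ z ∉ P.support} by rwa [hset]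
      ext z
      have hX : z ∈ ({x, m x} : Set V) ↔ z ∈ hadj.toWalk.support := by
        simp only [Set.mem_insert_iff, Set.mem_singleton_iff, Walk.support_cons, Walk.support_nil,
          List.mem_cons, List.not_mem_nil, or_false]
        rcases hu with rfl | rfl <;> rcases hw with rfl | rfl
        exacts [absurd rfl huw, Iff.rfl, or_comm, absurd rfl huw]
      change _ ∧ _ ↔ _ ∧ _
      rw [hX, and_comm]
  obtain ⟨n, ⟨a, C, hC, hrest, rfl⟩, hmax⟩ : ∃ n ∈ L, ∀ k ∈ L, k ≤ n := by
    have hfin : L.Finite := (Set.finite_Iic (Fintype.card V)).subset hbdd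
    obtain ⟨n, hn⟩ := hfin.exists_maximal hLne
    exact ⟨n, hn.1, fun k hk => le_of_not_gt fun hlt => absurd (hn.2 hk hlt.le) (not_le.2 hlt)⟩
  refine ⟨a, C, Walk.isHamiltonianCycle_iff_isCycle_and_length_eq.2 ⟨hC, ?_⟩⟩
  by_contra hlen
  obtain ⟨y, hy⟩ : ∃ y, y ∉ C.support := by
    by_contra! hh
    have h1 : (Finset.univ : Finset V) ⊆ C.support.tail.toFinset := fun z _ => by
      rw [List.mem_toFinset]
      rcases C.mem_support_iff.1 (hh z) with rfl | h
      exacts [C.end_mem_tail_support hC.not_nil, h]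
    have h2 := Finset.card_le_card h1
    rw [Finset.card_univ, List.toFinset_card_of_nodup hC.support_nodup] at h2
    have h3 := hbdd _ ⟨a, C, hC, hrest, rfl⟩
    simp only [List.length_tail, Walk.length_support, Nat.add_sub_cancel] at h2
    omega
  obtain ⟨m', hm', u, hu, hu'⟩ := hG.exists_mate_notMem (X := {z | z ∈ C.support})
    C.start_mem_support hy
  obtain ⟨m, hm⟩ := matchable_induce_iff.1 hrest
  obtain ⟨w, P, hw, huw, hP, hodd, h3, hd, hrest'⟩ := exists_ear hc hm hm' hu hu'
  obtain ⟨Q, R, hQ, hR, hQR, hs, hl⟩ := exists_isPath_isPath_of_isCycle hC hu hw huw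
  have hcw : c u ≠ c w := by
    intro h
    have := ((Coloring.mk c fun {x y} h => hc x y h).odd_length_iff_not_congr P).1 hodd
    change ¬ c u = true ↔ c w = true at this
    rw [h] at this
    exact not_iff_self this
  have hoQ := odd_length_of_color_ne hc Q hcw
  have hoR := odd_length_of_color_ne hc R hcw
  have hPQ : ∀ z, z ∈ P.support → z ∈ Q.support → z = u ∨ z = w :=
    fun z hz hz' => hd z hz ((hs z).2 (Or.inl hz'))
  have hPR : ∀ z, z ∈ P.support → z ∈ R.support → z = u ∨ z = w :=
    fun z hz hz' => hd z hz ((hs z).2 (Or.inr hz'))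
  -- A path of length one has no inner vertices.
  have hshort : ∀ {T : G.Walk u w}, T.length ≤ 1 → ∀ z, z ∈ T.support → z = u ∨ z = w := by
    intro T hT z hz
    obtain ⟨i, rfl, hi⟩ := Walk.mem_support_iff_exists_getVert.1 hz
    rcases Nat.eq_zero_or_pos i with rfl | h0
    · left
      simp
    · right
      rw [show i = T.length by omega, Walk.getVert_length]
  by_cases h1 : 3 ≤ Q.length
  · by_cases h2 : 3 ≤ R.length
    · refine hA₁ (isConformalMinor_A₁ ![P, Q, R] ?_ ?_ ?_ ?_ ?_)
      · simp only [Fin.forall_fin_succ, IsEmpty.forall_iff, and_true]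
        exact ⟨hP, hQ, hR⟩
      · simp only [Fin.forall_fin_succ, IsEmpty.forall_iff, and_true]
        exact ⟨hodd, hoQ, hoR⟩
      · simp only [Fin.forall_fin_succ, IsEmpty.forall_iff, and_true]
        exact ⟨h3, h1, h2⟩
      · intro k l hkl z hz hz'
        fin_cases k <;> fin_cases l
        exacts [absurd rfl hkl, hPQ z hz hz', hPR z hz hz', hPQ z hz' hz, absurd rfl hkl,
          hQR z hz hz', hPR z hz' hz, hQR z hz' hz, absurd rfl hkl]
      · suffices hset : {z | ∀ k, z ∉ ((![P, Q, R] : Fin 3 → G.Walk u w) k).support} =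
            {z | z ∉ {z | z ∈ C.support} ∧ z ∉ P.support} by rwa [hset]
        ext z
        change (∀ k, z ∉ ((![P, Q, R] : Fin 3 → G.Walk u w) k).support) ↔ z ∉ C.support ∧ _
        simp only [Fin.forall_fin_succ, IsEmpty.forall_iff, and_true, hs]
        change z ∉ P.support ∧ z ∉ Q.support ∧ z ∉ R.support ↔ _
        tauto
    · obtain ⟨k, hk⟩ := hoR
      refine absurd (hmax _ (hcyc hP hQ (by omega) hPQ ?_)) (by omega)
      suffices hset : {z | z ∉ P.support ∧ z ∉ Q.support} =
          {z | z ∉ {z | z ∈ C.support} ∧ z ∉ P.support} by rwa [hset]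
      ext z
      change _ ↔ z ∉ C.support ∧ _
      rw [hs]
      have h4 : z ∈ R.support → z ∈ P.support := by
        intro hz
        rcases hshort (by omega) z hz with rfl | rfl
        exacts [P.start_mem_support, P.end_mem_support]
      change _ ∧ _ ↔ _
      tauto
  · obtain ⟨k, hk⟩ := hoQ
    refine absurd (hmax _ (hcyc hP hR (by omega) hPR ?_)) (by omega)
    suffices hset : {z | z ∉ P.support ∧ z ∉ R.support} =
        {z | z ∉ {z | z ∈ C.support} ∧ z ∉ P.support} by rwa [hset]
    ext z
    change _ ↔ z ∉ C.support ∧ _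
    rw [hs]
    have h4 : z ∈ Q.support → z ∈ P.support := by
      intro hz
      rcases hshort (by omega) z hz with rfl | rfl
      exacts [P.start_mem_support, P.end_mem_support]
    change _ ∧ _ ↔ _
    tauto

end ForcingGraphs

theorem theorem3p1 {V : Type*} [Fintype V] [DecidableEq V] (G : SimpleGraph V)
    (hmc : ForcingGraphs.MatchingCovered G) (hb : G.IsBipartite) (hcard : 4 ≤ Fintype.card V) :
    List.TFAE
      [ForcingGraphs.StronglyUniform G,
        ¬ ForcingGraphs.IsConformalMinor ForcingGraphs.A₁ G ∧
          ¬ ForcingGraphs.IsConformalMinor ForcingGraphs.A₂ G ∧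
          ¬ ForcingGraphs.IsConformalMinor ForcingGraphs.A₃ G ∧
          ¬ ForcingGraphs.IsConformalMinor ForcingGraphs.A₄ G,
        ForcingGraphs.IsB₀ G ∨ ForcingGraphs.IsB₁ G ∨ ForcingGraphs.IsB₂ G ∨
          ForcingGraphs.IsB₃ G] := by
  have : Nontrivial V := Fintype.one_lt_card_iff_nontrivial.1 (by omega)
  obtain ⟨c, hc⟩ : ∃ c : V → Bool, ∀ x y, G.Adj x y → c x ≠ c y := by
    obtain ⟨col⟩ := hb
    exact ⟨finTwoEquiv ∘ col, fun x y hxy h => col.valid hxy (finTwoEquiv.injective h)⟩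
  tfae_have 1 → 2 := fun h => h.not_isConformalMinor_A
  tfae_have 2 → 3 := by
    rintro ⟨hA₁, hA₂, hA₃, hA₄⟩
    obtain ⟨a, C, hC⟩ := ForcingGraphs.exists_isHamiltonianCycle hmc hc hcard hA₁
    obtain ⟨v, hv⟩ := ForcingGraphs.CycleEnum.exists_of_isHamiltonianCycle hC
    exact Or.inr (Or.inr (hv.isB₂_or_isB₃ hC hb hc hA₁ hA₂ hA₃ hA₄))
  tfae_have 3 → 1 := ForcingGraphs.stronglyUniform_of_isB hc hmc.matchable
  tfae_finish
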